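/- Model. Base stations (BSs) form a homogeneous Poisson point process $\Phi_B$ of intensity $\lambda_B>0$ on $\mathbb{R}^2$; the typical user is at the origin $o$. Each BS carries independent marks, independent of the locations and i.i.d. across BSs except that the link type depends on the BS's distance and the fading law on the link type, as follows. The link from a BS at $x$ to $o$ is line-of-sight (type $L$) with probability $C\in[0,1]$ if $\|x\|\le D$ and with probability $0$ if $\|x\|>D$, where $D>0$; otherwise it is of type $N$. A link of type $j\in\{L,N\}$ has path loss $L(x,o)=C_j\|x\|^{-\alpha_j}$ with $C_j,\alpha_j>0$, and a small-scale gain $h_{xo}\sim\mathrm{gamma}(N_j,1)$ (shape $N_j$, scale $1$), where $N_j\ge1$ is an integer. It is assumed that $C_ND^{-\alpha_N}\le C_LD^{-\alpha_L}$. The user is served by the BS $x^*=\arg\max_{x\in\Phi_B}L(x,o)$. Every other BS has an independent boresight angle, uniform on $[-180^\circ,180^\circ]$. If the absolute value of the angle is at most $\theta_b\in[0^\circ,180^\circ]$, the BS radiates its confidential signal towards $o$ with power $p_s=M_s\phi P_t$; otherwise it radiates artificial noise towards $o$ with power $p_a=M_a(1-\phi)P_t$. The two probabilities are $\mathrm{Pr}_x(s)=\theta_b/180$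 and $\mathrm{Pr}_x(a)=(180-\theta_b)/180$. Here $P_t,M_s>0$, $M_a\ge0$, $0<\phi\le1$. Let $\Phi_I$ and $\Phi_A$ be the two sets of interfering BSs $y\neq x^*$ obtained in this way, let $N_0>0$, $T_c>0$, and $$\mathrm{SINR}_U=\frac{\phi P_tM_sh_{x^*o}L(x^*,o)}{I_B+N_0},\qquad I_B=\sum_{y\in\Phi_I}p_s\,h_{yo}L(y,o)+\sum_{y\in\Phi_A}p_a\,h_{yo}L(y,o)$$ (with $\mathrm{SINR}_U=0$ if $I_B=\infty$). Notation. For $r\ge0$ let $\rho_N(r)=\left(\frac{C_N}{C_L}\right)^{1/\alpha_N}r^{\alpha_L/\alpha_N}$, $\rho_L(r)=\left(\frac{C_L}{C_N}\right)^{1/\alpha_L}r^{\alpha_N/\alpha_L}$, $\mu=\rho_N(D)$, and $$A_N=\int_0^{\mu}\left(e^{-\pi C\lambda_B\rho_L(x)^2}-e^{-\pi C\lambda_BD^2}\right)2\pi(1-C)\lambda_Bx\,e^{-\pi(1-C)\lambda_Bx^2}dx+e^{-\pi C\lambda_BD^2},\qquad A_L=1-A_N$$ (the probabilities of being served by a BS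 of type $N$, $L$). For $r\in[0,D]$, $$f_{r_L}(r)=\frac{1}{A_L}e^{-(1-C)\lambda_B\pi\rho_N(r)^2}\,2\pi C\lambda_Br\,e^{-C\lambda_B\pi r^2}$$ (read as $0$ if $A_L=0$, i.e. $C=0$), and for $r\ge0$ $$f_{r_N}(r)=\frac{2\pi\lambda_Bre^{-\pi\lambda_Br^2}\left((1-C)e^{\pi C\lambda_B(r^2-D^2)}\mathbb{I}(r\le D)+\mathbb{I}(r\ge D)\right)}{A_N}+\frac{2\pi(1-C)\lambda_Bre^{-(1-C)\lambda_B\pi r^2}\left(e^{-C\lambda_B\pi\rho_L(r)^2}-e^{-C\lambda_B\pi D^2}\right)}{A_N}\mathbb{I}(r\le\mu).$$ For $j\in\{L,N\}$ let $a_j=(N_j!)^{-1/N_j}$ and $\Theta_j(n)=\frac{T_c\,n\,a_j}{\phi P_tM_sC_j}$. For $i\in\{s,a\}$ and $0\le v\le w\le\infty$ let $$F_{j,i}(c,d;y)=1-\frac{1}{\left(1+c\,d\,p_i\,C_j\,y^{-\alpha_j}\right)^{N_j}},\qquad \Delta_{j,i}(z,v,w,c,d)=\exp\left(-2\pi z\lambda_B\mathrm{Pr}_x(i)\int_v^{w}F_{j,i}(c,d;y)\,y\,dy\right),$$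 with $e^{-\infty}=0$ and $0\cdot\infty=0$. For $i\in\{s,a\}$ put $$\varpi_i(n)=\Delta_{L,i}\left(C,r,D,\Theta_L(n),r^{\alpha_L}\right)\Delta_{N,i}\left(1-C,\min(\rho_N(r),D),D,\Theta_L(n),r^{\alpha_L}\right)\Delta_{N,i}\left(1,\max(\rho_N(r),D),\infty,\Theta_L(n),r^{\alpha_L}\right),$$ $$\varphi_i(n)=\Delta_{L,i}\left(C,\min(\rho_L(r),D),D,\Theta_N(n),r^{\alpha_N}\right)\Delta_{N,i}\left(1-C,\min(r,D),D,\Theta_N(n),r^{\alpha_N}\right)\Delta_{N,i}\left(1,\max(r,D),\infty,\Theta_N(n),r^{\alpha_N}\right),$$ $$\Xi_L(r)=\sum_{n=1}^{N_L}(-1)^{n+1}\binom{N_L}{n}e^{-\Theta_L(n)r^{\alpha_L}N_0}\varpi_s(n)\varpi_a(n),\qquad \Xi_N(r)=\sum_{n=1}^{N_N}(-1)^{n+1}\binom{N_N}{n}e^{-\Theta_N(n)r^{\alpha_N}N_0}\varphi_s(n)\varphi_a(n).$$ Theorem 6. The functions $\Xi_Lf_{r_L}$ and $\Xi_Nf_{r_N}$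 are integrable on $(0,D]$ and $(0,\infty)$, and the connection probability satisfies $$p_{con}=\Pr(\mathrm{SINR}_U\ge T_c)\le A_L\int_0^D\Xi_L(r)f_{r_L}(r)\,dr+A_N\int_0^{\infty}\Xi_N(r)f_{r_N}(r)\,dr.$$ -/

import Mathlib

open MeasureTheory ProbabilityTheory

noncomputable section

namespace MmWave

/-- The plane in which base stations (BSs) live; the typical user is at the origin. -/
abbrev Plane := EuclideanSpace ℝ (Fin 2)

/-- A radio link is line-of-sight or non-line-of-sight. -/
inductive Link
  | los
  | nlos

/-- A BS radiates its confidential signal inside its main sector, and artificial noise (AN)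
outside it. -/
inductive Sector
  | signal
  | noise

/-! ### Poisson point processes -/

/-- Number of points of the configuration `(X i ω)ᵢ` in the set `B`. -/
def count {Ω E : Type*} (X : ℕ → Ω → E) (B : Set E) (ω : Ω) : ℕ∞ :=
  {i | X i ω ∈ B}.encard

/-- The points `X 0, X 1, …` enumerate a Poisson point process of intensity measure `Λ`: counts in
sets of finite intensity are Poisson distributed, and counts in disjoint sets are independent.
(A process enumerated by `ℕ` has infinitely many points, which is almost surely the case when
`Λ` has infinite total mass.) -/
structure IsPoissonProcess {Ω E : Type*} [MeasurableSpace Ω] [MeasurableSpace E]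
    (P : Measure Ω) (X : ℕ → Ω → E) (Λ : Measure E) : Prop where
  measurable : ∀ i, Measurable (X i)
  hasLaw_count : ∀ B : Set E, MeasurableSet B → Λ B ≠ ⊤ →
    HasLaw (count X B) ((poissonMeasure (Λ B).toNNReal).map (Nat.cast : ℕ → ℕ∞)) P
  indep_count : ∀ (n : ℕ) (B : Fin n → Set E), (∀ k, MeasurableSet (B k)) → (∀ k, Λ (B k) ≠ ⊤) →
    Pairwise (fun k l => Disjoint (B k) (B l)) → iIndepFun (fun k => count X (B k)) P

/-! ### The network -/

/-- The numerical parameters of the network. -/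
structure Params where
  /-- intensity of the BS process -/
  lam : ℝ
  /-- probability that a link of length at most `D` is LOS -/
  C : ℝ
  /-- radius of the LOS ball -/
  D : ℝ
  /-- path-loss intercepts `C_L`, `C_N` -/
  coef : Link → ℝ
  /-- path-loss exponents `α_L`, `α_N` -/
  expo : Link → ℝ
  /-- Nakagami parameters `N_L`, `N_N` -/
  nak : Link → ℕ
  /-- total transmit power of a BS -/
  Pt : ℝ
  /-- main lobe gain of the confidential signal -/
  Ms : ℝ
  /-- main lobe gain of the AN -/
  Ma : ℝ
  /-- fraction of the power that is given to the confidential signal -/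
  phi : ℝ
  /-- beam width of the confidential signal, in degrees -/
  thetab : ℝ
  /-- noise power -/
  N0 : ℝ

/-- The random objects of the network. The link from the BS `i` to the origin carries a blockage
variable, the angle (in degrees) between the boresight of the BS and the origin, and one
small-scale fading gain for either type of the link. -/
structure Network (Ω : Type*) where
  loc : ℕ → Ω → Plane
  block : ℕ → Ω → ℝ
  angle : ℕ → Ω → ℝ
  fade : Link → ℕ → Ω → ℝ

/-- The marks of the BS `i`. -/
def Network.mark {Ω : Type*} (S : Network Ω) (i : ℕ) (ω : Ω) : ℝ × ℝ × ℝ × ℝ :=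
  (S.block i ω, S.angle i ω, S.fade Link.los i ω, S.fade Link.nlos i ω)

/-- The uniform distribution on `[a, b]`. -/
def uniformLaw (a b : ℝ) : Measure ℝ := cond volume (Set.Icc a b)

/-- The probabilistic model: the BSs form a homogeneous Poisson point process; the marks of
different BSs are i.i.d. and independent of the locations; for one BS, the blockage variable is
uniform on `[0, 1]`, the angle is uniform on `[-180, 180]`, the power gains of the Nakagami fading
are gamma distributed with shape `N_L` resp. `N_N` and scale `1`, and all of these are
independent. -/
structure IsModel (p : Params) {Ω : Type*} [MeasurableSpace Ω] (P : Measure Ω) (S : Network Ω) :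
    Prop where
  poisson : IsPoissonProcess P S.loc (ENNReal.ofReal p.lam • (volume : Measure Plane))
  measurable_mark : ∀ i, Measurable (S.mark i)
  hasLaw_mark : ∀ i, HasLaw (S.mark i)
    ((uniformLaw 0 1).prod ((uniformLaw (-180) 180).prod
      ((gammaMeasure (p.nak Link.los) 1).prod (gammaMeasure (p.nak Link.nlos) 1)))) P
  iIndep_mark : iIndepFun S.mark P
  indep_loc_mark : IndepFun (fun ω i => S.loc i ω) (fun ω i => S.mark i ω) P

section Model

variable (p : Params) {Ω : Type*} (S : Network Ω)

/-- Probability `q_L(r)` that a link of length `r` is LOS. -/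
def losProb (r : ℝ) : ℝ := if r ≤ p.D then p.C else 0

/-- Type of the link from the BS `i` to the typical user: given the locations, it is LOS with
probability `q_L` of its length. -/
def link (i : ℕ) (ω : Ω) : Link :=
  if S.block i ω < losProb p ‖S.loc i ω‖ then Link.los else Link.nlos

/-- What the BS `i` radiates towards the typical user when it does not serve that user. -/
def sector (i : ℕ) (ω : Ω) : Sector :=
  if |S.angle i ω| ≤ p.thetab then Sector.signal else Sector.noise

/-- Effective power radiated inside and outside the main sector, `M_s φ P_t` and
`M_a (1 - φ) P_t`. -/
def power : Sector → ℝ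
  | Sector.signal => p.Ms * p.phi * p.Pt
  | Sector.noise => p.Ma * (1 - p.phi) * p.Pt

/-- Probability of either sector, `θ_b / 180` and `(180 - θ_b) / 180`. -/
def sectorProb : Sector → ℝ
  | Sector.signal => p.thetab / 180
  | Sector.noise => (180 - p.thetab) / 180

/-- The path loss `L(x, o) = C_j ‖x‖ ^ (-α_j)` of the link from the BS `i` to the typical user. -/
def pathLoss (i : ℕ) (ω : Ω) : ℝ :=
  p.coef (link p S i ω) * ‖S.loc i ω‖ ^ (-p.expo (link p S i ω))

/-- Small-scale channel gain of the link from the BS `i` to the typical user. -/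
def fading (i : ℕ) (ω : Ω) : ℝ := S.fade (link p S i ω) i ω

/-- The BS `i` serves the typical user: it maximizes `L(x, o)`. -/
def Serves (i : ℕ) (ω : Ω) : Prop := ∀ k, pathLoss p S k ω ≤ pathLoss p S i ω

/-- Interference at the typical user when it is served by the BS `i`; it is `⊤` when the series
diverges. -/
def interference (i : ℕ) (ω : Ω) : ENNReal :=
  ∑' k : {k : ℕ // k ≠ i},
    ENNReal.ofReal (power p (sector p S k ω) * fading p S k ω * pathLoss p S k ω)

/-- SINR of the typical user when it is served by the BS `i`. -/
def sinr (i : ℕ) (ω : Ω) : ENNReal :=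
  ENNReal.ofReal (p.phi * p.Pt * p.Ms * fading p S i ω * pathLoss p S i ω) /
    (interference p S i ω + ENNReal.ofReal p.N0)

/-- The connection probability `Pr (SINR_U ≥ T_c)`. -/
def connProb [MeasurableSpace Ω] (P : Measure Ω) (Tc : ℝ) : ℝ :=
  P.real {ω | ∃ i, Serves p S i ω ∧ ENNReal.ofReal Tc ≤ sinr p S i ω}

end Model

/-! ### The analytical expressions -/

section Formulas

open Real

variable (p : Params)

/-- Distance at which a NLOS BS has the same path loss as a LOS BS at distance `r`. -/
def toNlos (r : ℝ) : ℝ :=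
  (p.coef Link.nlos / p.coef Link.los) ^ (1 / p.expo Link.nlos) *
    r ^ (p.expo Link.los / p.expo Link.nlos)

/-- Distance at which a LOS BS has the same path loss as a NLOS BS at distance `r`. -/
def toLos (r : ℝ) : ℝ :=
  (p.coef Link.los / p.coef Link.nlos) ^ (1 / p.expo Link.los) *
    r ^ (p.expo Link.nlos / p.expo Link.los)

/-- Probability `A_N` of being served by a NLOS BS. -/
def assocN : ℝ :=
  (∫ x in (0 : ℝ)..toNlos p p.D,
    (exp (-(π * p.C * p.lam * toLos p x ^ 2)) - exp (-(π * p.C * p.lam * p.D ^ 2))) *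
      (2 * π * (1 - p.C) * p.lam * x) * exp (-(π * (1 - p.C) * p.lam * x ^ 2))) +
    exp (-(π * p.C * p.lam * p.D ^ 2))

/-- Probability `A_L` of being served by a LOS BS. -/
def assocL : ℝ := 1 - assocN p

/-- Density `f_{r_L}` on `[0, D]` of the distance to the serving BS, given that it is LOS. -/
def pdfL (r : ℝ) : ℝ :=
  exp (-((1 - p.C) * p.lam * π * toNlos p r ^ 2)) *
    (2 * π * p.C * p.lam * r * exp (-(p.C * p.lam * π * r ^ 2))) / assocL p

/-- Density `f_{r_N}` on `[0, ∞)` of the distance to the serving BS, given that it is NLOS. -/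
def pdfN (r : ℝ) : ℝ :=
  2 * π * p.lam * r * exp (-(π * p.lam * r ^ 2)) *
      ((1 - p.C) * exp (π * p.C * p.lam * (r ^ 2 - p.D ^ 2)) * (if r ≤ p.D then 1 else 0) +
        (if p.D ≤ r then 1 else 0)) / assocN p +
    2 * π * (1 - p.C) * p.lam * r * exp (-((1 - p.C) * p.lam * π * r ^ 2)) *
      (exp (-(p.C * p.lam * π * toLos p r ^ 2)) - exp (-(p.C * p.lam * π * p.D ^ 2))) /
        assocN p * (if r ≤ toNlos p p.D then 1 else 0)

/-- `a_j = (N_j !) ^ (-1 / N_j)`. -/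
def alzer (j : Link) : ℝ := ((p.nak j).factorial : ℝ) ^ (-(1 / (p.nak j : ℝ)))

/-- `Θ_j(n)`. -/
def Theta (Tc : ℝ) (j : Link) (n : ℕ) : ℝ :=
  Tc * n * alzer p j / (p.phi * p.Pt * p.Ms * p.coef j)

/-- `F_j`, for interferers with link type `j`, sector `s` and distance `y`. -/
def F (j : Link) (s : Sector) (c d y : ℝ) : ℝ :=
  1 - 1 / (1 + c * d * power p s * p.coef j * y ^ (-p.expo j)) ^ p.nak j

/-- `Δ_j`, for interferers with link type `j` and sector `s` whose distance ranges over the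
interval `I`: the exponential of `-2 π z λ_B Pr(s) ∫_I F_j y dy`, with `exp (-∞) = 0`. -/
def Delta (j : Link) (s : Sector) (z : ℝ) (I : Set ℝ) (c d : ℝ) : ℝ :=
  (EReal.exp (-((ENNReal.ofReal (2 * π * z * p.lam * sectorProb p s) *
    ∫⁻ y in I, ENNReal.ofReal (F p j s c d y * y) : ENNReal) : EReal))).toReal

/-- `ϖ₁ ϖ₂ ϖ₃` for interferers in the sector `s`. -/
def varpi (Tc r : ℝ) (s : Sector) (n : ℕ) : ℝ :=
  Delta p Link.los s p.C (Set.Ioc r p.D) (Theta p Tc Link.los n) (r ^ p.expo Link.los) *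
  Delta p Link.nlos s (1 - p.C) (Set.Ioc (min (toNlos p r) p.D) p.D)
    (Theta p Tc Link.los n) (r ^ p.expo Link.los) *
  Delta p Link.nlos s 1 (Set.Ioi (max (toNlos p r) p.D))
    (Theta p Tc Link.los n) (r ^ p.expo Link.los)

/-- `φ₁ φ₂ φ₃` for interferers in the sector `s`. -/
def varphi (Tc r : ℝ) (s : Sector) (n : ℕ) : ℝ :=
  Delta p Link.los s p.C (Set.Ioc (min (toLos p r) p.D) p.D)
    (Theta p Tc Link.nlos n) (r ^ p.expo Link.nlos) *
  Delta p Link.nlos s (1 - p.C) (Set.Ioc (min r p.D) p.D)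
    (Theta p Tc Link.nlos n) (r ^ p.expo Link.nlos) *
  Delta p Link.nlos s 1 (Set.Ioi (max r p.D))
    (Theta p Tc Link.nlos n) (r ^ p.expo Link.nlos)

/-- `Ξ_L`. -/
def XiL (Tc r : ℝ) : ℝ :=
  ∑ n ∈ Finset.Icc 1 (p.nak Link.los), (-1 : ℝ) ^ (n + 1) * ((p.nak Link.los).choose n : ℝ) *
    exp (-(Theta p Tc Link.los n * r ^ p.expo Link.los * p.N0)) *
    varpi p Tc r Sector.signal n * varpi p Tc r Sector.noise n

/-- `Ξ_N`. -/
def XiN (Tc r : ℝ) : ℝ :=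
  ∑ n ∈ Finset.Icc 1 (p.nak Link.nlos), (-1 : ℝ) ^ (n + 1) * ((p.nak Link.nlos).choose n : ℝ) *
    exp (-(Theta p Tc Link.nlos n * r ^ p.expo Link.nlos * p.N0)) *
    varphi p Tc r Sector.signal n * varphi p Tc r Sector.noise n

end Formulas

end MmWave

end

/-!
Summing over the candidates for the serving base station turns the connection event into a
disjoint union, and the Mecke formula makes the candidate a fixed base station at distance `r`,
independent of the remaining Poisson process. The requirement that no other base station is
stronger is encoded as an infinite contribution to the exponent of a Laplace functional, so that
one exponential formula for marked Poisson processes evaluates both the density of the serving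
distance and the Laplace transform of the interference. The tail of the gamma law of the serving
gain is bounded by Alzer's inequality `P (h > t) ≤ 1 - (1 - exp (-a * t)) ^ N`, and the binomial
expansion of the right-hand side yields the alternating sums `Ξ_L` and `Ξ_N`. Moving the even
terms to the left-hand side keeps the computation in `[0, ∞]` until all terms are known to be
finite.
-/

open MeasureTheory ProbabilityTheory

noncomputable section

namespace MmWave

open Filter Set
open scoped ENNReal Topology

section NegExp

/-- `exp (-x)` for `x ∈ [0, ∞]`, with `exp (-∞) = 0`; Laplace transforms of sums that may diverge
are expectations of this function. -/
def nexp (x : ℝ≥0∞) : ℝ≥0∞ := EReal.exp (-(x : EReal))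

/-- The inverse of `nexp` on `[0, 1]`, which turns products of numbers in `[0, 1]` into sums. -/
def nlog (u : ℝ≥0∞) : ℝ≥0∞ := (-ENNReal.log u).toENNReal

@[simp] lemma nexp_zero : nexp 0 = 1 := by simp [nexp]

@[simp] lemma nexp_top : nexp ⊤ = 0 := by simp [nexp]

lemma nexp_antitone : Antitone nexp := fun _ _ h =>
  EReal.exp_monotone (EReal.neg_le_neg_iff.2 (EReal.coe_ennreal_le_coe_ennreal_iff.2 h))

lemma nexp_le_one (x : ℝ≥0∞) : nexp x ≤ 1 := nexp_zero ▸ nexp_antitone (zero_le (a := x))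

lemma nexp_ne_top (x : ℝ≥0∞) : nexp x ≠ ⊤ := ((nexp_le_one x).trans_lt ENNReal.one_lt_top).ne

lemma nexp_add (a b : ℝ≥0∞) : nexp (a + b) = nexp a * nexp b := by
  rw [nexp, nexp, nexp, ← EReal.exp_add, EReal.coe_ennreal_add, EReal.neg_add, sub_eq_add_neg]
  · exact .inl (EReal.coe_ennreal_ne_bot a)
  · exact .inr (EReal.coe_ennreal_ne_bot b)

lemma continuous_nexp : Continuous nexp :=
  ENNReal.continuous_exp.comp (continuous_neg.comp continuous_coe_ennreal_ereal)

lemma measurable_nexp : Measurable nexp := continuous_nexp.measurable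

lemma nexp_ofReal {a : ℝ} (ha : 0 ≤ a) :
    nexp (ENNReal.ofReal a) = ENNReal.ofReal (Real.exp (-a)) := by
  rw [nexp, EReal.coe_ennreal_ofReal, max_eq_left ha, ← EReal.coe_neg, EReal.exp_coe]

lemma nexp_sum {ι : Type*} (s : Finset ι) (f : ι → ℝ≥0∞) :
    nexp (∑ i ∈ s, f i) = ∏ i ∈ s, nexp (f i) := by
  classical
  induction s using Finset.induction_on with
  | empty => simp
  | insert a s ha ih => rw [Finset.sum_insert ha, Finset.prod_insert ha, nexp_add, ih]

lemma nexp_natCast_mul (n : ℕ) (x : ℝ≥0∞) : nexp (n * x) = nexp x ^ n := by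
  simpa using nexp_sum (Finset.range n) fun _ => x

lemma tendsto_prod_nexp {ι : Type*} (f : ι → ℝ≥0∞) :
    Tendsto (fun s : Finset ι => ∏ i ∈ s, nexp (f i)) atTop (𝓝 (nexp (∑' i, f i))) := by
  simp_rw [← nexp_sum]
  exact (continuous_nexp.tendsto _).comp ENNReal.summable.hasSum

lemma nexp_nlog {u : ℝ≥0∞} (hu : u ≤ 1) : nexp (nlog u) = u := by
  rw [nexp, nlog, EReal.coe_toENNReal, neg_neg, ENNReal.exp_log]
  exact EReal.neg_nonneg.2 (ENNReal.log_le_zero_iff.2 hu)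

lemma nlog_antitone : Antitone nlog := fun _ _ h =>
  EReal.toENNReal_le_toENNReal (EReal.neg_le_neg_iff.2 (ENNReal.log_monotone h))

lemma measurable_nlog : Measurable nlog :=
  (continuous_neg.measurable.comp ENNReal.measurable_log).ereal_toENNReal

end NegExp

section Counts

variable {Ω E : Type*}

lemma coe_count (X : ℕ → Ω → E) (B : Set E) (ω : Ω) :
    (count X B ω : ℝ≥0∞) = ∑' k, B.indicator 1 (X k ω) := by
  rw [count, ← ENNReal.tsum_set_one, tsum_subtype _ fun _ => (1 : ℝ≥0∞)]
  rfl

lemma tsum_ne_indicator_eq_count_sub_one {X : ℕ → Ω → E} {B : Set E} {i : ℕ} {ω : Ω}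
    (hi : X i ω ∈ B) :
    ∑' k : {k // k ≠ i}, B.indicator (1 : E → ℝ≥0∞) (X k ω) = ((count X B ω - 1 : ℕ∞) : ℝ≥0∞) := by
  rw [count, ← Set.encard_sdiff_singleton_of_mem (show i ∈ {k | X k ω ∈ B} from hi),
    ← ENNReal.tsum_set_one, tsum_subtype _ fun _ => (1 : ℝ≥0∞)]
  refine (tsum_subtype {k | k ≠ i} fun k => B.indicator (1 : E → ℝ≥0∞) (X k ω)).trans ?_
  refine tsum_congr fun k => ?_
  by_cases hk : k = i <;> by_cases hB : X k ω ∈ B <;> simp [hk, hB, hi]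

lemma indicator_nexp_tsum_ne {X : ℕ → Ω → E} {f f₀ : E → ℝ≥0∞} {A : Set E} {c : ℝ≥0∞}
    (hsplit : ∀ y, f y = c * A.indicator 1 y + f₀ y) (hf₀ : ∀ y ∈ A, f₀ y = 0) (i : ℕ) (ω : Ω) :
    (X i ⁻¹' A).indicator (fun ω => nexp (∑' k : {k // k ≠ i}, f (X k ω))) ω =
      A.indicator 1 (X i ω) *
        (nexp (c * (count X A ω - 1 : ℕ∞)) * nexp (∑' k, f₀ (X k ω))) := by
  by_cases hi : X i ω ∈ A
  · rw [indicator_of_mem (show ω ∈ X i ⁻¹' A from hi), indicator_of_mem hi, Pi.one_apply, one_mul,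
      ← nexp_add, ← tsum_ne_indicator_eq_count_sub_one hi, ← ENNReal.tsum_mul_left]
    simp_rw [hsplit, ENNReal.tsum_add]
    congr 2
    exact tsum_subtype_eq_of_support_subset (f := fun k => f₀ (X k ω)) fun k hk hki =>
      hk (hf₀ _ (hki ▸ hi))
  · simp [hi]

variable [MeasurableSpace E]

-- The value `0` is left out since its level set may have infinite intensity.
lemma tsum_simpleFunc_eq_sum_count (X : ℕ → Ω → E) (f : SimpleFunc E ℝ≥0∞) (ω : Ω) :
    ∑' k, f (X k ω) =
      ∑ d : {d // d ∈ f.range.erase 0}, (d : ℝ≥0∞) * count X (f ⁻¹' {(d : ℝ≥0∞)}) ω := by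
  have hf : ∀ y, f y =
      ∑ d : {d // d ∈ f.range.erase 0}, (d : ℝ≥0∞) * (f ⁻¹' {(d : ℝ≥0∞)}).indicator 1 y := by
    intro y
    rw [Finset.sum_coe_sort (f.range.erase 0) fun d => d * (f ⁻¹' {d}).indicator 1 y,
      Finset.sum_erase _ (zero_mul _),
      Finset.sum_eq_single_of_mem (f y) (SimpleFunc.mem_range_self f y)]
    · simp
    · intro d _ hd
      simp [hd.symm]
  simp_rw [coe_count, ← ENNReal.tsum_mul_left]
  rw [← Summable.tsum_finsetSum fun _ _ => ENNReal.summable]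
  exact tsum_congr fun k => hf _

lemma measurable_count [MeasurableSpace Ω] {X : ℕ → Ω → E} (hX : ∀ i, Measurable (X i))
    {B : Set E} (hB : MeasurableSet B) : Measurable (count X B) := by
  have hcast : Measurable fun ω => (count X B ω : ℝ≥0∞) := by
    simp_rw [coe_count]
    exact Measurable.tsum fun i => (measurable_one.indicator hB).comp (hX i)
  refine measurable_to_countable' fun n => ?_
  have hpre : count X B ⁻¹' {n} = (fun ω => (count X B ω : ℝ≥0∞)) ⁻¹' {(n : ℝ≥0∞)} := by
    ext ω; simp
  exact hpre ▸ hcast (measurableSet_singleton _)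

end Counts

section Poisson

variable {Ω E : Type*} [MeasurableSpace Ω] [MeasurableSpace E] {P : Measure Ω}
  {X : ℕ → Ω → E} {Λ : Measure E}

lemma IsPoissonProcess.lintegral_comp_count (hX : IsPoissonProcess P X Λ) {B : Set E}
    (hB : MeasurableSet B) (hΛ : Λ B ≠ ⊤) (g : ℕ∞ → ℝ≥0∞) :
    ∫⁻ ω, g (count X B ω) ∂P = ∑' n : ℕ,
      ENNReal.ofReal (Real.exp (-(Λ B).toReal) * (Λ B).toReal ^ n / n.factorial) * g n := by
  rw [(hX.hasLaw_count B hB hΛ).lintegral_comp (measurable_of_countable g).aemeasurable,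
    lintegral_map (measurable_of_countable g) (measurable_of_countable _), lintegral_countable']
  refine tsum_congr fun n => ?_
  rw [poissonMeasure_singleton, mul_comm]
  rfl

lemma IsPoissonProcess.lintegral_nexp_mul_count (hX : IsPoissonProcess P X Λ) {B : Set E}
    (hB : MeasurableSet B) (hΛ : Λ B ≠ ⊤) (c : ℝ≥0∞) :
    ∫⁻ ω, nexp (c * count X B ω) ∂P = nexp ((1 - nexp c) * Λ B) := by
  rw [hX.lintegral_comp_count hB hΛ fun n => nexp (c * n)]
  have hu1 : (nexp c).toReal ≤ 1 :=
    ENNReal.toReal_le_of_le_ofReal zero_le_one (by simpa using nexp_le_one c)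
  have hcu : nexp c = ENNReal.ofReal (nexp c).toReal := (ENNReal.ofReal_toReal (nexp_ne_top c)).symm
  have hΛl : Λ B = ENNReal.ofReal (Λ B).toReal := (ENNReal.ofReal_toReal hΛ).symm
  have hl0 : 0 ≤ (Λ B).toReal := ENNReal.toReal_nonneg
  have hu0 : 0 ≤ (nexp c).toReal := ENNReal.toReal_nonneg
  generalize (nexp c).toReal = u at hu0 hu1 hcu
  generalize (Λ B).toReal = l at hl0 hΛl ⊢
  have hterm : ∀ n : ℕ, ENNReal.ofReal (Real.exp (-l) * l ^ n / n.factorial) *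
      nexp (c * ((n : ℕ∞) : ℝ≥0∞)) =
      ENNReal.ofReal (Real.exp (-l) * ((l * u) ^ n / n.factorial)) := fun n => by
    rw [ENat.toENNReal_coe, mul_comm c, nexp_natCast_mul, hcu, ← ENNReal.ofReal_pow hu0,
      ← ENNReal.ofReal_mul (by positivity)]
    congr 1
    rw [mul_pow]
    ring
  have hsum : HasSum (fun n : ℕ => Real.exp (-l) * ((l * u) ^ n / n.factorial))
      (Real.exp (-l) * Real.exp (l * u)) := by
    rw [Real.exp_eq_exp_ℝ]
    exact (NormedSpace.expSeries_div_hasSum_exp (l * u)).mul_left _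
  simp_rw [hterm]
  rw [← ENNReal.ofReal_tsum_of_nonneg (fun n => by positivity) hsum.summable, hsum.tsum_eq, hcu,
    hΛl, ← ENNReal.ofReal_one, ← ENNReal.ofReal_sub _ hu0, ← ENNReal.ofReal_mul (by linarith),
    nexp_ofReal (mul_nonneg (by linarith) hl0), ← Real.exp_add]
  congr 2
  ring

-- The shift `n ↦ n + 1` in the Poisson weights is what makes the Mecke formula work.
lemma IsPoissonProcess.lintegral_count_mul_nexp (hX : IsPoissonProcess P X Λ) {B : Set E}
    (hB : MeasurableSet B) (hΛ : Λ B ≠ ⊤) (c : ℝ≥0∞) :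
    ∫⁻ ω, count X B ω * nexp (c * (count X B ω - 1 : ℕ∞)) ∂P =
      Λ B * ∫⁻ ω, nexp (c * count X B ω) ∂P := by
  rw [hX.lintegral_comp_count hB hΛ fun n => nexp (c * n),
    hX.lintegral_comp_count hB hΛ fun n => n * nexp (c * (n - 1 : ℕ∞)),
    tsum_eq_zero_add' ENNReal.summable, ← ENNReal.tsum_mul_left]
  simp only [Nat.cast_zero, ENat.toENNReal_zero, zero_mul, mul_zero, zero_add]
  refine tsum_congr fun n => ?_
  have hpred : (((n + 1 : ℕ) : ℕ∞) - 1 : ℕ∞) = n := by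
    simpa using (ENat.natCast_sub (n + 1) 1).symm
  rw [hpred, ← mul_assoc, ← mul_assoc]
  congr 1
  rw [ENat.toENNReal_coe, ← ENNReal.ofReal_natCast (n + 1), ← ENNReal.ofReal_mul (by positivity)]
  nth_rw 3 [← ENNReal.ofReal_toReal hΛ]
  rw [← ENNReal.ofReal_mul ENNReal.toReal_nonneg]
  congr 1
  rw [Nat.factorial_succ]
  push_cast
  field_simp
  ring

lemma IsPoissonProcess.lintegral_prod_count (hX : IsPoissonProcess P X Λ) {ι : Type*} [Fintype ι]
    {B : ι → Set E} (hB : ∀ k, MeasurableSet (B k)) (hΛ : ∀ k, Λ (B k) ≠ ⊤)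
    (hdisj : Pairwise fun k l => Disjoint (B k) (B l)) (g : ι → ℕ∞ → ℝ≥0∞) :
    ∫⁻ ω, ∏ k, g k (count X (B k) ω) ∂P = ∏ k, ∫⁻ ω, g k (count X (B k) ω) ∂P := by
  have e := Fintype.equivFin ι
  have hindep : iIndepFun (fun k => count X (B k)) P := by
    simpa using (hX.indep_count (Fintype.card ι) (fun k => B (e.symm k)) (fun k => hB _)
      (fun k => hΛ _) (fun k l hkl => hdisj (by simpa using hkl))).precomp (g := e) e.injective
  exact lintegral_prod_eq_prod_lintegral_of_indepFun Finset.univ _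
    (hindep.comp g fun k => measurable_of_countable _)
    fun k => (measurable_of_countable _).comp (measurable_count hX.measurable (hB k))

lemma measure_preimage_ne_top {f : SimpleFunc E ℝ≥0∞} (hf : Λ {y | f y ≠ 0} ≠ ⊤)
    {d : ℝ≥0∞} (hd : d ≠ 0) : Λ (f ⁻¹' {d}) ≠ ⊤ :=
  measure_ne_top_of_subset (fun _ (hy : f _ = d) => hy.trans_ne hd) hf

lemma IsPoissonProcess.lintegral_comp_count_mul_nexp_tsum (hX : IsPoissonProcess P X Λ)
    {f : SimpleFunc E ℝ≥0∞} (hf : Λ {y | f y ≠ 0} ≠ ⊤) {A : Set E} (hA : MeasurableSet A)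
    (hΛA : Λ A ≠ ⊤) (hfA : ∀ y ∈ A, f y = 0) (g : ℕ∞ → ℝ≥0∞) :
    ∫⁻ ω, g (count X A ω) * nexp (∑' k, f (X k ω)) ∂P =
      (∫⁻ ω, g (count X A ω) ∂P) *
        nexp (∫⁻ y, (1 - nexp (f y)) ∂Λ) := by
  let B : Option {d // d ∈ f.range.erase 0} → Set E := fun o => o.elim A fun d => f ⁻¹' {d.1}
  let G : Option {d // d ∈ f.range.erase 0} → ℕ∞ → ℝ≥0∞ :=
    fun o n => o.elim (g n) fun d => nexp (d * n)
  have hne : ∀ d : {d // d ∈ f.range.erase 0}, (d : ℝ≥0∞) ≠ 0 := fun d => Finset.ne_of_mem_erase d.2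
  have hlevel : ∀ d : ℝ≥0∞, MeasurableSet (f ⁻¹' {d}) := fun d => f.measurableSet_preimage _
  have hdisjA : ∀ d : {d // d ∈ f.range.erase 0}, Disjoint A (f ⁻¹' {d.1}) := fun d =>
    Set.disjoint_left.2 fun y hy (hd : f y = d) => hne d (hd.symm.trans (hfA y hy))
  have hdisj : Pairwise fun o o' => Disjoint (B o) (B o') := by
    rintro (_ | d) (_ | d') hoo'
    · exact absurd rfl hoo'
    · exact hdisjA d'
    · exact (hdisjA d).symm
    · exact Disjoint.preimage f (disjoint_singleton.2 fun h =>
        hoo' (congrArg some (Subtype.ext h)))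
  have hprod : ∀ ω, g (count X A ω) * nexp (∑' k, f (X k ω)) = ∏ o, G o (count X (B o) ω) :=
    fun ω => by rw [Fintype.prod_option, tsum_simpleFunc_eq_sum_count, nexp_sum]; rfl
  have hmap : ∫⁻ y, (1 - nexp (f y)) ∂Λ =
      ∑ d : {d // d ∈ f.range.erase 0}, (1 - nexp d) * Λ (f ⁻¹' {d.1}) := by
    rw [Finset.sum_coe_sort (f.range.erase 0) fun d => (1 - nexp d) * Λ (f ⁻¹' {d}),
      Finset.sum_erase _ (by simp), ← SimpleFunc.map_lintegral,
      ← SimpleFunc.lintegral_eq_lintegral]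
    rfl
  rw [lintegral_congr hprod, hX.lintegral_prod_count (by rintro (_ | d); exacts [hA, hlevel d])
    (by rintro (_ | d); exacts [hΛA, measure_preimage_ne_top hf (hne d)]) hdisj,
    Fintype.prod_option, hmap, nexp_sum]
  congr 1
  exact Finset.prod_congr rfl fun d _ =>
    hX.lintegral_nexp_mul_count (hlevel d) (measure_preimage_ne_top hf (hne d)) d

lemma IsPoissonProcess.laplace_simpleFunc [IsProbabilityMeasure P] (hX : IsPoissonProcess P X Λ)
    {f : SimpleFunc E ℝ≥0∞} (hf : Λ {y | f y ≠ 0} ≠ ⊤) :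
    ∫⁻ ω, nexp (∑' k, f (X k ω)) ∂P = nexp (∫⁻ y, (1 - nexp (f y)) ∂Λ) := by
  simpa using hX.lintegral_comp_count_mul_nexp_tsum hf MeasurableSet.empty (by simp) (by simp)
    fun _ => 1

lemma exists_monotone_simpleFunc_tendsto (Λ : Measure E) [SigmaFinite Λ] {v : E → ℝ≥0∞}
    (hv : Measurable v) :
    ∃ f : ℕ → SimpleFunc E ℝ≥0∞, (∀ y, Monotone fun n => f n y) ∧
      (∀ n, Λ {y | f n y ≠ 0} ≠ ⊤) ∧ ∀ y, Tendsto (fun n => f n y) atTop (𝓝 (v y)) := by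
  have happ : ∀ n y, (SimpleFunc.eapprox v n).restrict (spanningSets Λ n) y =
      (spanningSets Λ n).indicator (SimpleFunc.eapprox v n) y := fun n y => by
    rw [SimpleFunc.restrict_apply _ (measurableSet_spanningSets Λ n)]
  refine ⟨fun n => (SimpleFunc.eapprox v n).restrict (spanningSets Λ n), fun y m n hmn => ?_,
    fun n => ?_, fun y => ?_⟩
  · simp only [happ]
    exact (indicator_le_indicator_of_subset (monotone_spanningSets Λ hmn) (fun _ => zero_le)
      y).trans (indicator_le_indicator (SimpleFunc.monotone_eapprox v hmn y))
  · refine measure_ne_top_of_subset (fun y hy => ?_) (measure_spanningSets_lt_top Λ n).ne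
    by_contra h
    exact hy (by rw [happ, indicator_of_notMem h])
  · refine (SimpleFunc.tendsto_eapprox hv y).congr' ?_
    filter_upwards [eventually_ge_atTop (spanningSetsIndex Λ y)] with n hn
    rw [happ, indicator_of_mem]
    exact monotone_spanningSets Λ hn (mem_spanningSetsIndex Λ y)

lemma tendsto_nexp_tsum_of_monotone {ι : Type*} {f : ℕ → ι → ℝ≥0∞} {g : ι → ℝ≥0∞}
    (hf : ∀ i, Monotone fun n => f n i) (hg : ∀ i, Tendsto (fun n => f n i) atTop (𝓝 (g i))) :
    Tendsto (fun n => nexp (∑' i, f n i)) atTop (𝓝 (nexp (∑' i, g i))) := by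
  let _ : MeasurableSpace ι := ⊤
  simp_rw [← MeasureTheory.lintegral_count]
  exact (continuous_nexp.tendsto _).comp
    (lintegral_tendsto_of_tendsto_of_monotone (fun n => measurable_from_top.aemeasurable)
      (ae_of_all _ hf) (ae_of_all _ hg))

lemma measurable_nexp_tsum {ι : Type*} [Countable ι] (hX : ∀ i, Measurable (X i)) {v : E → ℝ≥0∞}
    (hv : Measurable v) (e : ι → ℕ) : Measurable fun ω => nexp (∑' k, v (X (e k) ω)) :=
  measurable_nexp.comp (Measurable.tsum fun _ => hv.comp (hX _))

lemma measurable_nexp_tsum_param {v : ℝ → E → ℝ≥0∞} (hX : ∀ i, Measurable (X i))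
    (hv : Measurable (Function.uncurry v)) {τ : E → ℝ} (hτ : Measurable τ) (i : ℕ) :
    Measurable fun ω => nexp (∑' k : {k : ℕ // k ≠ i}, v (τ (X i ω)) (X k ω)) :=
  measurable_nexp.comp (Measurable.tsum fun k =>
    hv.comp ((hτ.comp (hX i)).prodMk (hX k)))

lemma tendsto_lintegral_nexp_tsum [IsProbabilityMeasure P] (hX : ∀ i, Measurable (X i))
    {f : ℕ → SimpleFunc E ℝ≥0∞} {v : E → ℝ≥0∞} (hf : ∀ y, Monotone fun n => f n y)
    (hv : ∀ y, Tendsto (fun n => f n y) atTop (𝓝 (v y))) :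
    Tendsto (fun n => ∫⁻ ω, nexp (∑' k, f n (X k ω)) ∂P) atTop
      (𝓝 (∫⁻ ω, nexp (∑' k, v (X k ω)) ∂P)) :=
  tendsto_lintegral_of_dominated_convergence (fun _ => 1)
    (fun n => measurable_nexp_tsum hX (f n).measurable id)
    (fun n => ae_of_all _ fun ω => nexp_le_one _) (by simp)
    (ae_of_all _ fun ω => tendsto_nexp_tsum_of_monotone (fun _ => hf _) (fun _ => hv _))

lemma IsPoissonProcess.laplace [IsProbabilityMeasure P] [SigmaFinite Λ]
    (hX : IsPoissonProcess P X Λ) {v : E → ℝ≥0∞} (hv : Measurable v) :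
    ∫⁻ ω, nexp (∑' k, v (X k ω)) ∂P = nexp (∫⁻ y, (1 - nexp (v y)) ∂Λ) := by
  obtain ⟨f, hmono, hfin, hlim⟩ := exists_monotone_simpleFunc_tendsto Λ hv
  have hright : Tendsto (fun n => ∫⁻ y, (1 - nexp (f n y)) ∂Λ) atTop
      (𝓝 (∫⁻ y, (1 - nexp (v y)) ∂Λ)) :=
    lintegral_tendsto_of_tendsto_of_monotone
      (fun n => (measurable_const.sub (measurable_nexp.comp (f n).measurable)).aemeasurable)
      (ae_of_all _ fun y m n hmn => tsub_le_tsub_left (nexp_antitone (hmono y hmn)) 1)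
      (ae_of_all _ fun y => ENNReal.Tendsto.sub tendsto_const_nhds
        ((continuous_nexp.tendsto _).comp (hlim y)) (Or.inl ENNReal.one_ne_top))
  refine tendsto_nhds_unique (tendsto_lintegral_nexp_tsum hX.measurable hmono hlim) ?_
  simp_rw [fun n => hX.laplace_simpleFunc (hfin n)]
  exact (continuous_nexp.tendsto _).comp hright

/-- The Campbell measure `A ↦ E[∑ i, 1_A (X i) g i]` of the points `X i` weighted by `g i`. The
Mecke formula identifies it when `g i` is a functional of the points other than `X i`. -/
def campbell (P : Measure Ω) (X : ℕ → Ω → E) (g : ℕ → Ω → ℝ≥0∞) : Measure E :=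
  Measure.sum fun i => (P.withDensity (g i)).map (X i)

lemma campbell_apply (hX : ∀ i, Measurable (X i)) (g : ℕ → Ω → ℝ≥0∞) {A : Set E}
    (hA : MeasurableSet A) : campbell P X g A = ∑' i, ∫⁻ ω in X i ⁻¹' A, g i ω ∂P := by
  rw [campbell, Measure.sum_apply _ hA]
  exact tsum_congr fun i => by rw [Measure.map_apply (hX i) hA, withDensity_apply _ (hX i hA)]

lemma lintegral_campbell (hX : ∀ i, Measurable (X i)) {g : ℕ → Ω → ℝ≥0∞}
    (hg : ∀ i, Measurable (g i)) {f : E → ℝ≥0∞} (hf : Measurable f) :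
    ∫⁻ x, f x ∂campbell P X g = ∑' i, ∫⁻ ω, f (X i ω) * g i ω ∂P := by
  rw [campbell, lintegral_sum_measure]
  refine tsum_congr fun i => ?_
  rw [lintegral_map hf (hX i)]
  refine (lintegral_withDensity_eq_lintegral_mul P (hg i) (hf.comp (hX i))).trans ?_
  exact lintegral_congr fun ω => mul_comm _ _

lemma tendsto_campbell_apply (hX : ∀ i, Measurable (X i)) {g : ℕ → ℕ → Ω → ℝ≥0∞}
    {G : ℕ → Ω → ℝ≥0∞} (hg : ∀ n i, Measurable (g n i)) (hg1 : ∀ n i ω, g n i ω ≤ 1)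
    (hlim : ∀ i ω, Tendsto (fun n => g n i ω) atTop (𝓝 (G i ω))) {A : Set E}
    (hA : MeasurableSet A) (hfin : campbell P X 1 A ≠ ⊤) :
    Tendsto (fun n => campbell P X (g n) A) atTop (𝓝 (campbell P X G A)) := by
  simp_rw [campbell_apply hX _ hA, ← MeasureTheory.lintegral_count (α := ℕ)] at hfin ⊢
  refine tendsto_lintegral_of_dominated_convergence (fun i => ∫⁻ _ in X i ⁻¹' A, 1 ∂P)
    (fun n => measurable_of_countable _)
    (fun n => ae_of_all _ fun i => lintegral_mono (hg1 n i)) hfin (ae_of_all _ fun i => ?_)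
  refine tendsto_lintegral_of_dominated_convergence (fun _ => 1) (fun n => hg n i)
    (fun n => ae_of_all _ (hg1 n i)) ?_ (ae_of_all _ (hlim i))
  rw [MeasureTheory.lintegral_count] at hfin
  exact ENNReal.ne_top_of_tsum_ne_top hfin i

lemma measure_ext_of_cover [SigmaFinite Λ] {μ ν : Measure E} {Z : Type*} [Countable Z]
    {s : Z → Set E} (hs : ∀ z, MeasurableSet (s z)) (hcover : ⋃ z, s z = univ)
    (h : ∀ z A, MeasurableSet A → A ⊆ s z → Λ A ≠ ⊤ → μ A = ν A) : μ = ν := by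
  refine Measure.ext_of_iUnion_eq_univ (s := fun z : Z × ℕ => s z.1 ∩ spanningSets Λ z.2) ?_
    fun z => Measure.ext fun A hA => ?_
  · rw [iUnion_prod', ← iUnion_inter_iUnion, hcover, iUnion_spanningSets, inter_univ]
  · rw [Measure.restrict_apply hA, Measure.restrict_apply hA]
    refine h z.1 _ (hA.inter ((hs z.1).inter (measurableSet_spanningSets Λ z.2)))
      (inter_subset_right.trans inter_subset_left) ?_
    exact measure_ne_top_of_subset (inter_subset_right.trans inter_subset_right)
      (measure_spanningSets_lt_top Λ z.2).ne

lemma IsPoissonProcess.campbell_apply_of_subset_preimage (hX : IsPoissonProcess P X Λ)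
    {f : SimpleFunc E ℝ≥0∞} (hf : Λ {y | f y ≠ 0} ≠ ⊤) {A : Set E} (hA : MeasurableSet A)
    (hΛA : Λ A ≠ ⊤) {c : ℝ≥0∞} (hAc : A ⊆ f ⁻¹' {c}) :
    campbell P X (fun i ω => nexp (∑' k : {k // k ≠ i}, f (X k ω))) A =
      Λ A * ∫⁻ ω, nexp (∑' k, f (X k ω)) ∂P := by
  let f₀ : SimpleFunc E ℝ≥0∞ := f.restrict Aᶜ
  have hf₀A : ∀ y ∈ A, f₀ y = 0 := fun y hy => by
    rw [SimpleFunc.restrict_apply _ hA.compl, indicator_of_notMem (by simpa using hy)]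
  have hf₀ : Λ {y | f₀ y ≠ 0} ≠ ⊤ := by
    refine measure_ne_top_of_subset (fun y (hy : f₀ y ≠ 0) (h0 : f y = 0) => hy ?_) hf
    rw [SimpleFunc.restrict_apply _ hA.compl]
    exact indicator_apply_eq_zero.2 fun _ => h0
  have hsplit : ∀ y, f y = c * A.indicator 1 y + f₀ y := fun y => by
    rw [SimpleFunc.restrict_apply _ hA.compl]
    by_cases hy : y ∈ A
    · simp [hy, show f y = c from hAc hy]
    · simp [hy]
  have hall : ∀ ω, nexp (∑' k, f (X k ω)) =
      nexp (c * count X A ω) * nexp (∑' k, f₀ (X k ω)) := fun ω => by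
    simp_rw [← nexp_add, coe_count, ← ENNReal.tsum_mul_left, ← ENNReal.tsum_add, ← hsplit]
  rw [campbell_apply hX.measurable _ hA]
  simp_rw [← lintegral_indicator (hX.measurable _ hA),
    indicator_nexp_tsum_ne hsplit hf₀A, hall]
  rw [← lintegral_tsum fun i => ?_]
  · simp_rw [ENNReal.tsum_mul_right, ← coe_count, ← mul_assoc]
    rw [hX.lintegral_comp_count_mul_nexp_tsum hf₀ hA hΛA hf₀A fun n => n * nexp (c * (n - 1 : ℕ∞)),
      hX.lintegral_comp_count_mul_nexp_tsum hf₀ hA hΛA hf₀A fun n => nexp (c * n),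
      hX.lintegral_count_mul_nexp hA hΛA, mul_assoc]
  · have hcount : Measurable fun ω => nexp (c * (count X A ω - 1 : ℕ∞)) :=
      (measurable_of_countable fun n : ℕ∞ => nexp (c * (n - 1 : ℕ∞))).comp
        (measurable_count hX.measurable hA)
    exact (((measurable_one.indicator hA).comp (hX.measurable i)).mul
      (hcount.mul (measurable_nexp_tsum hX.measurable f₀.measurable id))).aemeasurable

lemma tendsto_floor_add_div {a : ℝ} (ha : a ∈ Icc (0 : ℝ) 1) (t : ℝ) :
    Tendsto (fun n : ℕ => ((⌊((n : ℝ) + 1) * t⌋ : ℝ) + a) / ((n : ℝ) + 1)) atTop (𝓝 t) := by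
  rw [tendsto_iff_dist_tendsto_zero]
  refine squeeze_zero (fun _ => dist_nonneg) (fun n => ?_)
    (tendsto_one_div_add_atTop_nhds_zero_nat (𝕜 := ℝ))
  have hn : (0 : ℝ) < n + 1 := by positivity
  have hdiff : ((⌊((n : ℝ) + 1) * t⌋ : ℝ) + a) / ((n : ℝ) + 1) - t =
      ((⌊((n : ℝ) + 1) * t⌋ : ℝ) + a - (n + 1) * t) / ((n : ℝ) + 1) := by field_simp
  rw [Real.dist_eq, hdiff, abs_div, abs_of_pos hn]
  gcongr
  have hfloor := Int.floor_le (((n : ℝ) + 1) * t)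
  have hlt := Int.lt_floor_add_one (((n : ℝ) + 1) * t)
  rw [abs_le]
  constructor <;> linarith [ha.1, ha.2]

-- An antitone function has countably many discontinuities, which `τ` avoids almost everywhere.
lemma tendsto_setLIntegral_comp_of_antitone {H : ℝ → ℝ≥0∞} (hH : Antitone H) (hH1 : ∀ r, H r ≤ 1)
    {τ : E → ℝ} (hτ : Measurable τ) (hτ0 : ∀ c, Λ (τ ⁻¹' {c}) = 0) {e : ℕ → ℝ → ℝ}
    (he : ∀ n, Measurable (e n)) (hlim : ∀ t, Tendsto (fun n => e n t) atTop (𝓝 t))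
    {A : Set E} (hΛA : Λ A ≠ ⊤) :
    Tendsto (fun n => ∫⁻ x in A, H (e n (τ x)) ∂Λ) atTop (𝓝 (∫⁻ x in A, H (τ x) ∂Λ)) := by
  refine tendsto_lintegral_of_dominated_convergence (fun _ => 1)
    (fun n => hH.measurable.comp ((he n).comp hτ)) (fun n => ae_of_all _ fun x => hH1 _)
    (by simpa using hΛA) (ae_restrict_of_ae ?_)
  have hnull : Λ (τ ⁻¹' {r | ¬ ContinuousAt H r}) = 0 := by
    rw [← biUnion_preimage_singleton]
    exact (measure_biUnion_null_iff hH.countable_not_continuousAt).2 fun c _ => hτ0 c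
  have hcont : ∀ᵐ x ∂Λ, ContinuousAt H (τ x) := ae_iff.2 hnull
  filter_upwards [hcont] with x hx
  exact hx.tendsto.comp (hlim _)

variable [IsProbabilityMeasure P] [SigmaFinite Λ]

lemma IsPoissonProcess.campbell_simpleFunc (hX : IsPoissonProcess P X Λ) {f : SimpleFunc E ℝ≥0∞}
    (hf : Λ {y | f y ≠ 0} ≠ ⊤) :
    campbell P X (fun i ω => nexp (∑' k : {k // k ≠ i}, f (X k ω))) =
      nexp (∫⁻ y, (1 - nexp (f y)) ∂Λ) • Λ := by
  refine measure_ext_of_cover (Λ := Λ) (s := fun d : f.range => f ⁻¹' {d.1})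
    (fun d => f.measurableSet_preimage _) ?_ fun d A hA hAd hΛA => ?_
  · exact eq_univ_of_forall fun y => mem_iUnion.2 ⟨⟨f y, SimpleFunc.mem_range_self f y⟩, rfl⟩
  · rw [hX.campbell_apply_of_subset_preimage hf hA hΛA hAd, hX.laplace_simpleFunc hf, mul_comm]
    rfl

lemma IsPoissonProcess.campbell_one (hX : IsPoissonProcess P X Λ) : campbell P X 1 = Λ := by
  have hzero := hX.campbell_simpleFunc (f := 0) (by simp)
  simp only [SimpleFunc.coe_zero, Pi.zero_apply, tsum_zero, nexp_zero, tsub_self, lintegral_zero,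
    one_smul] at hzero
  exact hzero

lemma IsPoissonProcess.campbell_nexp_tsum (hX : IsPoissonProcess P X Λ) {v : E → ℝ≥0∞}
    (hv : Measurable v) :
    campbell P X (fun i ω => nexp (∑' k : {k // k ≠ i}, v (X k ω))) =
      nexp (∫⁻ y, (1 - nexp (v y)) ∂Λ) • Λ := by
  obtain ⟨f, hmono, hfin, hlim⟩ := exists_monotone_simpleFunc_tendsto Λ hv
  refine measure_ext_of_cover (Λ := Λ) (s := fun _ : Unit => univ) (fun _ => .univ)
    (iUnion_const univ) fun _ A hA _ hΛA => ?_
  have hcampbell := tendsto_campbell_apply (P := P) hX.measurable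
    (g := fun n i ω => nexp (∑' k : {k // k ≠ i}, f n (X k ω)))
    (fun n i => measurable_nexp_tsum hX.measurable (f n).measurable Subtype.val)
    (fun n i ω => nexp_le_one _)
    (fun i ω => tendsto_nexp_tsum_of_monotone (fun _ => hmono _) fun _ => hlim _)
    hA (hX.campbell_one.symm ▸ hΛA)
  refine tendsto_nhds_unique hcampbell ?_
  simp_rw [hX.campbell_simpleFunc (hfin _), Measure.smul_apply, smul_eq_mul, ← hX.laplace hv,
    ← hX.laplace_simpleFunc (hfin _)]
  exact ENNReal.Tendsto.mul_const (tendsto_lintegral_nexp_tsum hX.measurable hmono hlim)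
    (Or.inr hΛA)

lemma IsPoissonProcess.campbell_nexp_tsum_label (hX : IsPoissonProcess P X Λ) {Z : Type*}
    [Countable Z] [MeasurableSpace Z] [MeasurableSingletonClass Z] {q : E → Z} (hq : Measurable q)
    {v : Z → E → ℝ≥0∞} (hv : ∀ z, Measurable (v z)) :
    campbell P X (fun i ω => nexp (∑' k : {k // k ≠ i}, v (q (X i ω)) (X k ω))) =
      Λ.withDensity fun x => nexp (∫⁻ y, (1 - nexp (v (q x) y)) ∂Λ) := by
  refine measure_ext_of_cover (Λ := Λ) (s := fun z => q ⁻¹' {z})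
    (fun z => hq (measurableSet_singleton z)) ?_ fun z A hA hAz _ => ?_
  · exact eq_univ_of_forall fun y => mem_iUnion.2 ⟨q y, rfl⟩
  have hz : ∀ x ∈ A, q x = z := hAz
  have hfixed := congrArg (· A) (hX.campbell_nexp_tsum (hv z))
  simp only [campbell_apply hX.measurable _ hA, Measure.smul_apply, smul_eq_mul] at hfixed ⊢
  rw [withDensity_apply _ hA, setLIntegral_congr_fun hA (g := fun _ => nexp (∫⁻ y,
    (1 - nexp (v z y)) ∂Λ)) fun x hx => by simp only [hz x hx], setLIntegral_const, ← hfixed]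
  exact tsum_congr fun i => setLIntegral_congr_fun (hX.measurable i hA) fun ω hω => by
    simp only [hz _ hω]

lemma IsPoissonProcess.campbell_nexp_tsum_monotone (hX : IsPoissonProcess P X Λ)
    {v : ℝ → E → ℝ≥0∞} (hv : ∀ r, Measurable (v r)) (hmono : ∀ y, Monotone fun r => v r y)
    {τ : E → ℝ} (hτ : Measurable τ) (hτ0 : ∀ c, Λ (τ ⁻¹' {c}) = 0) :
    campbell P X (fun i ω => nexp (∑' k : {k // k ≠ i}, v (τ (X i ω)) (X k ω))) =
      Λ.withDensity fun x => nexp (∫⁻ y, (1 - nexp (v (τ x) y)) ∂Λ) := by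
  refine measure_ext_of_cover (Λ := Λ) (s := fun _ : Unit => univ) (fun _ => .univ)
    (iUnion_const univ) fun _ A hA _ hΛA => ?_
  let e : ℝ → ℕ → ℝ → ℝ := fun a n t => (⌊((n : ℝ) + 1) * t⌋ + a) / ((n : ℝ) + 1)
  have hgrid : ∀ a n,
      campbell P X (fun i ω => nexp (∑' k : {k // k ≠ i}, v (e a n (τ (X i ω))) (X k ω))) A =
        ∫⁻ x in A, nexp (∫⁻ y, (1 - nexp (v (e a n (τ x)) y)) ∂Λ) ∂Λ := fun a n => by
    rw [hX.campbell_nexp_tsum_label (q := fun x => ⌊((n : ℝ) + 1) * τ x⌋)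
      (Int.measurable_floor.comp (hτ.const_mul _)) (v := fun z => v ((z + a) / ((n : ℝ) + 1)))
      fun z => hv _, withDensity_apply _ hA]
  have hlim : ∀ a ∈ Icc (0 : ℝ) 1,
      Tendsto (fun n => ∫⁻ x in A, nexp (∫⁻ y, (1 - nexp (v (e a n (τ x)) y)) ∂Λ) ∂Λ) atTop
        (𝓝 (∫⁻ x in A, nexp (∫⁻ y, (1 - nexp (v (τ x) y)) ∂Λ) ∂Λ)) := fun a ha =>
    tendsto_setLIntegral_comp_of_antitone
      (H := fun r => nexp (∫⁻ y, (1 - nexp (v r y)) ∂Λ))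
      (fun r s hrs => nexp_antitone
        (lintegral_mono fun y => tsub_le_tsub_left (nexp_antitone (hmono y hrs)) 1))
      (fun _ => nexp_le_one _) hτ hτ0 (fun n => by fun_prop)
      (fun t => tendsto_floor_add_div ha t) hΛA
  have hle : ∀ s t : ℝ → ℝ, (∀ r, s r ≤ t r) →
      campbell P X (fun i ω => nexp (∑' k : {k // k ≠ i}, v (t (τ (X i ω))) (X k ω))) A ≤
        campbell P X (fun i ω => nexp (∑' k : {k // k ≠ i}, v (s (τ (X i ω))) (X k ω))) A := by
    intro s t hst
    simp_rw [campbell_apply hX.measurable _ hA]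
    gcongr
    exact nexp_antitone (ENNReal.tsum_le_tsum fun k => hmono _ (hst _))
  rw [withDensity_apply _ hA]
  refine le_antisymm (ge_of_tendsto' (hlim 0 (by simp)) fun n => hgrid 0 n ▸ hle (e 0 n) id ?_)
    (le_of_tendsto' (hlim 1 (by simp)) fun n => hgrid 1 n ▸ hle id (e 1 n) ?_) <;> intro t
  · rw [id, div_le_iff₀ (by positivity), add_zero, mul_comm t]
    exact Int.floor_le _
  · rw [id, le_div_iff₀ (by positivity), mul_comm t]
    exact (Int.lt_floor_add_one _).le

lemma measurable_nexp_lintegral_param {v : ℝ → E → ℝ≥0∞}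
    (hv : Measurable (Function.uncurry v)) :
    Measurable fun r => nexp (∫⁻ y, (1 - nexp (v r y)) ∂Λ) :=
  measurable_nexp.comp (Measurable.lintegral_prod_right'
    (f := fun z : ℝ × E => 1 - nexp (v z.1 z.2)) (measurable_const.sub (measurable_nexp.comp hv)))

lemma IsPoissonProcess.mecke (hX : IsPoissonProcess P X Λ) {v : ℝ → E → ℝ≥0∞}
    (hv : Measurable (Function.uncurry v)) (hmono : ∀ y, Monotone fun r => v r y) {τ : E → ℝ}
    (hτ : Measurable τ) (hτ0 : ∀ c, Λ (τ ⁻¹' {c}) = 0) {f : E → ℝ≥0∞} (hf : Measurable f) :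
    ∑' i, ∫⁻ ω, f (X i ω) * nexp (∑' k : {k : ℕ // k ≠ i}, v (τ (X i ω)) (X k ω)) ∂P =
      ∫⁻ x, f x * nexp (∫⁻ y, (1 - nexp (v (τ x) y)) ∂Λ) ∂Λ := by
  rw [← lintegral_campbell hX.measurable
    (fun i => measurable_nexp_tsum_param hX.measurable hv hτ i) hf,
    hX.campbell_nexp_tsum_monotone (fun _ => hv.of_uncurry_left) hmono hτ hτ0]
  refine (lintegral_withDensity_eq_lintegral_mul Λ
    ((measurable_nexp_lintegral_param hv).comp hτ) hf).trans ?_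
  exact lintegral_congr fun x => mul_comm _ _

end Poisson

section Alzer

open Real

lemma hasDerivAt_exp_neg_mul (c t : ℝ) :
    HasDerivAt (fun t => exp (-(c * t))) (-(c * exp (-(c * t)))) t := by
  simpa [mul_comm] using ((hasDerivAt_id' t).const_mul (-c)).exp

lemma integral_exp_neg_mul_eq {c : ℝ} (hc : 0 < c) :
    ∫ t in (0 : ℝ)..1, exp (-(c * t)) = (1 - exp (-c)) / c := by
  have hprim : ∀ t ∈ uIcc (0 : ℝ) 1,
      HasDerivAt (fun t => -(exp (-(c * t)) / c)) (exp (-(c * t))) t := fun t _ => by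
    have hderiv := ((hasDerivAt_exp_neg_mul c t).div_const c).fun_neg
    rwa [neg_div, mul_div_cancel_left₀ _ hc.ne', neg_neg] at hderiv
  rw [intervalIntegral.integral_eq_sub_of_hasDerivAt hprim
    (Continuous.intervalIntegrable (by fun_prop) _ _)]
  simp only [mul_one, mul_zero, neg_zero, exp_zero]
  field_simp
  ring

-- Jensen's inequality for `u ↦ u ^ (y / c)` and `t ↦ exp (-(c * t))` on `[0, 1]`.
lemma one_sub_exp_neg_div_rpow_le {c y : ℝ} (hc : 0 < c) (hcy : c ≤ y) :
    ((1 - exp (-c)) / c) ^ (y / c) ≤ (1 - exp (-y)) / y := by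
  rw [← integral_exp_neg_mul_eq hc, ← integral_exp_neg_mul_eq (hc.trans_le hcy),
    intervalIntegral.integral_of_le zero_le_one, intervalIntegral.integral_of_le zero_le_one]
  have hpow : ∀ t, exp (-(y * t)) = exp (-(c * t)) ^ (y / c) := fun t => by
    rw [← exp_mul]
    congr 1
    field_simp
  have hint : ∀ d : ℝ, IntegrableOn (fun t => exp (-(d * t))) (Ioc 0 1) := fun d =>
    (Continuous.integrableOn_Icc (by fun_prop)).mono_set Ioc_subset_Icc_self
  have : IsProbabilityMeasure (volume.restrict (Ioc (0 : ℝ) 1)) := ⟨by simp⟩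
  have hp : 1 ≤ y / c := (one_le_div hc).2 hcy
  simp_rw [hpow]
  exact (convexOn_rpow hp).map_integral_le (μ := volume.restrict (Ioc (0 : ℝ) 1))
    (f := fun t => exp (-(c * t))) (continuousOn_id.rpow_const fun _ _ => Or.inr (by linarith))
    isClosed_Ici (ae_of_all _ fun t => (exp_pos _).le) (hint c)
    ((hint y).congr (ae_of_all _ hpow))

lemma integrableOn_erlang (m : ℕ) :
    IntegrableOn (fun t : ℝ => t ^ m * exp (-t) / m.factorial) (Ioi 0) := by
  have hgamma := GammaIntegral_convergent (s := (m : ℝ) + 1) (by positivity)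
  refine IntegrableOn.congr_fun (hgamma.div_const (m.factorial : ℝ)) (fun t _ => ?_)
    measurableSet_Ioi
  simp [mul_comm]

lemma integral_erlang (m : ℕ) :
    ∫ t in Ioi (0 : ℝ), t ^ m * exp (-t) / m.factorial = 1 := by
  have hgamma := Gamma_eq_integral (s := (m : ℝ) + 1) (by positivity)
  rw [Gamma_nat_eq_factorial] at hgamma
  rw [integral_div, div_eq_one_iff_eq (by positivity), hgamma]
  refine setIntegral_congr_fun measurableSet_Ioi fun t _ => ?_
  simp [mul_comm]

/-- The amount by which the distribution function of the gamma distribution of shape `m + 1` exceeds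
`(1 - exp (-a x)) ^ (m + 1)`; Alzer's inequality says that it is nonnegative. -/
def alzerGap (m : ℕ) (a x : ℝ) : ℝ :=
  (∫ t in (0 : ℝ)..x, t ^ m * exp (-t) / m.factorial) - (1 - exp (-(a * x))) ^ (m + 1)

variable {m : ℕ} {a : ℝ}

lemma hasDerivAt_alzerGap (m : ℕ) (a x : ℝ) :
    HasDerivAt (alzerGap m a)
      (x ^ m * exp (-x) / m.factorial -
        (m + 1) * (1 - exp (-(a * x))) ^ m * (a * exp (-(a * x)))) x := by
  have hg : Continuous fun t : ℝ => t ^ m * exp (-t) / m.factorial := by fun_prop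
  have hpow := ((hasDerivAt_exp_neg_mul a x).const_sub 1).fun_pow (m + 1)
  rw [Nat.add_sub_cancel, neg_neg] at hpow
  exact (intervalIntegral.integral_hasDerivAt_right (hg.intervalIntegrable _ _)
    hg.stronglyMeasurable.stronglyMeasurableAtFilter hg.continuousAt).sub (mod_cast hpow)

lemma deriv_alzerGap (ha : 0 < a) (ham : a ^ (m + 1) * (m + 1).factorial = 1) {x : ℝ}
    (hx : 0 < x) :
    deriv (alzerGap m a) x = (m + 1) * a * (a * x) ^ m * exp (-(a * x)) *
      (exp (-((1 - a) * x)) - ((1 - exp (-(a * x))) / (a * x)) ^ m) := by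
  have hfact : (1 : ℝ) / m.factorial = (m + 1) * a ^ (m + 1) := by
    rw [Nat.factorial_succ] at ham
    push_cast at ham
    have : (m.factorial : ℝ) ≠ 0 := by positivity
    field_simp
    linarith
  have hexp : exp (-x) = exp (-(a * x)) * exp (-((1 - a) * x)) := by
    rw [← exp_add]
    congr 1
    ring
  rw [(hasDerivAt_alzerGap m a x).deriv, div_eq_mul_one_div, hfact, hexp, div_pow]
  have : (a * x) ^ m ≠ 0 := by positivity
  field_simp
  ring

lemma exp_neg_mul_le_pow_mono (ha : 0 < a) {c y : ℝ} (hc : 0 < c) (hcy : c ≤ y)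
    (hle : exp (-((1 - a) * c)) ≤ ((1 - exp (-(a * c))) / (a * c)) ^ m) :
    exp (-((1 - a) * y)) ≤ ((1 - exp (-(a * y))) / (a * y)) ^ m := by
  have hbase : 0 ≤ (1 - exp (-(a * c))) / (a * c) := by
    refine div_nonneg (sub_nonneg.2 (exp_le_one_iff.2 ?_)) (by positivity)
    exact neg_nonpos.2 (mul_pos ha hc).le
  have hjensen := one_sub_exp_neg_div_rpow_le (mul_pos ha hc) (mul_le_mul_of_nonneg_left hcy ha.le)
  rw [mul_div_mul_left _ _ ha.ne'] at hjensen
  calc exp (-((1 - a) * y)) = exp (-((1 - a) * c)) ^ (y / c) := by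
        rw [← exp_mul]
        congr 1
        field_simp
    _ ≤ (((1 - exp (-(a * c))) / (a * c)) ^ m) ^ (y / c) :=
        rpow_le_rpow (exp_pos _).le hle (div_nonneg (hc.le.trans hcy) hc.le)
    _ = (((1 - exp (-(a * c))) / (a * c)) ^ (y / c)) ^ m := by
        rw [← rpow_natCast, ← rpow_mul hbase, mul_comm (m : ℝ), rpow_mul hbase, rpow_natCast]
    _ ≤ _ := pow_le_pow_left₀ (rpow_nonneg hbase _) hjensen m

lemma tendsto_alzerGap_atTop (m : ℕ) (ha : 0 < a) : Tendsto (alzerGap m a) atTop (𝓝 0) := by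
  have hpow : Tendsto (fun x => (1 - exp (-(a * x))) ^ (m + 1)) atTop (𝓝 ((1 - 0) ^ (m + 1))) :=
    (tendsto_const_nhds.sub
      (tendsto_exp_neg_atTop_nhds_zero.comp (tendsto_id.const_mul_atTop ha))).pow _
  have hcdf := intervalIntegral_tendsto_integral_Ioi 0 (integrableOn_erlang m) tendsto_id
  rw [integral_erlang] at hcdf
  have hlim := hcdf.sub hpow
  rwa [sub_zero, one_pow, sub_self] at hlim

-- The gap vanishes at `0` and at `∞`, and its derivative stays nonpositive once it is negative.
theorem alzerGap_nonneg (ha : 0 < a) (ham : a ^ (m + 1) * (m + 1).factorial = 1) {x : ℝ}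
    (hx : 0 ≤ x) : 0 ≤ alzerGap m a x := by
  by_contra! hneg
  have hzero : alzerGap m a 0 = 0 := by simp [alzerGap]
  have hx0 : 0 < x := hx.lt_of_ne (by rintro rfl; exact hneg.ne hzero)
  have hdiff : Differentiable ℝ (alzerGap m a) := fun y =>
    (hasDerivAt_alzerGap m a y).differentiableAt
  obtain ⟨c, ⟨hc0, hcx⟩, hslope⟩ :=
    exists_deriv_eq_slope (alzerGap m a) hx0 hdiff.continuous.continuousOn hdiff.differentiableOn
  have hderiv_c : deriv (alzerGap m a) c < 0 := by
    rw [hslope, hzero]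
    exact div_neg_of_neg_of_pos (by linarith) (by linarith)
  have hexp_c : exp (-((1 - a) * c)) ≤ ((1 - exp (-(a * c))) / (a * c)) ^ m := by
    rw [deriv_alzerGap ha ham hc0] at hderiv_c
    by_contra! hlt
    exact hderiv_c.not_ge (mul_nonneg (by positivity) (sub_nonneg.2 hlt.le))
  have hanti : AntitoneOn (alzerGap m a) (Ici c) := by
    refine antitoneOn_of_deriv_nonpos (convex_Ici c) hdiff.continuous.continuousOn
      hdiff.differentiableOn fun y hy => ?_
    have hcy : c < y := by rwa [interior_Ici] at hy
    have hy0 : 0 < y := hc0.trans hcy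
    rw [deriv_alzerGap ha ham hy0]
    exact mul_nonpos_of_nonneg_of_nonpos (by positivity)
      (sub_nonpos.2 (exp_neg_mul_le_pow_mono ha hc0 hcy.le hexp_c))
  refine hneg.not_ge (le_of_tendsto (tendsto_alzerGap_atTop m ha) ?_)
  filter_upwards [eventually_ge_atTop x] with y hy
  exact hanti hcx.le (hcx.le.trans hy) hy

lemma gammaMeasure_Iio (m : ℕ) {x : ℝ} (hx : 0 ≤ x) :
    gammaMeasure ((m : ℝ) + 1) 1 (Iio x) =
      ENNReal.ofReal (∫ t in (0 : ℝ)..x, t ^ m * exp (-t) / m.factorial) := by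
  have hg : Continuous fun t : ℝ => t ^ m * exp (-t) / m.factorial := by fun_prop
  have hdisj : Disjoint (Iio (0 : ℝ)) (Ico 0 x) :=
    Set.disjoint_left.2 fun y hy hy' => hy'.1.not_gt hy
  rw [gammaMeasure, withDensity_apply _ measurableSet_Iio, ← Iio_union_Ico_eq_Iio hx,
    lintegral_union measurableSet_Ico hdisj, lintegral_gammaPDF_of_nonpos le_rfl, zero_add,
    intervalIntegral.integral_of_le hx, ← integral_Ico_eq_integral_Ioc,
    ofReal_integral_eq_lintegral_ofReal (hg.integrableOn_Icc.mono_set Ico_subset_Icc_self)]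
  · refine setLIntegral_congr_fun measurableSet_Ico fun t ht => ?_
    rw [gammaPDF_of_nonneg ht.1, Gamma_nat_eq_factorial]
    congr 1
    simp only [one_rpow, one_div, add_sub_cancel_right, rpow_natCast, one_mul]
    ring
  · filter_upwards [ae_restrict_mem measurableSet_Ico] with t ht
    have := ht.1
    positivity

lemma gammaMeasure_Ici_le (ha : 0 < a) (ham : a ^ (m + 1) * (m + 1).factorial = 1) {x : ℝ}
    (hx : 0 ≤ x) :
    gammaMeasure ((m : ℝ) + 1) 1 (Ici x) ≤
      1 - (1 - nexp (ENNReal.ofReal (a * x))) ^ (m + 1) := by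
  have : IsProbabilityMeasure (gammaMeasure ((m : ℝ) + 1) 1) :=
    isProbabilityMeasure_gammaMeasure (by positivity) one_pos
  have hexp : exp (-(a * x)) ≤ 1 := exp_le_one_iff.2 (neg_nonpos.2 (mul_nonneg ha.le hx))
  rw [← compl_Iio, prob_compl_eq_one_sub measurableSet_Iio, gammaMeasure_Iio m hx,
    nexp_ofReal (by positivity), ← ENNReal.ofReal_one, ← ENNReal.ofReal_sub _ (exp_pos _).le,
    ← ENNReal.ofReal_pow (sub_nonneg.2 hexp)]
  exact tsub_le_tsub_left (ENNReal.ofReal_le_ofReal (sub_nonneg.1 (alzerGap_nonneg ha ham hx))) _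

lemma gammaMeasure_setOf_le_ofReal_le (ha : 0 < a) (ham : a ^ (m + 1) * (m + 1).factorial = 1)
    (T : ℝ≥0∞) :
    gammaMeasure ((m : ℝ) + 1) 1 {h | T ≤ ENNReal.ofReal h} ≤
      1 - (1 - nexp (ENNReal.ofReal a * T)) ^ (m + 1) := by
  have : IsProbabilityMeasure (gammaMeasure ((m : ℝ) + 1) 1) :=
    isProbabilityMeasure_gammaMeasure (by positivity) one_pos
  rcases eq_or_ne T ⊤ with rfl | hT
  · simp
  rcases eq_or_ne T 0 with rfl | hT₀
  · simp
  have hpos : 0 < T.toReal := ENNReal.toReal_pos hT₀ hT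
  have hset : {h | T ≤ ENNReal.ofReal h} = Ici T.toReal := by
    ext h
    rw [mem_ofPred_eq, mem_Ici, ← ENNReal.ofReal_toReal hT, ENNReal.ofReal_le_ofReal_iff',
      ENNReal.toReal_ofReal hpos.le, or_iff_left hpos.not_ge]
  simpa only [hset, ENNReal.ofReal_mul ha.le, ENNReal.ofReal_toReal hT] using
    gammaMeasure_Ici_le ha ham hpos.le

lemma gammaPDF_mul_nexp {n : ℝ} (hn : 0 < n) {s : ℝ} (hs : 0 ≤ s) (h : ℝ) :
    gammaPDF n 1 h * nexp (ENNReal.ofReal (s * h)) =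
      ENNReal.ofReal (1 / (1 + s) ^ n) * gammaPDF n (1 + s) h := by
  rcases lt_or_ge h 0 with hneg | hnn
  · simp [gammaPDF_of_neg hneg]
  have := Gamma_pos_of_pos hn
  rw [gammaPDF_of_nonneg hnn, gammaPDF_of_nonneg hnn, nexp_ofReal (mul_nonneg hs hnn),
    ← ENNReal.ofReal_mul (by positivity), ← ENNReal.ofReal_mul (by positivity)]
  congr 1
  have hexp : exp (-((1 + s) * h)) = exp (-(1 * h)) * exp (-(s * h)) := by
    rw [← exp_add]; congr 1; ring
  have hpow : (1 + s) ^ n ≠ 0 := by positivity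
  rw [hexp, one_rpow]
  field_simp

lemma lintegral_nexp_gammaMeasure {n : ℝ} (hn : 0 < n) {s : ℝ} (hs : 0 ≤ s) :
    ∫⁻ h, nexp (ENNReal.ofReal (s * h)) ∂gammaMeasure n 1 =
      ENNReal.ofReal (1 / (1 + s) ^ n) := by
  refine (lintegral_withDensity_eq_lintegral_mul volume (f := gammaPDF n 1)
    (measurable_gammaPDFReal _ _).ennreal_ofReal
    (measurable_nexp.comp (ENNReal.measurable_ofReal.comp (measurable_const_mul s)))).trans ?_
  refine (lintegral_congr (gammaPDF_mul_nexp hn hs)).trans ?_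
  rw [lintegral_const_mul _ (f := gammaPDF n (1 + s)) (measurable_gammaPDFReal _ _).ennreal_ofReal,
    lintegral_gammaPDF_eq_one hn (by linarith), mul_one]

end Alzer

section Marks

variable {Ω E M : Type*} [MeasurableSpace Ω] [MeasurableSpace E] [MeasurableSpace M]
  {P : Measure Ω} {X : ℕ → Ω → E} {Y : ℕ → Ω → M} {Λ : Measure E} {ν : Measure M}

lemma lintegral_nexp_le_one [IsProbabilityMeasure ν] (W : M → ℝ≥0∞) :
    ∫⁻ m, nexp (W m) ∂ν ≤ 1 :=
  (lintegral_mono fun m => nexp_le_one (W m)).trans_eq (by simp)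

lemma lintegral_nexp_tsum_mark [IsProbabilityMeasure P] {ι : Type*} [Countable ι] {e : ι → ℕ}
    (he : Function.Injective e) (hY : ∀ i, Measurable (Y i)) (hlaw : ∀ i, HasLaw (Y i) ν P)
    (hind : iIndepFun Y P) {W : ι → M → ℝ≥0∞} (hW : ∀ k, Measurable (W k)) :
    ∫⁻ ω, nexp (∑' k, W k (Y (e k) ω)) ∂P = nexp (∑' k, nlog (∫⁻ m, nexp (W k m) ∂ν)) := by
  have hmark : ∀ k, ∫⁻ ω, nexp (W k (Y (e k) ω)) ∂P = ∫⁻ m, nexp (W k m) ∂ν := fun k =>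
    (hlaw (e k)).lintegral_comp (f := fun m => nexp (W k m))
      (measurable_nexp.comp (hW k)).aemeasurable
  have hterm : ∀ k, Measurable fun ω => nexp (W k (Y (e k) ω)) := fun k =>
    measurable_nexp.comp ((hW k).comp (hY _))
  have hfinite : ∀ s : Finset ι, ∏ k ∈ s, nexp (nlog (∫⁻ m, nexp (W k m) ∂ν)) =
      ∫⁻ ω, ∏ k ∈ s, nexp (W k (Y (e k) ω)) ∂P := fun s => by
    have hcomp := (hind.precomp he).comp (fun k m => nexp (W k m))
      fun k => measurable_nexp.comp (hW k)
    refine Eq.trans ?_ (lintegral_prod_eq_prod_lintegral_of_indepFun s _ hcomp hterm).symm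
    refine Finset.prod_congr rfl fun k _ => ?_
    rw [← hmark, nexp_nlog (lintegral_nexp_le_one _)]
    rfl
  have hlim : Tendsto (fun s : Finset ι => ∫⁻ ω, ∏ k ∈ s, nexp (W k (Y (e k) ω)) ∂P) atTop
      (𝓝 (∫⁻ ω, nexp (∑' k, W k (Y (e k) ω)) ∂P)) :=
    tendsto_lintegral_filter_of_dominated_convergence (fun _ => 1)
      (Eventually.of_forall fun s => Finset.measurable_fun_prod _ fun k _ => hterm k)
      (Eventually.of_forall fun s => ae_of_all _ fun ω =>
        Finset.prod_le_one' fun k _ => nexp_le_one _)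
      (by simp) (ae_of_all _ fun ω => tendsto_prod_nexp _)
  exact tendsto_nhds_unique hlim ((tendsto_prod_nexp _).congr hfinite)

lemma indepFun_compl_of_iIndepFun (hY : ∀ i, Measurable (Y i)) (hind : iIndepFun Y P) (i : ℕ) :
    IndepFun (Y i) (fun ω (k : {k : ℕ // k ≠ i}) => Y k ω) P := by
  have hσ := indep_iSup_of_disjoint (fun k => (hY k).comap_le) hind
    (S := {i}) (T := {i}ᶜ) disjoint_compl_right
  refine indep_of_indep_of_le_left (indep_of_indep_of_le_right hσ ?_) ?_
  · refine Measurable.comap_le ?_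
    refine @measurable_pi_lambda _ _ _ (_) _ _ fun k => ?_
    refine Measurable.mono (comap_measurable (Y k)) ?_ le_rfl
    exact le_iSup₂_of_le (f := fun n (_ : n ∈ ({i}ᶜ : Set ℕ)) => MeasurableSpace.comap (Y n) _)
      (k : ℕ) k.2 le_rfl
  · exact le_iSup₂_of_le (f := fun n (_ : n ∈ ({i} : Set ℕ)) => MeasurableSpace.comap (Y n) _)
      i rfl le_rfl

lemma lintegral_comp_of_indepFun {S T : Type*} [MeasurableSpace S] [MeasurableSpace T]
    [IsFiniteMeasure P] {U : Ω → S} {V : Ω → T} (hU : Measurable U) (hV : Measurable V)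
    (hUV : IndepFun U V P) {Φ : S × T → ℝ≥0∞} (hΦ : Measurable Φ) :
    ∫⁻ ω, Φ (U ω, V ω) ∂P = ∫⁻ ω, ∫⁻ ω', Φ (U ω, V ω') ∂P ∂P := by
  rw [← lintegral_map (f := Φ) hΦ (hU.prodMk hV),
    (indepFun_iff_map_prod_eq_prod_map_map hU.aemeasurable hV.aemeasurable).1 hUV,
    lintegral_prod _ hΦ.aemeasurable, lintegral_map hΦ.lintegral_prod_right' hU]
  exact lintegral_congr fun ω => lintegral_map (hΦ.comp measurable_prodMk_left) hV

lemma lintegral_mark_eq_lintegral_lintegral [IsFiniteMeasure P] (hY : ∀ i, Measurable (Y i))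
    (hlaw : ∀ i, HasLaw (Y i) ν P) (hind : iIndepFun Y P) (i : ℕ)
    {Ψ : M × ({k : ℕ // k ≠ i} → M) → ℝ≥0∞} (hΨ : Measurable Ψ) :
    ∫⁻ ω, Ψ (Y i ω, fun k => Y k ω) ∂P = ∫⁻ ω, ∫⁻ m, Ψ (m, fun k => Y k ω) ∂ν ∂P := by
  have hothers : Measurable fun ω (k : {k : ℕ // k ≠ i}) => Y k ω :=
    measurable_pi_lambda _ fun k => hY k
  refine (lintegral_comp_of_indepFun hothers (hY i) (indepFun_compl_of_iIndepFun hY hind i).symm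
    (hΨ.comp measurable_swap)).trans (lintegral_congr fun ω => ?_)
  exact (hlaw i).lintegral_comp (f := fun m => Ψ (m, fun k => Y k ω))
    (hΨ.comp measurable_prodMk_right).aemeasurable

variable [IsProbabilityMeasure P]

lemma lintegral_weight_mul_nexp_tsum_mark (hX : ∀ i, Measurable (X i))
    (hY : ∀ i, Measurable (Y i)) (hlaw : ∀ i, HasLaw (Y i) ν P) (hind : iIndepFun Y P)
    (hXY : IndepFun (fun ω i => X i ω) (fun ω i => Y i ω) P) {w : ℝ × E × M → ℝ≥0∞}
    (hw : Measurable w) {τ : E → ℝ} (hτ : Measurable τ) {f : E → ℝ≥0∞} (hf : Measurable f)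
    (i : ℕ) :
    ∫⁻ ω, f (X i ω) * nexp (∑' k : {k : ℕ // k ≠ i}, w (τ (X i ω), X k ω, Y k ω)) ∂P =
      ∫⁻ ω, f (X i ω) * nexp (∑' k : {k : ℕ // k ≠ i},
        nlog (∫⁻ m, nexp (w (τ (X i ω), X k ω, m)) ∂ν)) ∂P := by
  have hΦ : Measurable fun z : (ℕ → E) × (ℕ → M) => f (z.1 i) *
      nexp (∑' k : {k : ℕ // k ≠ i}, w (τ (z.1 i), z.1 k, z.2 k)) :=
    (hf.comp (by fun_prop)).mul
      (measurable_nexp.comp (Measurable.tsum fun k => hw.comp (by fun_prop)))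
  refine (lintegral_comp_of_indepFun (measurable_pi_lambda _ hX) (measurable_pi_lambda _ hY) hXY
    hΦ).trans (lintegral_congr fun ω => ?_)
  have hmarks : Measurable fun ω' =>
      nexp (∑' k : {k : ℕ // k ≠ i}, w (τ (X i ω), X k ω, Y k ω')) :=
    measurable_nexp.comp (Measurable.tsum fun k => hw.comp (by fun_prop))
  refine (lintegral_const_mul (f (X i ω)) hmarks).trans ?_
  congr 1
  exact lintegral_nexp_tsum_mark Subtype.val_injective hY hlaw hind
    (W := fun (k : {k : ℕ // k ≠ i}) m => w (τ (X i ω), X k ω, m)) fun k => hw.comp (by fun_prop)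

-- Averaging over the marks of the other points gives a Mecke formula for the unmarked process.
lemma IsPoissonProcess.mecke_marked [SigmaFinite Λ]
    (hX : IsPoissonProcess P X Λ) (hY : ∀ i, Measurable (Y i)) (hlaw : ∀ i, HasLaw (Y i) ν P)
    (hind : iIndepFun Y P) (hXY : IndepFun (fun ω i => X i ω) (fun ω i => Y i ω) P)
    {w : ℝ × E × M → ℝ≥0∞} (hw : Measurable w) (hmono : ∀ y m, Monotone fun r => w (r, y, m))
    {τ : E → ℝ} (hτ : Measurable τ) (hτ0 : ∀ c, Λ (τ ⁻¹' {c}) = 0) {f : E → ℝ≥0∞}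
    (hf : Measurable f) :
    ∑' i, ∫⁻ ω, f (X i ω) *
        nexp (∑' k : {k : ℕ // k ≠ i}, w (τ (X i ω), X k ω, Y k ω)) ∂P =
      ∫⁻ x, f x * nexp (∫⁻ y, (1 - ∫⁻ m, nexp (w (τ x, y, m)) ∂ν) ∂Λ) ∂Λ := by
  have hν : IsProbabilityMeasure ν :=
    (hlaw 0).map_eq ▸ Measure.isProbabilityMeasure_map (hY 0).aemeasurable
  let v : ℝ → E → ℝ≥0∞ := fun r y => nlog (∫⁻ m, nexp (w (r, y, m)) ∂ν)
  have hv : Measurable (Function.uncurry v) :=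
    measurable_nlog.comp (Measurable.lintegral_prod_right'
      (f := fun z : (ℝ × E) × M => nexp (w (z.1.1, z.1.2, z.2)))
      (measurable_nexp.comp (hw.comp (by fun_prop))))
  have hvmono : ∀ y, Monotone fun r => v r y := fun y r s hrs =>
    nlog_antitone (lintegral_mono fun m => nexp_antitone (hmono y m hrs))
  have hmecke := hX.mecke hv hvmono hτ hτ0 hf
  simp only [v, nexp_nlog (lintegral_nexp_le_one _)] at hmecke
  rw [← hmecke]
  exact tsum_congr fun i =>
    lintegral_weight_mul_nexp_tsum_mark hX.measurable hY hlaw hind hXY hw hτ hf i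

end Marks

section SingleMark

variable {p : Params}

instance : Fintype Link := ⟨⟨[Link.los, Link.nlos], by simp⟩, by rintro (_ | _) <;> simp⟩

instance : Fintype Sector :=
  ⟨⟨[Sector.signal, Sector.noise], by simp⟩, by rintro (_ | _) <;> simp⟩

instance : MeasurableSpace Link := ⊤

instance : MeasurableSpace Sector := ⊤

instance : DiscreteMeasurableSpace Link := ⟨fun _ => trivial⟩

instance : DiscreteMeasurableSpace Sector := ⟨fun _ => trivial⟩

lemma sum_link {α : Type*} [AddCommMonoid α] (f : Link → α) :
    ∑ k, f k = f Link.los + f Link.nlos :=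
  Fintype.sum_eq_add _ _ (by simp) (by rintro (_ | _) <;> simp)

@[to_additive]
lemma prod_sector {α : Type*} [CommMonoid α] (f : Sector → α) :
    ∏ s, f s = f Sector.signal * f Sector.noise :=
  Fintype.prod_eq_mul _ _ (by simp) (by rintro (_ | _) <;> simp)

/-- Blockage variable, boresight angle, LOS gain and NLOS gain of one base station. -/
abbrev Mark := ℝ × ℝ × ℝ × ℝ

/-- The law of the mark of one base station. -/
def markLaw (p : Params) : Measure Mark :=
  (uniformLaw 0 1).prod ((uniformLaw (-180) 180).prod
    ((gammaMeasure (p.nak Link.los) 1).prod (gammaMeasure (p.nak Link.nlos) 1)))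

/-- The fading gain of a link of the given type. -/
def gain (m : Mark) : Link → ℝ
  | Link.los => m.2.2.1
  | Link.nlos => m.2.2.2

/-- The type of the link of length `t` to a base station with mark `m`. -/
def markLink (p : Params) (t : ℝ) (m : Mark) : Link :=
  if m.1 < losProb p t then Link.los else Link.nlos

/-- The sector in which a base station with mark `m` radiates towards the user. -/
def markSector (p : Params) (m : Mark) : Sector :=
  if |m.2.1| ≤ p.thetab then Sector.signal else Sector.noise

/-- The probability of a link type at distance `t`. -/
def linkProb (p : Params) (t : ℝ) : Link → ℝ
  | Link.los => losProb p t
  | Link.nlos => 1 - losProb p t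

lemma measurable_gain (k : Link) : Measurable fun m : Mark => gain m k := by
  cases k <;> simp only [gain] <;> fun_prop

lemma measurable_losProb (p : Params) : Measurable (losProb p) :=
  Measurable.ite measurableSet_Iic measurable_const measurable_const

lemma measurable_linkProb (p : Params) (k : Link) : Measurable fun t => linkProb p t k := by
  cases k
  · exact measurable_losProb p
  · exact measurable_const.sub (measurable_losProb p)

lemma measurable_markLink (p : Params) : Measurable fun z : ℝ × Mark => markLink p z.1 z.2 :=
  Measurable.ite (measurableSet_lt (by fun_prop) ((measurable_losProb p).comp measurable_fst))
    measurable_const measurable_const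

lemma measurable_markSector (p : Params) : Measurable (markSector p) :=
  Measurable.ite (measurableSet_le (by fun_prop) measurable_const)
    measurable_const measurable_const

lemma losProb_nonneg (hC₀ : 0 ≤ p.C) (t : ℝ) : 0 ≤ losProb p t := by
  unfold losProb
  split_ifs <;> simp [hC₀]

lemma losProb_le_one (hC₁ : p.C ≤ 1) (t : ℝ) : losProb p t ≤ 1 := by
  unfold losProb
  split_ifs <;> simp [hC₁]

lemma linkProb_nonneg (hC₀ : 0 ≤ p.C) (hC₁ : p.C ≤ 1) (t : ℝ) (k : Link) :
    0 ≤ linkProb p t k := by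
  cases k
  · exact losProb_nonneg hC₀ t
  · exact sub_nonneg.2 (losProb_le_one hC₁ t)

lemma linkProb_le_one (hC₀ : 0 ≤ p.C) (hC₁ : p.C ≤ 1) (t : ℝ) (k : Link) :
    linkProb p t k ≤ 1 := by
  cases k
  · exact losProb_le_one hC₁ t
  · exact sub_le_self _ (losProb_nonneg hC₀ t)

lemma sum_linkProb (hC₀ : 0 ≤ p.C) (hC₁ : p.C ≤ 1) (t : ℝ) :
    ∑ k, ENNReal.ofReal (linkProb p t k) = 1 := by
  rw [sum_link, ← ENNReal.ofReal_add (linkProb_nonneg hC₀ hC₁ t _) (linkProb_nonneg hC₀ hC₁ t _)]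
  simp [linkProb]

lemma sectorProb_nonneg (hθ₀ : 0 ≤ p.thetab) (hθ₁ : p.thetab ≤ 180) (s : Sector) :
    0 ≤ sectorProb p s := by
  cases s
  · exact div_nonneg hθ₀ (by norm_num)
  · exact div_nonneg (sub_nonneg.2 hθ₁) (by norm_num)

lemma sum_sectorProb (hθ₀ : 0 ≤ p.thetab) (hθ₁ : p.thetab ≤ 180) :
    ∑ s, ENNReal.ofReal (sectorProb p s) = 1 := by
  rw [sum_sector, ← ENNReal.ofReal_add (sectorProb_nonneg hθ₀ hθ₁ _) (sectorProb_nonneg hθ₀ hθ₁ _),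
    sectorProb, sectorProb, ← add_div, add_sub_cancel, div_self (by norm_num), ENNReal.ofReal_one]

lemma isProbabilityMeasure_uniformLaw {a b : ℝ} (hab : a < b) :
    IsProbabilityMeasure (uniformLaw a b) :=
  cond_isProbabilityMeasure_of_finite (by simp [hab]) (by simp)

lemma isProbabilityMeasure_fading (hnak : ∀ j, 1 ≤ p.nak j) (j : Link) :
    IsProbabilityMeasure (gammaMeasure (p.nak j) 1) :=
  isProbabilityMeasure_gammaMeasure (mod_cast hnak j) one_pos

lemma uniformLaw_Iio {q : ℝ} (hq : q ≤ 1) : uniformLaw 0 1 (Iio q) = ENNReal.ofReal q := by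
  have hinter : Icc (0 : ℝ) 1 ∩ Iio q = Ico 0 q := by
    ext b
    exact ⟨fun h => ⟨h.1.1, h.2⟩, fun h => ⟨⟨h.1, h.2.le.trans hq⟩, h.2⟩⟩
  rw [uniformLaw, cond_apply measurableSet_Icc, hinter]
  simp

lemma uniformLaw_abs_le {q : ℝ} (hq : q ≤ 180) :
    uniformLaw (-180) 180 {b | |b| ≤ q} = ENNReal.ofReal (q / 180) := by
  have hinter : Icc (-180 : ℝ) 180 ∩ {b | |b| ≤ q} = Icc (-q) q := by
    simp only [abs_le]
    exact inter_eq_right.2 (Icc_subset_Icc (neg_le_neg hq) hq)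
  rw [uniformLaw, cond_apply measurableSet_Icc, hinter, Real.volume_Icc, Real.volume_Icc,
    ← ENNReal.ofReal_inv_of_pos (by norm_num), ← ENNReal.ofReal_mul (by norm_num)]
  congr 1
  ring

lemma lintegral_comp_ite {α β : Type*} [MeasurableSpace α] {μ : Measure α}
    [IsProbabilityMeasure μ] {q : α → Prop} [DecidablePred q] (hq : MeasurableSet {a | q a})
    (g : β → ℝ≥0∞) (x y : β) :
    ∫⁻ a, g (if q a then x else y) ∂μ = μ {a | q a} * g x + (1 - μ {a | q a}) * g y := by
  rw [← prob_compl_eq_one_sub hq, ← lintegral_add_compl _ hq, mul_comm, mul_comm _ (g y),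
    ← setLIntegral_const, ← setLIntegral_const]
  congr 1
  · exact setLIntegral_congr_fun hq fun a ha => congrArg g (if_pos ha)
  · exact setLIntegral_congr_fun hq.compl fun a ha => congrArg g (if_neg ha)

lemma lintegral_comp_link (hC₀ : 0 ≤ p.C) (hC₁ : p.C ≤ 1) (t : ℝ) (g : Link → ℝ≥0∞) :
    ∫⁻ b, g (if b < losProb p t then Link.los else Link.nlos) ∂uniformLaw 0 1 =
      ∑ k, ENNReal.ofReal (linkProb p t k) * g k := by
  have := isProbabilityMeasure_uniformLaw one_pos
  have hlos : uniformLaw 0 1 {b | b < losProb p t} = _ := uniformLaw_Iio (losProb_le_one hC₁ t)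
  rw [lintegral_comp_ite measurableSet_Iio, sum_link, hlos, ← ENNReal.ofReal_one,
    ← ENNReal.ofReal_sub _ (losProb_nonneg hC₀ t)]
  rfl

lemma lintegral_comp_sector (hθ₀ : 0 ≤ p.thetab) (hθ₁ : p.thetab ≤ 180) (g : Sector → ℝ≥0∞) :
    ∫⁻ b, g (if |b| ≤ p.thetab then Sector.signal else Sector.noise) ∂uniformLaw (-180) 180 =
      ∑ s, ENNReal.ofReal (sectorProb p s) * g s := by
  have := isProbabilityMeasure_uniformLaw (a := -180) (b := 180) (by norm_num)
  rw [lintegral_comp_ite (measurableSet_le (by fun_prop) measurable_const), sum_sector,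
    uniformLaw_abs_le hθ₁, ← ENNReal.ofReal_one, ← ENNReal.ofReal_sub _ (by positivity), sectorProb,
    sectorProb, sub_div, div_self (by norm_num)]

lemma lintegral_comp_gain (hnak : ∀ j, 1 ≤ p.nak j) (b a : ℝ) (k : Link) {g : ℝ → ℝ≥0∞}
    (hg : Measurable g) :
    ∫⁻ h, g (gain (b, a, h) k)
        ∂(gammaMeasure (p.nak Link.los) 1).prod (gammaMeasure (p.nak Link.nlos) 1) =
      ∫⁻ h, g h ∂gammaMeasure (p.nak k) 1 := by
  have := isProbabilityMeasure_fading hnak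
  cases k
  · exact measurePreserving_fst.lintegral_comp hg
  · exact measurePreserving_snd.lintegral_comp hg

lemma measurable_link_apply {α β : Type*} [MeasurableSpace α] [MeasurableSpace β]
    {f : Link → α → β} (hf : ∀ k, Measurable (f k)) {l : α → Link} (hl : Measurable l) :
    Measurable fun a => f (l a) a :=
  (measurable_from_prod_countable_right (f := fun z : Link × α => f z.1 z.2) hf).comp
    (hl.prodMk measurable_id)

lemma measurable_sector_apply {α β : Type*} [MeasurableSpace α] [MeasurableSpace β]
    {f : Sector → α → β} (hf : ∀ s, Measurable (f s)) {l : α → Sector} (hl : Measurable l) :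
    Measurable fun a => f (l a) a :=
  (measurable_from_prod_countable_right (f := fun z : Sector × α => f z.1 z.2) hf).comp
    (hl.prodMk measurable_id)

lemma lintegral_markLaw (hC₀ : 0 ≤ p.C) (hC₁ : p.C ≤ 1) (hnak : ∀ j, 1 ≤ p.nak j)
    (hθ₀ : 0 ≤ p.thetab) (hθ₁ : p.thetab ≤ 180) (t : ℝ) {G : Link → Sector → ℝ → ℝ≥0∞}
    (hG : ∀ k s, Measurable (G k s)) :
    ∫⁻ m, G (markLink p t m) (markSector p m) (gain m (markLink p t m)) ∂markLaw p =
      ∑ k, ∑ s, ENNReal.ofReal (linkProb p t k) * (ENNReal.ofReal (sectorProb p s) *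
        ∫⁻ h, G k s h ∂gammaMeasure (p.nak k) 1) := by
  have := isProbabilityMeasure_uniformLaw one_pos
  have := isProbabilityMeasure_uniformLaw (a := -180) (b := 180) (by norm_num)
  have := isProbabilityMeasure_fading hnak
  have hlink : Measurable (markLink p t) :=
    (measurable_markLink p).comp (measurable_const.prodMk measurable_id)
  have hmeas : Measurable fun m : Mark =>
      G (markLink p t m) (markSector p m) (gain m (markLink p t m)) :=
    measurable_link_apply (f := fun k m => G k (markSector p m) (gain m k))
      (fun k => measurable_sector_apply (f := fun s m => G k s (gain m k))
        (fun s => (hG k s).comp (measurable_gain k)) (measurable_markSector p)) hlink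
  calc _ = ∫⁻ b, ∫⁻ a, ∫⁻ h, G (markLink p t (b, a, h)) (markSector p (b, a, h))
          (gain (b, a, h) (markLink p t (b, a, h)))
          ∂(gammaMeasure (p.nak Link.los) 1).prod (gammaMeasure (p.nak Link.nlos) 1)
          ∂uniformLaw (-180) 180 ∂uniformLaw 0 1 := by
        rw [markLaw, lintegral_prod _ hmeas.aemeasurable]
        exact lintegral_congr fun b =>
          lintegral_prod _ (hmeas.comp measurable_prodMk_left).aemeasurable
    _ = ∫⁻ b, ∫⁻ a, ∫⁻ h, G (if b < losProb p t then Link.los else Link.nlos)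
          (if |a| ≤ p.thetab then Sector.signal else Sector.noise) h
          ∂gammaMeasure (p.nak (if b < losProb p t then Link.los else Link.nlos)) 1
          ∂uniformLaw (-180) 180 ∂uniformLaw 0 1 :=
        lintegral_congr fun b => lintegral_congr fun a =>
          lintegral_comp_gain hnak b a (markLink p t (b, a, 0))
            (hG (markLink p t (b, a, 0)) (markSector p (b, a, 0)))
    _ = ∑ k, ENNReal.ofReal (linkProb p t k) * ∫⁻ a, ∫⁻ h,
          G k (if |a| ≤ p.thetab then Sector.signal else Sector.noise) h
          ∂gammaMeasure (p.nak k) 1 ∂uniformLaw (-180) 180 :=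
        lintegral_comp_link hC₀ hC₁ t fun k => ∫⁻ a, ∫⁻ h,
          G k (if |a| ≤ p.thetab then Sector.signal else Sector.noise) h
          ∂gammaMeasure (p.nak k) 1 ∂uniformLaw (-180) 180
    _ = _ := by
        refine Finset.sum_congr rfl fun k _ => ?_
        rw [lintegral_comp_sector hθ₀ hθ₁ fun s => ∫⁻ h, G k s h ∂gammaMeasure (p.nak k) 1,
          Finset.mul_sum]

end SingleMark

section Radial

lemma lintegral_volumeIoiPow_one {f : ℝ → ℝ≥0∞} (hf : Measurable f) :
    ∫⁻ x : Ioi (0 : ℝ), f x ∂.volumeIoiPow 1 = ∫⁻ t in Ioi (0 : ℝ), ENNReal.ofReal t * f t := by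
  rw [← lintegral_subtype_comap measurableSet_Ioi fun t => ENNReal.ofReal t * f t]
  simp only [Measure.volumeIoiPow, pow_one]
  exact lintegral_withDensity_eq_lintegral_mul _ (by fun_prop) (hf.comp measurable_subtype_coe)

lemma lintegral_fun_norm_plane {f : ℝ → ℝ≥0∞} (hf : Measurable f) :
    ∫⁻ x : Plane, f ‖x‖ = ENNReal.ofReal (2 * Real.pi) *
      ∫⁻ t in Ioi (0 : ℝ), ENNReal.ofReal t * f t := by
  have hdim : Module.finrank ℝ Plane = 2 := by simp
  have hsphere : (volume : Measure Plane).toSphere univ = ENNReal.ofReal (2 * Real.pi) := by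
    rw [Measure.toSphere_apply_univ, hdim, EuclideanSpace.volume_ball_fin_two,
      ENNReal.ofReal_mul (by norm_num)]
    simp
  calc ∫⁻ x : Plane, f ‖x‖
      = ∫⁻ x : ({(0)}ᶜ : Set Plane), f ‖x.1‖ ∂(volume.comap Subtype.val) := by
        rw [lintegral_subtype_comap (measurableSet_singleton _).compl fun x : Plane => f ‖x‖,
          restrict_compl_singleton]
    _ = ∫⁻ x, f x.2 ∂(volume : Measure Plane).toSphere.prod (.volumeIoiPow 1) := by
        simpa [hdim] using
          (volume : Measure Plane).measurePreserving_homeomorphUnitSphereProd.lintegral_comp_emb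
            (Homeomorph.measurableEmbedding _) fun z => f z.2
    _ = ENNReal.ofReal (2 * Real.pi) * ∫⁻ x : Ioi (0 : ℝ), f x ∂.volumeIoiPow 1 := by
        simpa [hsphere] using lintegral_prod_mul (μ := (volume : Measure Plane).toSphere)
          (ν := Measure.volumeIoiPow 1) (f := fun _ => 1) (g := fun x : Ioi (0 : ℝ) => f x)
          aemeasurable_const (hf.comp measurable_subtype_coe).aemeasurable
    _ = _ := by rw [lintegral_volumeIoiPow_one hf]

lemma lintegral_radial {lam : ℝ} (hlam : 0 ≤ lam) {f : ℝ → ℝ≥0∞} (hf : Measurable f) :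
    ∫⁻ x, f ‖x‖ ∂(ENNReal.ofReal lam • (volume : Measure Plane)) =
      ∫⁻ t in Ioi (0 : ℝ), ENNReal.ofReal (2 * Real.pi * lam * t) * f t := by
  rw [lintegral_smul_measure, lintegral_fun_norm_plane hf, smul_eq_mul, ← mul_assoc,
    ← lintegral_const_mul _ (by fun_prop), ← ENNReal.ofReal_mul hlam]
  refine lintegral_congr fun t => ?_
  rw [← mul_assoc, ← ENNReal.ofReal_mul (by positivity), mul_comm lam]

lemma measure_norm_preimage_singleton (lam c : ℝ) :
    (ENNReal.ofReal lam • (volume : Measure Plane)) ((fun x => ‖x‖) ⁻¹' {c}) = 0 := by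
  have hsphere : (fun x : Plane => ‖x‖) ⁻¹' {c} = Metric.sphere 0 c := by
    ext
    simp
  rw [hsphere, Measure.smul_apply, Measure.addHaar_sphere, smul_zero]

lemma lintegral_Ioc_two_mul {a b c : ℝ} (ha : 0 ≤ a) (hab : a ≤ b) (hc : 0 ≤ c) :
    ∫⁻ t in Ioc a b, ENNReal.ofReal (2 * c * t) = ENNReal.ofReal (c * (b ^ 2 - a ^ 2)) := by
  rw [← ofReal_integral_eq_lintegral_ofReal, ← intervalIntegral.integral_of_le hab]
  · rw [intervalIntegral.integral_const_mul, integral_id]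
    congr 1
    ring
  · exact (Continuous.integrableOn_Icc (by fun_prop)).mono_set Ioc_subset_Icc_self
  · filter_upwards [ae_restrict_mem measurableSet_Ioc] with t ht
    have := ha.trans ht.1.le
    positivity

end Radial

section Rival

variable {p : Params}

/-- The ranges of the parameters in the network model. -/
structure Params.IsAdmissible (p : Params) : Prop where
  lam_pos : 0 < p.lam
  C_nonneg : 0 ≤ p.C
  C_le_one : p.C ≤ 1
  D_pos : 0 < p.D
  coef_pos : ∀ j, 0 < p.coef j
  expo_pos : ∀ j, 0 < p.expo j
  one_le_nak : ∀ j, 1 ≤ p.nak j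
  Pt_pos : 0 < p.Pt
  Ms_pos : 0 < p.Ms
  Ma_nonneg : 0 ≤ p.Ma
  phi_pos : 0 < p.phi
  phi_le_one : p.phi ≤ 1
  thetab_nonneg : 0 ≤ p.thetab
  thetab_le : p.thetab ≤ 180
  N0_pos : 0 < p.N0

/-- Path loss at distance `t` for a base station with mark `m`. -/
def markLoss (p : Params) (t : ℝ) (m : Mark) : ℝ :=
  p.coef (markLink p t m) * t ^ (-p.expo (markLink p t m))

/-- Power received from an interfering base station at `y` with mark `m`. -/
def received (p : Params) (y : Plane) (m : Mark) : ℝ≥0∞ :=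
  ENNReal.ofReal (power p (markSector p m) * gain m (markLink p ‖y‖ m) * markLoss p ‖y‖ m)

/-- Barrier of a competitor `(y, m)` of a serving base station with a link of type `j` and length
`r`, where `z = (r, y, m)`: infinite if the competitor is stronger, and zero otherwise. Taking the
positive part of `r` makes it monotone in `r` on the whole line. -/
def barrier (p : Params) (j : Link) (z : ℝ × Plane × Mark) : ℝ≥0∞ :=
  if markLoss p ‖z.2.1‖ z.2.2 * max z.1 0 ^ p.expo j ≤ p.coef j then 0 else ⊤

/-- Exponent of a competitor, which forbids stronger base stations and weights the interference of
the others. -/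
def rivalExponent (p : Params) (j : Link) (c : ℝ) (z : ℝ × Plane × Mark) : ℝ≥0∞ :=
  barrier p j z + ENNReal.ofReal (c * max z.1 0 ^ p.expo j) * received p z.2.1 z.2.2

lemma measurable_markLoss (p : Params) : Measurable fun z : ℝ × Mark => markLoss p z.1 z.2 :=
  measurable_link_apply (f := fun k (z : ℝ × Mark) => p.coef k * z.1 ^ (-p.expo k))
    (fun k => by fun_prop) (measurable_markLink p)

lemma measurable_received (p : Params) :
    Measurable fun z : Plane × Mark => received p z.1 z.2 := by
  have hpolar : Measurable fun z : Plane × Mark => (‖z.1‖, z.2) := by fun_prop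
  have hgain := measurable_link_apply (f := fun k (z : Plane × Mark) => gain z.2 k)
    (fun k => (measurable_gain k).comp measurable_snd) ((measurable_markLink p).comp hpolar)
  have hpower : Measurable fun z : Plane × Mark => power p (markSector p z.2) :=
    (measurable_of_countable (power p)).comp ((measurable_markSector p).comp measurable_snd)
  exact ((hpower.mul hgain).mul ((measurable_markLoss p).comp hpolar)).ennreal_ofReal

lemma measurable_barrier (p : Params) (j : Link) : Measurable (barrier p j) := by
  have hloss : Measurable fun z : ℝ × Plane × Mark => markLoss p ‖z.2.1‖ z.2.2 :=
    (measurable_markLoss p).comp (f := fun z : ℝ × Plane × Mark => (‖z.2.1‖, z.2.2)) (by fun_prop)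
  exact Measurable.ite (measurableSet_le (hloss.mul (by fun_prop)) measurable_const)
    measurable_const measurable_const

lemma measurable_rivalExponent (p : Params) (j : Link) (c : ℝ) :
    Measurable (rivalExponent p j c) :=
  (measurable_barrier p j).add
    (Measurable.mul (by fun_prop) ((measurable_received p).comp measurable_snd))

lemma markLoss_nonneg (hcoef : ∀ j, 0 < p.coef j) {t : ℝ} (ht : 0 ≤ t) (m : Mark) :
    0 ≤ markLoss p t m :=
  mul_nonneg (hcoef _).le (Real.rpow_nonneg ht _)

lemma rivalExponent_monotone (hcoef : ∀ j, 0 < p.coef j) (hexpo : ∀ j, 0 < p.expo j)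
    (j : Link) {c : ℝ} (hc : 0 ≤ c) (y : Plane) (m : Mark) :
    Monotone fun r => rivalExponent p j c (r, y, m) := by
  intro r s hrs
  have hpow : max r 0 ^ p.expo j ≤ max s 0 ^ p.expo j :=
    Real.rpow_le_rpow (le_max_right _ _) (max_le_max_right 0 hrs) (hexpo j).le
  have hbarrier : barrier p j (r, y, m) ≤ barrier p j (s, y, m) := by
    unfold barrier
    by_cases hs : markLoss p ‖y‖ m * max s 0 ^ p.expo j ≤ p.coef j
    · have hloss := markLoss_nonneg hcoef (norm_nonneg y) m
      rw [if_pos ((mul_le_mul_of_nonneg_left hpow hloss).trans hs), if_pos hs]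
    · rw [if_neg hs]
      exact le_top
  exact add_le_add hbarrier (by gcongr)

lemma power_nonneg (hp : p.IsAdmissible) (s : Sector) : 0 ≤ power p s := by
  cases s
  · exact mul_nonneg (mul_nonneg hp.Ms_pos.le hp.phi_pos.le) hp.Pt_pos.le
  · exact mul_nonneg (mul_nonneg hp.Ma_nonneg (sub_nonneg.2 hp.phi_le_one)) hp.Pt_pos.le

lemma interference_coeff_nonneg (hp : p.IsAdmissible) (k : Link) (s : Sector) {c d t : ℝ}
    (hc : 0 ≤ c) (hd : 0 ≤ d) (ht : 0 ≤ t) :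
    0 ≤ c * d * power p s * p.coef k * t ^ (-p.expo k) :=
  mul_nonneg (mul_nonneg (mul_nonneg (mul_nonneg hc hd) (power_nonneg hp s)) (hp.coef_pos k).le)
    (Real.rpow_nonneg ht _)

lemma F_mem_Icc (hp : p.IsAdmissible) (k : Link) (s : Sector) {c d t : ℝ}
    (hc : 0 ≤ c) (hd : 0 ≤ d) (ht : 0 ≤ t) : F p k s c d t ∈ Icc (0 : ℝ) 1 := by
  have hone : 1 ≤ (1 + c * d * power p s * p.coef k * t ^ (-p.expo k)) ^ p.nak k :=
    one_le_pow₀ (le_add_of_nonneg_right (interference_coeff_nonneg hp k s hc hd ht))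
  have hpos := one_pos.trans_le hone
  exact ⟨sub_nonneg.2 ((div_le_one hpos).2 hone), sub_le_self _ (one_div_nonneg.2 hpos.le)⟩

lemma measurable_F (p : Params) (k : Link) (s : Sector) (c d : ℝ) : Measurable (F p k s c d) := by
  unfold F
  fun_prop

/-- Probability that a competitor with a link of type `k` and length `t` is stronger than the
serving base station, or removed by a thinning with the interference it causes. -/
def rivalEffect (p : Params) (j : Link) (c r : ℝ) (k : Link) (t : ℝ) : ℝ≥0∞ :=
  ∑ s, ENNReal.ofReal (sectorProb p s) *
    if p.coef k * t ^ (-p.expo k) * r ^ p.expo j ≤ p.coef j then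
      ENNReal.ofReal (F p k s c (r ^ p.expo j) t) else 1

lemma measurable_rivalEffect (p : Params) (j : Link) (c r : ℝ) (k : Link) :
    Measurable (rivalEffect p j c r k) :=
  Finset.measurable_fun_sum _ fun s _ => measurable_const.mul <|
    Measurable.ite (measurableSet_le (by fun_prop) measurable_const)
      (measurable_F p k s c _).ennreal_ofReal measurable_const

lemma lintegral_nexp_rival_gammaMeasure (hp : p.IsAdmissible) (j k : Link) (s : Sector)
    {c r t : ℝ} (hc : 0 ≤ c) (hr : 0 ≤ r) (ht : 0 ≤ t) :
    ∫⁻ h, nexp ((if p.coef k * t ^ (-p.expo k) * r ^ p.expo j ≤ p.coef j then 0 else ⊤) +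
        ENNReal.ofReal (c * r ^ p.expo j) *
          ENNReal.ofReal (power p s * h * (p.coef k * t ^ (-p.expo k))))
        ∂gammaMeasure (p.nak k) 1 =
      if p.coef k * t ^ (-p.expo k) * r ^ p.expo j ≤ p.coef j then
        ENNReal.ofReal (1 - F p k s c (r ^ p.expo j) t) else 0 := by
  have hd : 0 ≤ r ^ p.expo j := Real.rpow_nonneg hr _
  split_ifs
  · rw [F, sub_sub_cancel, ← Real.rpow_natCast, ← lintegral_nexp_gammaMeasure
      (mod_cast hp.one_le_nak k) (interference_coeff_nonneg hp k s hc hd ht)]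
    refine lintegral_congr fun h => ?_
    rw [zero_add, ← ENNReal.ofReal_mul (mul_nonneg hc hd)]
    congr 2
    ring
  · simp

lemma sum_mul_add_sum_mul_eq_one {ι : Type*} [Fintype ι] {w x y : ι → ℝ≥0∞}
    (hw : ∑ i, w i = 1) (hxy : ∀ i, x i + y i = 1) :
    ∑ i, w i * x i + ∑ i, w i * y i = 1 := by
  simp_rw [← Finset.sum_add_distrib, ← mul_add, hxy, mul_one, hw]

lemma one_sub_lintegral_nexp_rivalExponent (hp : p.IsAdmissible) (j : Link) {c r : ℝ}
    (hc : 0 ≤ c) (hr : 0 ≤ r) (y : Plane) :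
    1 - ∫⁻ m, nexp (rivalExponent p j c (r, y, m)) ∂markLaw p =
      ∑ k, ENNReal.ofReal (linkProb p ‖y‖ k) * rivalEffect p j c r k ‖y‖ := by
  let W : Link → Sector → ℝ → ℝ≥0∞ := fun k s h =>
    (if p.coef k * ‖y‖ ^ (-p.expo k) * r ^ p.expo j ≤ p.coef j then 0 else ⊤) +
      ENNReal.ofReal (c * r ^ p.expo j) *
        ENNReal.ofReal (power p s * h * (p.coef k * ‖y‖ ^ (-p.expo k)))
  have hW : ∀ m, rivalExponent p j c (r, y, m) =
      W (markLink p ‖y‖ m) (markSector p m) (gain m (markLink p ‖y‖ m)) := fun m => by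
    simp only [rivalExponent, barrier, received, markLoss, W, max_eq_left hr]
  have hmark : ∫⁻ m, nexp (rivalExponent p j c (r, y, m)) ∂markLaw p =
      ∑ k, ENNReal.ofReal (linkProb p ‖y‖ k) * ∑ s, ENNReal.ofReal (sectorProb p s) *
        ∫⁻ h, nexp (W k s h) ∂gammaMeasure (p.nak k) 1 := by
    simp_rw [hW, Finset.mul_sum]
    exact lintegral_markLaw hp.C_nonneg hp.C_le_one hp.one_le_nak hp.thetab_nonneg hp.thetab_le
      ‖y‖ (G := fun k s h => nexp (W k s h)) fun k s => measurable_nexp.comp (by fun_prop)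
  have htotal : ∑ k, ENNReal.ofReal (linkProb p ‖y‖ k) * rivalEffect p j c r k ‖y‖ +
      ∫⁻ m, nexp (rivalExponent p j c (r, y, m)) ∂markLaw p = 1 := by
    rw [hmark]
    refine sum_mul_add_sum_mul_eq_one (sum_linkProb hp.C_nonneg hp.C_le_one _) fun k => ?_
    refine sum_mul_add_sum_mul_eq_one (sum_sectorProb hp.thetab_nonneg hp.thetab_le) fun s => ?_
    rw [lintegral_nexp_rival_gammaMeasure hp j k s hc hr (norm_nonneg y)]
    have hF := F_mem_Icc hp k s hc (Real.rpow_nonneg hr (p.expo j)) (norm_nonneg y)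
    split_ifs
    · rw [← ENNReal.ofReal_add hF.1 (sub_nonneg.2 hF.2), add_sub_cancel, ENNReal.ofReal_one]
    · rw [add_zero]
  exact ENNReal.sub_eq_of_eq_add
    (ne_top_of_le_ne_top ENNReal.one_ne_top (le_add_self.trans_eq htotal)) htotal.symm

end Rival

section Rivals

variable {p : Params}

/-- Distance at which a link of type `k` is as strong as a link of type `j` at distance `r`. -/
def equalLossDist (p : Params) (j k : Link) (r : ℝ) : ℝ :=
  (p.coef k / p.coef j) ^ (1 / p.expo k) * r ^ (p.expo j / p.expo k)

lemma equalLossDist_self (hcoef : ∀ j, 0 < p.coef j) (hexpo : ∀ j, 0 < p.expo j)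
    (j : Link) (r : ℝ) : equalLossDist p j j r = r := by
  simp [equalLossDist, div_self (hcoef j).ne', div_self (hexpo j).ne']

lemma equalLossDist_nonneg (hcoef : ∀ j, 0 < p.coef j) (j k : Link) {r : ℝ}
    (hr : 0 ≤ r) : 0 ≤ equalLossDist p j k r :=
  mul_nonneg (Real.rpow_nonneg (div_nonneg (hcoef k).le (hcoef j).le) _) (Real.rpow_nonneg hr _)

lemma equalLossDist_rpow (hcoef : ∀ j, 0 < p.coef j) (hexpo : ∀ j, 0 < p.expo j)
    (j k : Link) {r : ℝ} (hr : 0 ≤ r) :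
    equalLossDist p j k r ^ p.expo k = p.coef k / p.coef j * r ^ p.expo j := by
  have hratio : 0 ≤ p.coef k / p.coef j := div_nonneg (hcoef k).le (hcoef j).le
  rw [equalLossDist, Real.mul_rpow (Real.rpow_nonneg hratio _) (Real.rpow_nonneg hr _),
    ← Real.rpow_mul hratio, ← Real.rpow_mul hr, one_div_mul_cancel (hexpo k).ne', Real.rpow_one,
    div_mul_cancel₀ _ (hexpo k).ne']

lemma not_stronger_iff (hcoef : ∀ j, 0 < p.coef j) (hexpo : ∀ j, 0 < p.expo j)
    (j k : Link) {r t : ℝ} (hr : 0 ≤ r) (ht : 0 < t) :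
    p.coef k * t ^ (-p.expo k) * r ^ p.expo j ≤ p.coef j ↔ equalLossDist p j k r ≤ t := by
  rw [← Real.rpow_le_rpow_iff (equalLossDist_nonneg hcoef j k hr) ht.le (hexpo k),
    equalLossDist_rpow hcoef hexpo j k hr, Real.rpow_neg ht.le, mul_right_comm, ← div_eq_mul_inv,
    div_le_iff₀ (Real.rpow_pos_of_pos ht _), div_mul_eq_mul_div, div_le_iff₀ (hcoef j),
    mul_comm (p.coef j)]

lemma rivalEffect_of_lt (hp : p.IsAdmissible) (j : Link) (c : ℝ) {r : ℝ} (hr : 0 ≤ r) (k : Link)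
    {t : ℝ} (ht : 0 < t) (hlt : t < equalLossDist p j k r) : rivalEffect p j c r k t = 1 := by
  have hstronger := mt (not_stronger_iff hp.coef_pos hp.expo_pos j k hr ht).1 hlt.not_ge
  simp only [rivalEffect, if_neg hstronger, mul_one, sum_sectorProb hp.thetab_nonneg hp.thetab_le]

lemma rivalEffect_of_le (hp : p.IsAdmissible) (j : Link) (c : ℝ) {r : ℝ} (hr : 0 ≤ r) (k : Link)
    {t : ℝ} (ht : 0 < t) (hle : equalLossDist p j k r ≤ t) :
    rivalEffect p j c r k t = ∑ s, ENNReal.ofReal (sectorProb p s) *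
      ENNReal.ofReal (F p k s c (r ^ p.expo j) t) := by
  simp only [rivalEffect, if_pos ((not_stronger_iff hp.coef_pos hp.expo_pos j k hr ht).2 hle)]

/-- The exponent in `Delta`. -/
def deltaExponent (p : Params) (k : Link) (s : Sector) (z : ℝ) (I : Set ℝ) (c d : ℝ) : ℝ≥0∞ :=
  ENNReal.ofReal (2 * Real.pi * z * p.lam * sectorProb p s) *
    ∫⁻ y in I, ENNReal.ofReal (F p k s c d y * y)

lemma Delta_nonneg (p : Params) (k : Link) (s : Sector) (z : ℝ) (I : Set ℝ) (c d : ℝ) :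
    0 ≤ Delta p k s z I c d := ENNReal.toReal_nonneg

lemma Delta_le_one (p : Params) (k : Link) (s : Sector) (z : ℝ) (I : Set ℝ) (c d : ℝ) :
    Delta p k s z I c d ≤ 1 :=
  ENNReal.toReal_le_of_le_ofReal zero_le_one (ENNReal.ofReal_one ▸ nexp_le_one _)

lemma nexp_deltaExponent (p : Params) (k : Link) (s : Sector) (z : ℝ) (I : Set ℝ) (c d : ℝ) :
    nexp (deltaExponent p k s z I c d) = ENNReal.ofReal (Delta p k s z I c d) :=
  (ENNReal.ofReal_toReal (nexp_ne_top _)).symm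

lemma deltaExponent_congr (p : Params) (k : Link) (s : Sector) (z : ℝ) {I J : Set ℝ}
    (hIJ : I =ᵐ[volume] J) (c d : ℝ) :
    deltaExponent p k s z I c d = deltaExponent p k s z J c d := by
  rw [deltaExponent, deltaExponent, setLIntegral_congr hIJ]

lemma sum_deltaExponent (hlam : 0 ≤ p.lam) (hθ₀ : 0 ≤ p.thetab) (hθ₁ : p.thetab ≤ 180)
    (k : Link) {z : ℝ} (hz : 0 ≤ z) {I : Set ℝ} (hI : MeasurableSet I) (hpos : I ⊆ Ioi 0)
    (c d : ℝ) :
    ∑ s, deltaExponent p k s z I c d = ∫⁻ t in I, ENNReal.ofReal (2 * Real.pi * p.lam * t) *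
      (ENNReal.ofReal z * ∑ s, ENNReal.ofReal (sectorProb p s) *
        ENNReal.ofReal (F p k s c d t)) := by
  have hF : ∀ s, Measurable fun t => ENNReal.ofReal (F p k s c d t * t) := fun s =>
    ((measurable_F p k s c d).mul measurable_id).ennreal_ofReal
  simp_rw [deltaExponent, ← lintegral_const_mul _ (hF _)]
  rw [← lintegral_finsetSum _ fun s _ => (hF s).const_mul _]
  refine setLIntegral_congr_fun hI fun t ht => ?_
  have ht₀ : 0 < t := hpos ht
  simp only [Finset.mul_sum]
  refine Finset.sum_congr rfl fun s _ => ?_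
  have hs := sectorProb_nonneg hθ₀ hθ₁ s
  rw [← ENNReal.ofReal_mul hs, ← ENNReal.ofReal_mul hz, ← ENNReal.ofReal_mul (by positivity),
    ← ENNReal.ofReal_mul (by positivity)]
  congr 1
  ring

lemma setLIntegral_rivalEffect (hp : p.IsAdmissible) (j : Link) (c : ℝ) {r : ℝ} (hr : 0 ≤ r)
    (k : Link) {z : ℝ} (hz : 0 ≤ z) {R : Set ℝ} (hR : MeasurableSet R) (hpos : R ⊆ Ioi 0)
    (hlink : ∀ t ∈ R, linkProb p t k = z) :
    ∫⁻ t in R, ENNReal.ofReal (2 * Real.pi * p.lam * t) *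
        (ENNReal.ofReal (linkProb p t k) * rivalEffect p j c r k t) =
      (∫⁻ t in R ∩ Iio (equalLossDist p j k r), ENNReal.ofReal (2 * (Real.pi * p.lam * z) * t)) +
        ∑ s, deltaExponent p k s z (R ∩ Ici (equalLossDist p j k r)) c (r ^ p.expo j) := by
  have hlam := hp.lam_pos
  rw [← lintegral_inter_add_sdiff _ R (measurableSet_Iio (a := equalLossDist p j k r)),
    sdiff_eq, compl_Iio,
    sum_deltaExponent hlam.le hp.thetab_nonneg hp.thetab_le k hz (hR.inter measurableSet_Ici)
      (inter_subset_left.trans hpos)]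
  congr 1
  · refine setLIntegral_congr_fun (hR.inter measurableSet_Iio) fun t ht => ?_
    have ht₀ : 0 < t := hpos ht.1
    rw [hlink t ht.1, rivalEffect_of_lt hp j c hr k ht₀ ht.2, mul_one,
      ← ENNReal.ofReal_mul (by positivity)]
    congr 1
    ring
  · refine setLIntegral_congr_fun (hR.inter measurableSet_Ici) fun t ht => ?_
    rw [hlink t ht.1, rivalEffect_of_le hp j c hr k (hpos ht.1) ht.2]

lemma ae_eq_of_forall_ne {A B : Set ℝ} (h : ℝ) (hAB : ∀ t, t ≠ h → (t ∈ A ↔ t ∈ B)) :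
    A =ᵐ[volume] B := by
  filter_upwards [Measure.ae_ne volume h] with t ht
  exact propext (hAB t ht)

lemma Ioc_inter_Ici_ae {h : ℝ} (hh : 0 ≤ h) (D : ℝ) :
    (Ioc 0 D ∩ Ici h : Set ℝ) =ᵐ[volume] Ioc (min h D) D :=
  ae_eq_of_forall_ne h fun t ht => by grind

lemma Ioi_inter_Ici_ae (h D : ℝ) : (Ioi D ∩ Ici h : Set ℝ) =ᵐ[volume] Ioi (max h D) :=
  ae_eq_of_forall_ne h fun t ht => by grind

lemma Ioc_inter_Iio_ae (h D : ℝ) : (Ioc 0 D ∩ Iio h : Set ℝ) =ᵐ[volume] Ioc 0 (min h D) :=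
  ae_eq_of_forall_ne h fun t ht => by grind

lemma Ioi_inter_Iio_ae (h D : ℝ) : (Ioi D ∩ Iio h : Set ℝ) =ᵐ[volume] Ioc D (max h D) :=
  ae_eq_of_forall_ne h fun t ht => by grind

lemma lintegral_rivalEffect (hp : p.IsAdmissible) (j : Link) (c : ℝ) {r : ℝ} (hr : 0 ≤ r)
    (k : Link) {a b : ℝ} (ha : 0 ≤ a) (hb : 0 ≤ b) (hin : ∀ t ≤ p.D, linkProb p t k = a)
    (hout : ∀ t, p.D < t → linkProb p t k = b) :
    ∫⁻ t in Ioi 0, ENNReal.ofReal (2 * Real.pi * p.lam * t) *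
        (ENNReal.ofReal (linkProb p t k) * rivalEffect p j c r k t) =
      ENNReal.ofReal (Real.pi * p.lam * (a * min (equalLossDist p j k r) p.D ^ 2 +
        b * (max (equalLossDist p j k r) p.D ^ 2 - p.D ^ 2))) +
        ∑ s, (deltaExponent p k s a (Ioc (min (equalLossDist p j k r) p.D) p.D) c (r ^ p.expo j) +
          deltaExponent p k s b (Ioi (max (equalLossDist p j k r) p.D)) c (r ^ p.expo j)) := by
  have hD := hp.D_pos.le
  have hlam := hp.lam_pos
  have hh := equalLossDist_nonneg hp.coef_pos j k hr
  have hmax : 0 ≤ max (equalLossDist p j k r) p.D ^ 2 - p.D ^ 2 :=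
    sub_nonneg.2 (pow_le_pow_left₀ hD (le_max_right _ _) 2)
  rw [← Ioc_union_Ioi_eq_Ioi hD, lintegral_union measurableSet_Ioi (Ioc_disjoint_Ioi le_rfl),
    setLIntegral_rivalEffect hp j c hr k ha measurableSet_Ioc Ioc_subset_Ioi_self
      fun t ht => hin t ht.2,
    setLIntegral_rivalEffect hp j c hr k hb measurableSet_Ioi (Ioi_subset_Ioi hD) hout,
    setLIntegral_congr (Ioc_inter_Iio_ae _ p.D), setLIntegral_congr (Ioi_inter_Iio_ae _ p.D),
    lintegral_Ioc_two_mul le_rfl (le_min hh hD) (by positivity),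
    lintegral_Ioc_two_mul hD (le_max_right _ _) (by positivity),
    add_add_add_comm, ← ENNReal.ofReal_add (mul_nonneg (by positivity) (by simpa using sq_nonneg _))
      (by positivity)]
  simp_rw [deltaExponent_congr p k _ _ (Ioc_inter_Ici_ae hh p.D),
    deltaExponent_congr p k _ _ (Ioi_inter_Ici_ae _ p.D)]
  refine congrArg₂ (· + ·) (congrArg ENNReal.ofReal (by ring)) (Finset.sum_add_distrib ..).symm

/-- Mean number of base stations that are stronger than a link of type `j` and length `r`. -/
def strongerMean (p : Params) (j : Link) (r : ℝ) : ℝ :=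
  Real.pi * p.lam * (p.C * min (equalLossDist p j Link.los r) p.D ^ 2 +
    (equalLossDist p j Link.nlos r ^ 2 - p.C * min (equalLossDist p j Link.nlos r) p.D ^ 2))

/-- Laplace transform of the interference from the sector `s`, given that the serving link has
type `j` and length `r`. -/
def rivalFactor (p : Params) (j : Link) (c r : ℝ) (s : Sector) : ℝ :=
  Delta p Link.los s p.C (Ioc (min (equalLossDist p j Link.los r) p.D) p.D) c (r ^ p.expo j) *
  Delta p Link.nlos s (1 - p.C) (Ioc (min (equalLossDist p j Link.nlos r) p.D) p.D) c
    (r ^ p.expo j) *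
  Delta p Link.nlos s 1 (Ioi (max (equalLossDist p j Link.nlos r) p.D)) c (r ^ p.expo j)

lemma rivalFactor_nonneg (p : Params) (j : Link) (c r : ℝ) (s : Sector) :
    0 ≤ rivalFactor p j c r s :=
  mul_nonneg (mul_nonneg (Delta_nonneg ..) (Delta_nonneg ..)) (Delta_nonneg ..)

lemma rivalFactor_le_one (p : Params) (j : Link) (c r : ℝ) (s : Sector) :
    rivalFactor p j c r s ≤ 1 :=
  mul_le_one₀ (mul_le_one₀ (Delta_le_one ..) (Delta_nonneg ..) (Delta_le_one ..))
    (Delta_nonneg ..) (Delta_le_one ..)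

lemma ofReal_rivalFactor (p : Params) (j : Link) (c r : ℝ) (s : Sector) :
    ENNReal.ofReal (rivalFactor p j c r s) = nexp
      (deltaExponent p Link.los s p.C (Ioc (min (equalLossDist p j Link.los r) p.D) p.D) c
          (r ^ p.expo j) +
        (deltaExponent p Link.nlos s (1 - p.C) (Ioc (min (equalLossDist p j Link.nlos r) p.D) p.D)
            c (r ^ p.expo j) +
          deltaExponent p Link.nlos s 1 (Ioi (max (equalLossDist p j Link.nlos r) p.D)) c
            (r ^ p.expo j))) := by
  rw [rivalFactor, ENNReal.ofReal_mul (mul_nonneg (Delta_nonneg ..) (Delta_nonneg ..)),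
    ENNReal.ofReal_mul (Delta_nonneg ..), nexp_add, nexp_add, nexp_deltaExponent,
    nexp_deltaExponent, nexp_deltaExponent, mul_assoc]

lemma lintegral_rivalEffect_los (hp : p.IsAdmissible) (j : Link) (c : ℝ) {r : ℝ} (hr : 0 ≤ r) :
    ∫⁻ t in Ioi 0, ENNReal.ofReal (2 * Real.pi * p.lam * t) *
        (ENNReal.ofReal (linkProb p t Link.los) * rivalEffect p j c r Link.los t) =
      ENNReal.ofReal (Real.pi * p.lam * (p.C * min (equalLossDist p j Link.los r) p.D ^ 2)) +
        ∑ s, deltaExponent p Link.los s p.C (Ioc (min (equalLossDist p j Link.los r) p.D) p.D) c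
          (r ^ p.expo j) := by
  rw [lintegral_rivalEffect hp j c hr Link.los hp.C_nonneg le_rfl (fun t ht => if_pos ht)
    fun t ht => if_neg ht.not_ge]
  simp [deltaExponent]

lemma lintegral_rivalEffect_nlos (hp : p.IsAdmissible) (j : Link) (c : ℝ) {r : ℝ} (hr : 0 ≤ r) :
    ∫⁻ t in Ioi 0, ENNReal.ofReal (2 * Real.pi * p.lam * t) *
        (ENNReal.ofReal (linkProb p t Link.nlos) * rivalEffect p j c r Link.nlos t) =
      ENNReal.ofReal (Real.pi * p.lam * (equalLossDist p j Link.nlos r ^ 2 -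
          p.C * min (equalLossDist p j Link.nlos r) p.D ^ 2)) +
        ∑ s, (deltaExponent p Link.nlos s (1 - p.C)
            (Ioc (min (equalLossDist p j Link.nlos r) p.D) p.D) c (r ^ p.expo j) +
          deltaExponent p Link.nlos s 1 (Ioi (max (equalLossDist p j Link.nlos r) p.D)) c
            (r ^ p.expo j)) := by
  have hmax : max (equalLossDist p j Link.nlos r) p.D ^ 2 - p.D ^ 2 =
      equalLossDist p j Link.nlos r ^ 2 - min (equalLossDist p j Link.nlos r) p.D ^ 2 := by
    rcases le_total (equalLossDist p j Link.nlos r) p.D with h | h <;> simp [h]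
  rw [lintegral_rivalEffect hp j c hr Link.nlos (sub_nonneg.2 hp.C_le_one) zero_le_one
    (fun t ht => by rw [linkProb, losProb, if_pos ht])
    (fun t ht => by rw [linkProb, losProb, if_neg ht.not_ge, sub_zero]), hmax]
  congr 3
  ring

lemma mul_sq_le_sq (hp : p.IsAdmissible) {s t : ℝ} (hs : 0 ≤ s) (hst : s ≤ t) :
    p.C * s ^ 2 ≤ t ^ 2 :=
  (mul_le_of_le_one_left (sq_nonneg _) hp.C_le_one).trans (pow_le_pow_left₀ hs hst 2)

lemma mul_min_sq_le_sq (hp : p.IsAdmissible) {t : ℝ} (ht : 0 ≤ t) :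
    p.C * min t p.D ^ 2 ≤ t ^ 2 :=
  mul_sq_le_sq hp (le_min ht hp.D_pos.le) (min_le_left _ _)

lemma nexp_lintegral_rivals (hp : p.IsAdmissible) (j : Link) {c r : ℝ} (hc : 0 ≤ c) (hr : 0 ≤ r) :
    nexp (∫⁻ y, (1 - ∫⁻ m, nexp (rivalExponent p j c (r, y, m)) ∂markLaw p)
        ∂(ENNReal.ofReal p.lam • (volume : Measure Plane))) =
      ENNReal.ofReal (Real.exp (-strongerMean p j r) * ∏ s, rivalFactor p j c r s) := by
  have hlam := hp.lam_pos
  have hC := hp.C_nonneg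
  have hnlos := sub_nonneg.2 (mul_min_sq_le_sq hp (equalLossDist_nonneg hp.coef_pos j Link.nlos hr))
  have hmeas : ∀ k, Measurable fun t =>
      ENNReal.ofReal (linkProb p t k) * rivalEffect p j c r k t := fun k =>
    (measurable_linkProb p k).ennreal_ofReal.mul (measurable_rivalEffect p j c r k)
  have hmean : 0 ≤ strongerMean p j r := by
    unfold strongerMean
    positivity
  simp_rw [one_sub_lintegral_nexp_rivalExponent hp j hc hr]
  rw [lintegral_radial hlam.le (f := fun t => ∑ k, ENNReal.ofReal (linkProb p t k) *
    rivalEffect p j c r k t) (Finset.measurable_fun_sum _ fun k _ => hmeas k)]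
  simp_rw [sum_link, mul_add]
  rw [lintegral_add_left (f := fun t => ENNReal.ofReal (2 * Real.pi * p.lam * t) *
      (ENNReal.ofReal (linkProb p t Link.los) * rivalEffect p j c r Link.los t))
      (by exact Measurable.mul (by fun_prop) (hmeas _)),
    lintegral_rivalEffect_los hp j c hr, lintegral_rivalEffect_nlos hp j c hr, add_add_add_comm,
    ← ENNReal.ofReal_add (by positivity) (by positivity), ← Finset.sum_add_distrib, ← mul_add,
    nexp_add, nexp_sum, ← strongerMean, nexp_ofReal hmean,
    ENNReal.ofReal_mul (Real.exp_pos _).le,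
    ENNReal.ofReal_prod_of_nonneg fun s _ => rivalFactor_nonneg p j c r s]
  simp_rw [ofReal_rivalFactor]

end Rivals

section Binomial

lemma one_sub_pow_add_sum_odd {R : Type*} [CommRing R] (N : ℕ) (x : R) :
    (1 - x) ^ N + ∑ n ∈ Finset.Icc 1 N with ¬ Even n, (N.choose n : R) * x ^ n =
      1 + ∑ n ∈ Finset.Icc 1 N with Even n, (N.choose n : R) * x ^ n := by
  have hterm : ∀ n, (-x) ^ n * (N.choose n : R) =
      if Even n then N.choose n * x ^ n else -(N.choose n * x ^ n) := fun n => by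
    split_ifs with hn
    · rw [hn.neg_pow, mul_comm]
    · rw [(Nat.not_even_iff_odd.1 hn).neg_pow, neg_mul, mul_comm]
  have hbinom : (1 - x) ^ N = 1 + ∑ n ∈ Finset.Icc 1 N, (-x) ^ n * (N.choose n : R) := by
    rw [sub_eq_neg_add, add_pow, Finset.range_eq_Ico,
      Finset.sum_eq_sum_Ico_succ_bot (Nat.succ_pos N)]
    simp [Finset.Ico_add_one_right_eq_Icc]
  rw [hbinom]
  simp_rw [hterm]
  rw [Finset.sum_ite, Finset.sum_neg_distrib, ← add_assoc, neg_add_cancel_right]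

lemma one_sub_one_sub_pow_add_sum_even (N : ℕ) {u : ℝ≥0∞} (hu : u ≤ 1) :
    1 - (1 - u) ^ N + ∑ n ∈ Finset.Icc 1 N with Even n, (N.choose n : ℝ≥0∞) * u ^ n =
      ∑ n ∈ Finset.Icc 1 N with ¬ Even n, (N.choose n : ℝ≥0∞) * u ^ n := by
  lift u to NNReal using ne_top_of_le_ne_top ENNReal.one_ne_top hu
  have hu' : u ≤ 1 := mod_cast hu
  have hpow : (1 - u) ^ N ≤ 1 := pow_le_one₀ zero_le tsub_le_self
  norm_cast
  rw [← NNReal.coe_inj]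
  push_cast [NNReal.coe_sub hu', NNReal.coe_sub hpow]
  linear_combination -one_sub_pow_add_sum_odd N (u : ℝ)

end Binomial

section Connection

variable {p : Params}

lemma alzer_pos (p : Params) (j : Link) : 0 < alzer p j :=
  Real.rpow_pos_of_pos (mod_cast Nat.factorial_pos _) _

lemma alzer_pow {j : Link} (hnak : 1 ≤ p.nak j) :
    alzer p j ^ p.nak j * (p.nak j).factorial = 1 := by
  have hfact : (0 : ℝ) < (p.nak j).factorial := mod_cast Nat.factorial_pos _
  have hn : (p.nak j : ℝ) ≠ 0 := mod_cast (one_pos.trans_le hnak).ne'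
  rw [alzer, ← Real.rpow_natCast, ← Real.rpow_mul hfact.le, neg_mul, one_div_mul_cancel hn,
    Real.rpow_neg_one, inv_mul_cancel₀ hfact.ne']

lemma gammaMeasure_nak_tail_le {j : Link} (hnak : 1 ≤ p.nak j) (T : ℝ≥0∞) :
    gammaMeasure (p.nak j) 1 {h | T ≤ ENNReal.ofReal h} ≤
      1 - (1 - nexp (ENNReal.ofReal (alzer p j) * T)) ^ p.nak j := by
  have halzer := alzer_pow hnak
  obtain ⟨m, hm⟩ := Nat.exists_eq_add_of_le' hnak
  rw [hm] at halzer ⊢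
  exact_mod_cast gammaMeasure_setOf_le_ofReal_le (alzer_pos p j) halzer T

/-- Gain that a serving link of type `j` and length `r` needs per unit of interference. -/
def gainFactor (p : Params) (Tc : ℝ) (j : Link) (r : ℝ) : ℝ :=
  Tc * r ^ p.expo j / (p.phi * p.Pt * p.Ms * p.coef j)

lemma gainFactor_nonneg (hp : p.IsAdmissible) {Tc : ℝ} (hTc : 0 ≤ Tc) (j : Link) {r : ℝ}
    (hr : 0 ≤ r) : 0 ≤ gainFactor p Tc j r :=
  div_nonneg (mul_nonneg hTc (Real.rpow_nonneg hr _))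
    (mul_pos (mul_pos (mul_pos hp.phi_pos hp.Pt_pos) hp.Ms_pos) (hp.coef_pos j)).le

/-- Total barrier of the competitors of the base station `i`: zero if none of them is stronger,
and infinite otherwise. -/
def totalBarrier (p : Params) (j : Link) (i : ℕ) (x : ℕ → Plane) (m : {k : ℕ // k ≠ i} → Mark) :
    ℝ≥0∞ :=
  ∑' k : {k : ℕ // k ≠ i}, barrier p j (‖x i‖, x k, m k)

/-- Interference plus noise for the serving base station `i`. -/
def interferenceNoise (p : Params) (i : ℕ) (x : ℕ → Plane) (m : {k : ℕ // k ≠ i} → Mark) :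
    ℝ≥0∞ :=
  ∑' k : {k : ℕ // k ≠ i}, received p (x k) (m k) + ENNReal.ofReal p.N0

/-- Gain with which the SINR of the serving base station `i` reaches `Tc` over a link of
type `j`. -/
def requiredGain (p : Params) (Tc : ℝ) (j : Link) (i : ℕ) (x : ℕ → Plane)
    (m : {k : ℕ // k ≠ i} → Mark) : ℝ≥0∞ :=
  ENNReal.ofReal (gainFactor p Tc j ‖x i‖) * interferenceNoise p i x m

/-- Indicator of a connection through the base station `i`, with mark `m₀`, over a link of
type `j`. -/
def connIndicator (p : Params) (Tc : ℝ) (j : Link) (i : ℕ) (x : ℕ → Plane) (m₀ : Mark)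
    (m : {k : ℕ // k ≠ i} → Mark) : ℝ≥0∞ :=
  {m' | markLink p ‖x i‖ m' = j ∧
    requiredGain p Tc j i x m ≤ ENNReal.ofReal (gain m' j)}.indicator 1 m₀ *
      nexp (totalBarrier p j i x m)

lemma measurable_totalBarrier (p : Params) (j : Link) (i : ℕ) :
    Measurable fun z : (ℕ → Plane) × ({k : ℕ // k ≠ i} → Mark) => totalBarrier p j i z.1 z.2 :=
  Measurable.tsum fun k => (measurable_barrier p j).comp (by fun_prop)

lemma measurable_interferenceNoise (p : Params) (i : ℕ) :
    Measurable fun z : (ℕ → Plane) × ({k : ℕ // k ≠ i} → Mark) =>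
      interferenceNoise p i z.1 z.2 :=
  (Measurable.tsum fun k : {k : ℕ // k ≠ i} => (measurable_received p).comp
    (f := fun z : (ℕ → Plane) × ({k : ℕ // k ≠ i} → Mark) => (z.1 k, z.2 k))
    (by fun_prop)).add measurable_const

lemma measurable_requiredGain (p : Params) (Tc : ℝ) (j : Link) (i : ℕ) :
    Measurable fun z : (ℕ → Plane) × ({k : ℕ // k ≠ i} → Mark) =>
      requiredGain p Tc j i z.1 z.2 := by
  have hfactor : Measurable fun z : (ℕ → Plane) × ({k : ℕ // k ≠ i} → Mark) =>
      ENNReal.ofReal (gainFactor p Tc j ‖z.1 i‖) := by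
    unfold gainFactor
    fun_prop
  exact hfactor.mul (measurable_interferenceNoise p i)

lemma measurable_connIndicator (p : Params) (Tc : ℝ) (j : Link) (i : ℕ) :
    Measurable fun z : (ℕ → Plane) × Mark × ({k : ℕ // k ≠ i} → Mark) =>
      connIndicator p Tc j i z.1 z.2.1 z.2.2 := by
  have hforget : Measurable fun z : (ℕ → Plane) × Mark × ({k : ℕ // k ≠ i} → Mark) =>
      (z.1, z.2.2) := by fun_prop
  have hlink : MeasurableSet {z : (ℕ → Plane) × Mark × ({k : ℕ // k ≠ i} → Mark) |
      markLink p ‖z.1 i‖ z.2.1 = j} :=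
    (measurable_markLink p).comp (f := fun z : (ℕ → Plane) × Mark × ({k : ℕ // k ≠ i} → Mark) =>
      (‖z.1 i‖, z.2.1)) (by fun_prop) (measurableSet_singleton j)
  have hgain : Measurable fun z : (ℕ → Plane) × Mark × ({k : ℕ // k ≠ i} → Mark) =>
      ENNReal.ofReal (gain z.2.1 j) :=
    ((measurable_gain j).comp (measurable_fst.comp measurable_snd)).ennreal_ofReal
  have hrequired := (measurable_requiredGain p Tc j i).comp hforget
  have hbarrier := measurable_nexp.comp ((measurable_totalBarrier p j i).comp hforget)
  exact Measurable.mul (f := (_ ∩ _ : Set _).indicator 1)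
    (measurable_one.indicator (hlink.inter (measurableSet_le hrequired hgain))) hbarrier

variable {Ω : Type*} {S : Network Ω} {i : ℕ} {ω : Ω}

lemma fading_eq_gain (p : Params) (S : Network Ω) (i : ℕ) (ω : Ω) :
    fading p S i ω = gain (S.mark i ω) (link p S i ω) := by
  rw [fading]
  cases link p S i ω <;> rfl

lemma rpow_neg_mul_rpow_eq_zero_or_one {r : ℝ} (hr : 0 ≤ r) (a : ℝ) :
    r ^ (-a) * r ^ a = 0 ∨ r ^ (-a) * r ^ a = 1 := by
  rw [Real.rpow_neg hr]
  rcases eq_or_ne (r ^ a) 0 with h | h <;> simp [h]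

lemma pathLoss_mul_rpow_le (hp : p.IsAdmissible) (S : Network Ω) (i : ℕ) (ω : Ω) :
    pathLoss p S i ω * ‖S.loc i ω‖ ^ p.expo (link p S i ω) ≤ p.coef (link p S i ω) := by
  rw [pathLoss, mul_assoc]
  refine mul_le_of_le_one_right (hp.coef_pos _).le ?_
  rcases rpow_neg_mul_rpow_eq_zero_or_one (norm_nonneg (S.loc i ω)) (p.expo (link p S i ω))
    with h | h <;> simp [h]

lemma totalBarrier_eq_zero_of_serves (hp : p.IsAdmissible) (hserve : Serves p S i ω) :
    totalBarrier p (link p S i ω) i (fun k => S.loc k ω) (fun k => S.mark k ω) = 0 := by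
  refine ENNReal.tsum_eq_zero.2 fun k => if_pos ?_
  rw [max_eq_left (norm_nonneg _)]
  exact (mul_le_mul_of_nonneg_right (hserve k) (Real.rpow_nonneg (norm_nonneg _) _)).trans
    (pathLoss_mul_rpow_le hp S i ω)

lemma interferenceNoise_eq_interference_add (p : Params) (S : Network Ω) (i : ℕ) (ω : Ω) :
    interferenceNoise p i (fun k => S.loc k ω) (fun k => S.mark k ω) =
      interference p S i ω + ENNReal.ofReal p.N0 := by
  simp only [interference, fading_eq_gain]
  rfl

lemma requiredGain_le_of_le_sinr (hp : p.IsAdmissible) {Tc : ℝ}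
    (hsinr : ENNReal.ofReal Tc ≤ sinr p S i ω) :
    requiredGain p Tc (link p S i ω) i (fun k => S.loc k ω) (fun k => S.mark k ω) ≤
      ENNReal.ofReal (gain (S.mark i ω) (link p S i ω)) := by
  have hphi := hp.phi_pos
  have hPt := hp.Pt_pos
  have hMs := hp.Ms_pos
  have hcoef := hp.coef_pos (link p S i ω)
  have hnoise : ENNReal.ofReal p.N0 ≠ 0 := (ENNReal.ofReal_pos.2 hp.N0_pos).ne'
  rw [sinr, ENNReal.le_div_iff_mul_le (Or.inl (by simp [hnoise])) (Or.inr ENNReal.ofReal_ne_top),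
    ← interferenceNoise_eq_interference_add, fading_eq_gain] at hsinr
  rw [requiredGain]
  set r := ‖S.loc i ω‖ with hr
  set j := link p S i ω with hj
  set g := gain (S.mark i ω) j
  set I := interferenceNoise p i (fun k => S.loc k ω) (fun k => S.mark k ω)
  let q := r ^ p.expo j / (p.phi * p.Pt * p.Ms * p.coef j)
  have hq : 0 ≤ q := div_nonneg (Real.rpow_nonneg (norm_nonneg _) _) (by positivity)
  calc ENNReal.ofReal (gainFactor p Tc j r) * I
      = ENNReal.ofReal q * (ENNReal.ofReal Tc * I) := by
        rw [← mul_assoc, ← ENNReal.ofReal_mul hq, gainFactor, mul_comm q, mul_div_assoc]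
    _ ≤ ENNReal.ofReal q *
        ENNReal.ofReal (p.phi * p.Pt * p.Ms * g * pathLoss p S i ω) := by gcongr
    _ = ENNReal.ofReal (g * (r ^ (-p.expo j) * r ^ p.expo j)) := by
        rw [← ENNReal.ofReal_mul hq, pathLoss, ← hj, ← hr]
        congr 1
        simp only [q]
        field_simp
    _ ≤ ENNReal.ofReal g := by
        rcases rpow_neg_mul_rpow_eq_zero_or_one (norm_nonneg (S.loc i ω)) (p.expo j)
          with h | h <;> simp [r, h]

lemma connIndicator_eq_one (hp : p.IsAdmissible) {Tc : ℝ} (hserve : Serves p S i ω)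
    (hsinr : ENNReal.ofReal Tc ≤ sinr p S i ω) :
    connIndicator p Tc (link p S i ω) i (fun k => S.loc k ω) (S.mark i ω)
      (fun k => S.mark k ω) = 1 := by
  rw [connIndicator, totalBarrier_eq_zero_of_serves hp hserve, nexp_zero, mul_one]
  refine indicator_of_mem (f := (1 : Mark → ℝ≥0∞)) ?_
  exact ⟨rfl, requiredGain_le_of_le_sinr hp hsinr⟩

end Connection

section Bound

variable {p : Params}

lemma lintegral_indicator_link_gain (hp : p.IsAdmissible) (t : ℝ) (j : Link) {A : Set ℝ}
    (hA : MeasurableSet A) :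
    ∫⁻ m, {m' | markLink p t m' = j ∧ gain m' j ∈ A}.indicator 1 m ∂markLaw p =
      ENNReal.ofReal (linkProb p t j) * gammaMeasure (p.nak j) 1 A := by
  classical
  let G : Link → Sector → ℝ → ℝ≥0∞ := fun k _ h => if k = j then A.indicator 1 h else 0
  have hG : ∀ k s, Measurable (G k s) := fun k _ =>
    Measurable.ite (.const (k = j)) (measurable_one.indicator hA) measurable_const
  have hmark : ∀ m, {m' | markLink p t m' = j ∧ gain m' j ∈ A}.indicator 1 m =
      G (markLink p t m) (markSector p m) (gain m (markLink p t m)) := fun m => by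
    by_cases hm : markLink p t m = j <;> simp [G, hm, indicator]
  rw [lintegral_congr hmark, lintegral_markLaw hp.C_nonneg hp.C_le_one hp.one_le_nak
    hp.thetab_nonneg hp.thetab_le t hG, Finset.sum_eq_single j (by simp +contextual [G]) (by simp)]
  simp only [G, if_true, lintegral_indicator_one hA]
  rw [← Finset.mul_sum, ← Finset.sum_mul, sum_sectorProb hp.thetab_nonneg hp.thetab_le, one_mul]

/-- Bound for the conditional probability of a connection through the base station `i` over a link
of type `j`, given the locations of all base stations and the marks of the others. -/
def condBound (p : Params) (Tc : ℝ) (j : Link) (i : ℕ) (x : ℕ → Plane)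
    (m : {k : ℕ // k ≠ i} → Mark) : ℝ≥0∞ :=
  ENNReal.ofReal (linkProb p ‖x i‖ j) * (nexp (totalBarrier p j i x m) *
    (1 - (1 - nexp (ENNReal.ofReal (alzer p j) * requiredGain p Tc j i x m)) ^ p.nak j))

lemma measurable_condBound (p : Params) (Tc : ℝ) (j : Link) (i : ℕ) :
    Measurable fun z : (ℕ → Plane) × ({k : ℕ // k ≠ i} → Mark) => condBound p Tc j i z.1 z.2 := by
  have hlink : Measurable fun z : (ℕ → Plane) × ({k : ℕ // k ≠ i} → Mark) =>
      ENNReal.ofReal (linkProb p ‖z.1 i‖ j) :=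
    ((measurable_linkProb p j).comp (by fun_prop)).ennreal_ofReal
  have hgain := measurable_nexp.comp
    ((measurable_requiredGain p Tc j i).const_mul (ENNReal.ofReal (alzer p j)))
  exact hlink.mul ((measurable_nexp.comp (measurable_totalBarrier p j i)).mul
    (measurable_const.sub ((measurable_const.sub hgain).pow_const _)))

lemma lintegral_connIndicator_le (hp : p.IsAdmissible) (Tc : ℝ) (j : Link) (i : ℕ)
    (x : ℕ → Plane) (m : {k : ℕ // k ≠ i} → Mark) :
    ∫⁻ m₀, connIndicator p Tc j i x m₀ m ∂markLaw p ≤ condBound p Tc j i x m := by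
  let A : Set ℝ := {h | requiredGain p Tc j i x m ≤ ENNReal.ofReal h}
  have hA : MeasurableSet A := measurableSet_le measurable_const ENNReal.measurable_ofReal
  calc ∫⁻ m₀, connIndicator p Tc j i x m₀ m ∂markLaw p
      = ENNReal.ofReal (linkProb p ‖x i‖ j) * gammaMeasure (p.nak j) 1 A *
          nexp (totalBarrier p j i x m) := by
        rw [← lintegral_indicator_link_gain hp _ j hA]
        exact lintegral_mul_const' _ _ (nexp_ne_top _)
    _ ≤ condBound p Tc j i x m := by
        rw [condBound, mul_assoc, mul_comm (nexp _)]
        gcongr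
        exact gammaMeasure_nak_tail_le (hp.one_le_nak j) _

/-- One term of the binomial expansion of `condBound`. -/
def rivalTerm (p : Params) (j : Link) (c : ℝ) (i : ℕ) (x : ℕ → Plane)
    (m : {k : ℕ // k ≠ i} → Mark) : ℝ≥0∞ :=
  ENNReal.ofReal (linkProb p ‖x i‖ j) * nexp (ENNReal.ofReal (c * ‖x i‖ ^ p.expo j * p.N0)) *
    nexp (∑' k : {k : ℕ // k ≠ i}, rivalExponent p j c (‖x i‖, x k, m k))

lemma measurable_weight (p : Params) (j : Link) (c : ℝ) : Measurable fun r : ℝ =>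
    ENNReal.ofReal (linkProb p r j) * nexp (ENNReal.ofReal (c * r ^ p.expo j * p.N0)) :=
  (measurable_linkProb p j).ennreal_ofReal.mul (measurable_nexp.comp (by fun_prop))

lemma measurable_rivalTerm (p : Params) (j : Link) (c : ℝ) (i : ℕ) :
    Measurable fun z : (ℕ → Plane) × ({k : ℕ // k ≠ i} → Mark) => rivalTerm p j c i z.1 z.2 := by
  have hnorm : Measurable fun z : (ℕ → Plane) × ({k : ℕ // k ≠ i} → Mark) => ‖z.1 i‖ := by
    fun_prop
  refine ((measurable_weight p j c).comp hnorm).mul (measurable_nexp.comp ?_)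
  exact Measurable.tsum fun k => (measurable_rivalExponent p j c).comp
    (f := fun z : (ℕ → Plane) × ({k : ℕ // k ≠ i} → Mark) => (‖z.1 i‖, z.1 k, z.2 k))
    (by fun_prop)

lemma rivalTerm_Theta (hp : p.IsAdmissible) {Tc : ℝ} (hTc : 0 ≤ Tc) (j : Link) (n i : ℕ)
    (x : ℕ → Plane) (m : {k : ℕ // k ≠ i} → Mark) :
    rivalTerm p j (Theta p Tc j n) i x m =
      ENNReal.ofReal (linkProb p ‖x i‖ j) * nexp (totalBarrier p j i x m) *
        nexp (ENNReal.ofReal (alzer p j) * requiredGain p Tc j i x m) ^ n := by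
  have hr : 0 ≤ ‖x i‖ := norm_nonneg _
  have hgain := gainFactor_nonneg hp hTc j hr
  have halzer := (alzer_pos p j).le
  have hTheta : Theta p Tc j n * ‖x i‖ ^ p.expo j = n * (alzer p j * gainFactor p Tc j ‖x i‖) := by
    rw [Theta, gainFactor]
    ring
  simp only [rivalTerm, rivalExponent, requiredGain, totalBarrier, interferenceNoise,
    max_eq_left hr, hTheta]
  rw [ENNReal.tsum_add, ENNReal.tsum_mul_left, ENNReal.ofReal_mul (by positivity),
    ENNReal.ofReal_mul (by positivity), ENNReal.ofReal_natCast, ENNReal.ofReal_mul halzer,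
    ← nexp_natCast_mul, mul_assoc, mul_assoc (ENNReal.ofReal (linkProb p ‖x i‖ j)), ← nexp_add,
    ← nexp_add]
  congr 2
  ring

lemma condBound_add_sum_rivalTerm (hp : p.IsAdmissible) {Tc : ℝ} (hTc : 0 ≤ Tc) (j : Link)
    (i : ℕ) (x : ℕ → Plane) (m : {k : ℕ // k ≠ i} → Mark) :
    condBound p Tc j i x m + ∑ n ∈ Finset.Icc 1 (p.nak j) with Even n,
        ((p.nak j).choose n : ℝ≥0∞) * rivalTerm p j (Theta p Tc j n) i x m =
      ∑ n ∈ Finset.Icc 1 (p.nak j) with ¬ Even n,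
        ((p.nak j).choose n : ℝ≥0∞) * rivalTerm p j (Theta p Tc j n) i x m := by
  simp_rw [rivalTerm_Theta hp hTc, mul_left_comm _ (_ * _), ← Finset.mul_sum]
  rw [← one_sub_one_sub_pow_add_sum_even _ (nexp_le_one _), condBound, mul_add, ← mul_assoc,
    mul_assoc]

end Bound

section Model

variable {Ω : Type*} [MeasurableSpace Ω] {P : Measure Ω} {p : Params} {S : Network Ω}

lemma measurable_comp_loc_marks (hS : IsModel p P S) {i : ℕ}
    {f : (ℕ → Plane) × ({k : ℕ // k ≠ i} → Mark) → ℝ≥0∞} (hf : Measurable f) :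
    Measurable fun ω => f (fun k => S.loc k ω, fun k => S.mark k ω) :=
  hf.comp ((measurable_pi_lambda _ hS.poisson.measurable).prodMk
    (measurable_pi_lambda _ fun k => hS.measurable_mark k))

lemma lintegral_connIndicator_le_lintegral [IsProbabilityMeasure P] (hS : IsModel p P S)
    (hp : p.IsAdmissible) (Tc : ℝ) (j : Link) (i : ℕ) :
    ∫⁻ ω, connIndicator p Tc j i (fun k => S.loc k ω) (S.mark i ω) (fun k => S.mark k ω) ∂P ≤
      ∫⁻ ω, condBound p Tc j i (fun k => S.loc k ω) (fun k => S.mark k ω) ∂P := by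
  have hloc := measurable_pi_lambda _ hS.poisson.measurable
  have hmark := measurable_pi_lambda _ hS.measurable_mark
  have hconn := (measurable_connIndicator p Tc j i).comp
    (f := fun z : (ℕ → Plane) × (ℕ → Mark) => (z.1, z.2 i, fun k : {k : ℕ // k ≠ i} => z.2 k))
    (by fun_prop)
  have hbound := (measurable_condBound p Tc j i).comp
    (f := fun z : (ℕ → Plane) × (ℕ → Mark) => (z.1, fun k : {k : ℕ // k ≠ i} => z.2 k))
    (by fun_prop)
  refine (lintegral_comp_of_indepFun hloc hmark hS.indep_loc_mark hconn).trans_le ?_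
  refine le_of_le_of_eq (lintegral_mono fun ω => ?_)
    (lintegral_comp_of_indepFun hloc hmark hS.indep_loc_mark hbound).symm
  refine (lintegral_mark_eq_lintegral_lintegral hS.measurable_mark hS.hasLaw_mark hS.iIndep_mark i
    ((measurable_connIndicator p Tc j i).comp
      (measurable_prodMk_left (x := fun k => S.loc k ω)))).trans_le ?_
  exact lintegral_mono fun ω' => lintegral_connIndicator_le hp Tc j i _ _

lemma measure_one_le_connIndicator_le (hS : IsModel p P S) (Tc : ℝ) (j : Link) (i : ℕ) :
    P {ω | 1 ≤ connIndicator p Tc j i (fun k => S.loc k ω) (S.mark i ω) (fun k => S.mark k ω)} ≤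
      ∫⁻ ω, connIndicator p Tc j i (fun k => S.loc k ω) (S.mark i ω) (fun k => S.mark k ω) ∂P := by
  have hconn := (measurable_connIndicator p Tc j i).comp
    ((measurable_pi_lambda _ hS.poisson.measurable).prodMk ((hS.measurable_mark i).prodMk
      (measurable_pi_lambda _ fun k : {k : ℕ // k ≠ i} => hS.measurable_mark k)))
  exact (one_mul _).ge.trans (mul_meas_ge_le_lintegral₀ hconn.aemeasurable 1)

lemma measure_conn_le_tsum [IsProbabilityMeasure P] (hS : IsModel p P S) (hp : p.IsAdmissible)
    (Tc : ℝ) :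
    P {ω | ∃ i, Serves p S i ω ∧ ENNReal.ofReal Tc ≤ sinr p S i ω} ≤
      ∑ j, ∑' i, ∫⁻ ω, condBound p Tc j i (fun k => S.loc k ω) (fun k => S.mark k ω) ∂P := by
  have hsub : {ω | ∃ i, Serves p S i ω ∧ ENNReal.ofReal Tc ≤ sinr p S i ω} ⊆ ⋃ j : Link, ⋃ i : ℕ,
      {ω | 1 ≤ connIndicator p Tc j i (fun k => S.loc k ω) (S.mark i ω)
        (fun k => S.mark k ω)} := by
    rintro ω ⟨i, hserve, hsinr⟩
    exact mem_iUnion₂.2 ⟨link p S i ω, i, (connIndicator_eq_one hp hserve hsinr).ge⟩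
  refine (measure_mono hsub).trans ((measure_iUnion_le _).trans ?_)
  rw [tsum_fintype]
  refine Finset.sum_le_sum fun j _ => (measure_iUnion_le _).trans (ENNReal.tsum_le_tsum fun i => ?_)
  exact (measure_one_le_connIndicator_le hS Tc j i).trans
    (lintegral_connIndicator_le_lintegral hS hp Tc j i)

end Model

section AlternatingSum

lemma sum_neg_one_pow_succ_mul {R : Type*} [CommRing R] (s : Finset ℕ) (f : ℕ → R) :
    ∑ n ∈ s, (-1) ^ (n + 1) * f n = ∑ n ∈ s with ¬ Even n, f n - ∑ n ∈ s with Even n, f n := by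
  have hterm : ∀ n, (-1) ^ (n + 1) * f n = if Even n then -f n else f n := fun n => by
    split_ifs with hn
    · rw [hn.add_one.neg_one_pow, neg_one_mul]
    · rw [(Nat.not_even_iff_odd.1 hn).add_one.neg_one_pow, one_mul]
  simp_rw [hterm]
  rw [Finset.sum_ite, Finset.sum_neg_distrib, neg_add_eq_sub]

lemma toReal_eq_alternating_sum {s : Finset ℕ} {B : ℝ≥0∞} {f : ℕ → ℝ≥0∞} (hf : ∀ n, f n ≠ ⊤)
    (h : B + ∑ n ∈ s with Even n, f n = ∑ n ∈ s with ¬ Even n, f n) :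
    B ≠ ⊤ ∧ B.toReal = ∑ n ∈ s, (-1) ^ (n + 1) * (f n).toReal := by
  have hsum : ∀ u : Finset ℕ, ∑ n ∈ u, f n ≠ ⊤ := fun u => ENNReal.sum_ne_top.2 fun n _ => hf n
  have hB : B ≠ ⊤ := ne_top_of_le_ne_top (hsum _) (le_self_add.trans h.le)
  have hreal := congrArg ENNReal.toReal h
  rw [ENNReal.toReal_add hB (hsum _), ENNReal.toReal_sum fun n _ => hf n,
    ENNReal.toReal_sum fun n _ => hf n] at hreal
  rw [sum_neg_one_pow_succ_mul]
  exact ⟨hB, eq_sub_of_add_eq hreal⟩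

lemma tsum_lintegral_add_sum {Ω ι κ : Type*} [MeasurableSpace Ω] {P : Measure Ω} {b : κ → ℝ≥0∞}
    {A : ι → Ω → ℝ≥0∞} {T : κ → ι → Ω → ℝ≥0∞} (hA : ∀ i, Measurable (A i))
    (hT : ∀ n i, Measurable (T n i)) {s t : Finset κ}
    (h : ∀ i ω, A i ω + ∑ n ∈ s, b n * T n i ω = ∑ n ∈ t, b n * T n i ω) :
    ∑' i, ∫⁻ ω, A i ω ∂P + ∑ n ∈ s, b n * ∑' i, ∫⁻ ω, T n i ω ∂P =
      ∑ n ∈ t, b n * ∑' i, ∫⁻ ω, T n i ω ∂P := by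
  have hsum : ∀ u : Finset κ, ∑ n ∈ u, b n * ∑' i, ∫⁻ ω, T n i ω ∂P =
      ∑' i, ∫⁻ ω, ∑ n ∈ u, b n * T n i ω ∂P := by
    intro u
    simp_rw [lintegral_finsetSum u fun n _ => (hT n _).const_mul (b n),
      lintegral_const_mul _ (hT _ _)]
    rw [Summable.tsum_finsetSum fun _ _ => ENNReal.summable]
    simp_rw [ENNReal.tsum_mul_left]
  rw [hsum, hsum, ← ENNReal.tsum_add]
  simp_rw [← lintegral_add_left (hA _), h]

end AlternatingSum

section Density

variable {p : Params}

/-- Density of the distance to the serving base station on the event that its link has type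
`j`. -/
def servingDensity (p : Params) (j : Link) (r : ℝ) : ℝ :=
  2 * Real.pi * p.lam * r * linkProb p r j * Real.exp (-strongerMean p j r)

/-- `servingDensity`, weighted with the Laplace transform of interference and noise at the
argument `c * r ^ p.expo j`. -/
def laplaceDensity (p : Params) (j : Link) (c r : ℝ) : ℝ :=
  servingDensity p j r * (Real.exp (-(c * r ^ p.expo j * p.N0)) * ∏ s, rivalFactor p j c r s)

lemma servingDensity_nonneg (hp : p.IsAdmissible) (j : Link) {r : ℝ} (hr : 0 ≤ r) :
    0 ≤ servingDensity p j r := by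
  have hlink := linkProb_nonneg hp.C_nonneg hp.C_le_one r j
  have hlam := hp.lam_pos
  unfold servingDensity
  positivity

lemma sq_le_add_strongerMean (hp : p.IsAdmissible) {j : Link} {r : ℝ} (hr : 0 ≤ r)
    (hlink : linkProb p r j ≠ 0) :
    Real.pi * p.lam * r ^ 2 ≤ Real.pi * p.lam * p.D ^ 2 + strongerMean p j r := by
  have hlam := hp.lam_pos
  have hC := hp.C_nonneg
  have hlos : 0 ≤ p.C * min (equalLossDist p j Link.los r) p.D ^ 2 := by positivity
  have hsq : r ^ 2 ≤ p.D ^ 2 + (p.C * min (equalLossDist p j Link.los r) p.D ^ 2 +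
      (equalLossDist p j Link.nlos r ^ 2 -
        p.C * min (equalLossDist p j Link.nlos r) p.D ^ 2)) := by
    cases j with
    | los =>
      have hrD : r ≤ p.D := not_lt.1 fun hlt => hlink (if_neg hlt.not_ge)
      have hnlos := mul_min_sq_le_sq hp (equalLossDist_nonneg hp.coef_pos .los .nlos hr)
      linarith [pow_le_pow_left₀ hr hrD 2]
    | nlos =>
      rw [equalLossDist_self hp.coef_pos hp.expo_pos]
      linarith [mul_sq_le_sq hp (le_min hr hp.D_pos.le) (min_le_right r p.D)]
  rw [strongerMean, ← mul_add]
  gcongr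

lemma servingDensity_le (hp : p.IsAdmissible) (j : Link) {r : ℝ} (hr : 0 ≤ r) :
    servingDensity p j r ≤ 2 * Real.pi * p.lam * Real.exp (Real.pi * p.lam * p.D ^ 2) *
      (r * Real.exp (-(Real.pi * p.lam) * r ^ 2)) := by
  have hlam := hp.lam_pos
  have hexp : linkProb p r j * Real.exp (-strongerMean p j r) ≤
      Real.exp (Real.pi * p.lam * p.D ^ 2) * Real.exp (-(Real.pi * p.lam) * r ^ 2) := by
    by_cases hlink : linkProb p r j = 0
    · rw [hlink, zero_mul]
      positivity
    rw [← Real.exp_add]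
    refine (mul_le_of_le_one_left (Real.exp_pos _).le
      (linkProb_le_one hp.C_nonneg hp.C_le_one r j)).trans (Real.exp_le_exp.2 ?_)
    linarith [sq_le_add_strongerMean hp hr hlink]
  calc servingDensity p j r
      = 2 * Real.pi * p.lam * r * (linkProb p r j * Real.exp (-strongerMean p j r)) :=
        mul_assoc _ _ _
    _ ≤ 2 * Real.pi * p.lam * r * (Real.exp (Real.pi * p.lam * p.D ^ 2) *
        Real.exp (-(Real.pi * p.lam) * r ^ 2)) := by gcongr
    _ = _ := by ring

/-- The mean of `rivalTerm` given a base station at distance `r`. -/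
def rivalTermMean (p : Params) (j : Link) (c r : ℝ) : ℝ≥0∞ :=
  ENNReal.ofReal (linkProb p r j) * nexp (ENNReal.ofReal (c * r ^ p.expo j * p.N0)) *
    nexp (∫⁻ y, (1 - ∫⁻ m, nexp (rivalExponent p j c (r, y, m)) ∂markLaw p)
      ∂(ENNReal.ofReal p.lam • (volume : Measure Plane)))

lemma ofReal_laplaceDensity (hp : p.IsAdmissible) (j : Link) {c r : ℝ} (hc : 0 ≤ c)
    (hr : 0 ≤ r) :
    ENNReal.ofReal (laplaceDensity p j c r) =
      ENNReal.ofReal (2 * Real.pi * p.lam * r) * rivalTermMean p j c r := by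
  have hlink := linkProb_nonneg hp.C_nonneg hp.C_le_one r j
  have hlam := hp.lam_pos
  have hN0 := hp.N0_pos
  rw [rivalTermMean, nexp_lintegral_rivals hp j hc hr, nexp_ofReal (by positivity),
    ← ENNReal.ofReal_mul hlink, ← ENNReal.ofReal_mul (by positivity),
    ← ENNReal.ofReal_mul (by positivity), laplaceDensity, servingDensity]
  congr 1
  ring

lemma isProbabilityMeasure_markLaw (hnak : ∀ j, 1 ≤ p.nak j) :
    IsProbabilityMeasure (markLaw p) := by
  have huniform := isProbabilityMeasure_uniformLaw (a := 0) (b := 1) (by norm_num)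
  have hangle := isProbabilityMeasure_uniformLaw (a := -180) (b := 180) (by norm_num)
  have hfading := isProbabilityMeasure_fading hnak
  have hlos := hfading Link.los
  have hnlos := hfading Link.nlos
  unfold markLaw
  infer_instance

lemma measurable_rivalTermMean (hnak : ∀ j, 1 ≤ p.nak j) (j : Link) (c : ℝ) :
    Measurable (rivalTermMean p j c) := by
  have := isProbabilityMeasure_markLaw hnak
  have hmark : Measurable fun z : ℝ × Plane =>
      ∫⁻ m, nexp (rivalExponent p j c (z.1, z.2, m)) ∂markLaw p :=
    Measurable.lintegral_prod_right'
      (f := fun z : (ℝ × Plane) × Mark => nexp (rivalExponent p j c (z.1.1, z.1.2, z.2)))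
      (measurable_nexp.comp ((measurable_rivalExponent p j c).comp (by fun_prop)))
  have hplane : Measurable fun r : ℝ =>
      ∫⁻ y, (1 - ∫⁻ m, nexp (rivalExponent p j c (r, y, m)) ∂markLaw p)
        ∂(ENNReal.ofReal p.lam • (volume : Measure Plane)) :=
    Measurable.lintegral_prod_right' (f := fun z : ℝ × Plane =>
      1 - ∫⁻ m, nexp (rivalExponent p j c (z.1, z.2, m)) ∂markLaw p) (measurable_const.sub hmark)
  exact (measurable_weight p j c).mul (measurable_nexp.comp hplane)

lemma laplaceDensity_nonneg (hp : p.IsAdmissible) (j : Link) (c : ℝ) {r : ℝ} (hr : 0 ≤ r) :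
    0 ≤ laplaceDensity p j c r :=
  mul_nonneg (servingDensity_nonneg hp j hr)
    (mul_nonneg (Real.exp_pos _).le (Finset.prod_nonneg fun s _ => rivalFactor_nonneg p j c r s))

lemma laplaceDensity_le (hp : p.IsAdmissible) (j : Link) {c r : ℝ} (hc : 0 ≤ c) (hr : 0 ≤ r) :
    laplaceDensity p j c r ≤ servingDensity p j r := by
  have hN0 := hp.N0_pos
  refine mul_le_of_le_one_right (servingDensity_nonneg hp j hr) (mul_le_one₀ ?_ ?_ ?_)
  · exact Real.exp_le_one_iff.2 (neg_nonpos.2 (by positivity))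
  · exact Finset.prod_nonneg fun s _ => rivalFactor_nonneg p j c r s
  · exact Finset.prod_le_one (fun s _ => rivalFactor_nonneg p j c r s)
      fun s _ => rivalFactor_le_one p j c r s

lemma aestronglyMeasurable_laplaceDensity (hp : p.IsAdmissible) (j : Link) {c : ℝ} (hc : 0 ≤ c) :
    AEStronglyMeasurable (laplaceDensity p j c) (volume.restrict (Ioi 0)) := by
  have hmeas : Measurable fun r : ℝ =>
      (ENNReal.ofReal (2 * Real.pi * p.lam * r) * rivalTermMean p j c r).toReal :=
    (Measurable.mul (by fun_prop) (measurable_rivalTermMean hp.one_le_nak j c)).ennreal_toReal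
  refine hmeas.aestronglyMeasurable.congr ((ae_restrict_mem measurableSet_Ioi).mono fun r hr => ?_)
  simp only [← ofReal_laplaceDensity hp j hc hr.le,
    ENNReal.toReal_ofReal (laplaceDensity_nonneg hp j c hr.le)]

lemma integrableOn_laplaceDensity (hp : p.IsAdmissible) (j : Link) {c : ℝ} (hc : 0 ≤ c) :
    IntegrableOn (laplaceDensity p j c) (Ioi 0) := by
  have hgauss := (integrable_mul_exp_neg_mul_sq (mul_pos Real.pi_pos hp.lam_pos)).const_mul
    (2 * Real.pi * p.lam * Real.exp (Real.pi * p.lam * p.D ^ 2))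
  refine hgauss.integrableOn.mono' (aestronglyMeasurable_laplaceDensity hp j hc)
    ((ae_restrict_mem measurableSet_Ioi).mono fun r hr => ?_)
  rw [Real.norm_of_nonneg (laplaceDensity_nonneg hp j c hr.le)]
  exact (laplaceDensity_le hp j hc hr.le).trans (servingDensity_le hp j hr.le)

lemma Theta_nonneg (hp : p.IsAdmissible) {Tc : ℝ} (hTc : 0 ≤ Tc) (j : Link) (n : ℕ) :
    0 ≤ Theta p Tc j n := by
  have hcoef := hp.coef_pos j
  have hPt := hp.Pt_pos
  have hMs := hp.Ms_pos
  have hphi := hp.phi_pos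
  have halzer := alzer_pos p j
  unfold Theta
  positivity

/-- Weighted density of the connection over links of type `j`, which the binomial expansion splits
into an alternating sum. -/
def connDensity (p : Params) (Tc : ℝ) (j : Link) (r : ℝ) : ℝ :=
  ∑ n ∈ Finset.Icc 1 (p.nak j), (-1 : ℝ) ^ (n + 1) * ((p.nak j).choose n : ℝ) *
    laplaceDensity p j (Theta p Tc j n) r

lemma integrableOn_connDensity (hp : p.IsAdmissible) {Tc : ℝ} (hTc : 0 ≤ Tc) (j : Link) :
    IntegrableOn (connDensity p Tc j) (Ioi 0) :=
  integrable_finsetSum _ fun n _ =>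
    (integrableOn_laplaceDensity hp j (Theta_nonneg hp hTc j n)).const_mul _

lemma integral_connDensity (hp : p.IsAdmissible) {Tc : ℝ} (hTc : 0 ≤ Tc) (j : Link) :
    ∫ r in Ioi 0, connDensity p Tc j r =
      ∑ n ∈ Finset.Icc 1 (p.nak j), (-1 : ℝ) ^ (n + 1) * ((p.nak j).choose n : ℝ) *
        ∫ r in Ioi 0, laplaceDensity p j (Theta p Tc j n) r := by
  simp only [connDensity]
  rw [integral_finsetSum _ fun n _ =>
    (integrableOn_laplaceDensity hp j (Theta_nonneg hp hTc j n)).const_mul _]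
  simp_rw [integral_const_mul]

end Density

section Average

variable {Ω : Type*} [MeasurableSpace Ω] {P : Measure Ω} [IsProbabilityMeasure P] {p : Params}
  {S : Network Ω}

lemma tsum_lintegral_rivalTerm (hS : IsModel p P S) (hp : p.IsAdmissible) (j : Link) {c : ℝ}
    (hc : 0 ≤ c) :
    ∑' i, ∫⁻ ω, rivalTerm p j c i (fun k => S.loc k ω) (fun k => S.mark k ω) ∂P =
      ENNReal.ofReal (∫ r in Ioi 0, laplaceDensity p j c r) := by
  have : SigmaFinite (ENNReal.ofReal p.lam • (volume : Measure Plane)) :=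
    inferInstanceAs (SigmaFinite (p.lam.toNNReal • (volume : Measure Plane)))
  have hmecke := hS.poisson.mecke_marked hS.measurable_mark hS.hasLaw_mark hS.iIndep_mark
    hS.indep_loc_mark (measurable_rivalExponent p j c)
    (rivalExponent_monotone hp.coef_pos hp.expo_pos j hc) measurable_norm
    (measure_norm_preimage_singleton p.lam) ((measurable_weight p j c).comp measurable_norm)
  rw [ofReal_integral_eq_lintegral_ofReal (integrableOn_laplaceDensity hp j hc)
    ((ae_restrict_mem measurableSet_Ioi).mono fun r hr => laplaceDensity_nonneg hp j c hr.le)]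
  refine hmecke.trans ((lintegral_radial hp.lam_pos.le
    (measurable_rivalTermMean hp.one_le_nak j c)).trans ?_)
  exact setLIntegral_congr_fun measurableSet_Ioi fun r hr =>
    (ofReal_laplaceDensity hp j hc hr.le).symm

lemma tsum_lintegral_condBound (hS : IsModel p P S) (hp : p.IsAdmissible) {Tc : ℝ} (hTc : 0 ≤ Tc)
    (j : Link) :
    ∑' i, ∫⁻ ω, condBound p Tc j i (fun k => S.loc k ω) (fun k => S.mark k ω) ∂P ≠ ⊤ ∧
    (∑' i, ∫⁻ ω, condBound p Tc j i (fun k => S.loc k ω) (fun k => S.mark k ω) ∂P).toReal =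
      ∫ r in Ioi 0, connDensity p Tc j r := by
  have hbound : ∀ i, Measurable fun ω =>
      condBound p Tc j i (fun k => S.loc k ω) (fun k => S.mark k ω) := fun i =>
    measurable_comp_loc_marks hS (measurable_condBound p Tc j i)
  have hterm : ∀ n i, Measurable fun ω =>
      rivalTerm p j (Theta p Tc j n) i (fun k => S.loc k ω) (fun k => S.mark k ω) := fun n i =>
    measurable_comp_loc_marks hS (measurable_rivalTerm p j _ i)
  have hsum := tsum_lintegral_add_sum (P := P) (b := fun n => ((p.nak j).choose n : ℝ≥0∞))
    hbound hterm fun i ω => condBound_add_sum_rivalTerm hp hTc j i _ _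
  simp_rw [tsum_lintegral_rivalTerm hS hp j (Theta_nonneg hp hTc j _)] at hsum
  obtain ⟨hfinite, hreal⟩ := toReal_eq_alternating_sum
    (fun n => ENNReal.mul_ne_top (ENNReal.natCast_ne_top _) ENNReal.ofReal_ne_top) hsum
  refine ⟨hfinite, hreal.trans ?_⟩
  rw [integral_connDensity hp hTc]
  refine Finset.sum_congr rfl fun n _ => ?_
  rw [ENNReal.toReal_mul, ENNReal.toReal_natCast, mul_assoc, ENNReal.toReal_ofReal]
  exact setIntegral_nonneg measurableSet_Ioi fun r hr => laplaceDensity_nonneg hp j _ hr.le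

lemma connProb_le (hS : IsModel p P S) (hp : p.IsAdmissible) {Tc : ℝ} (hTc : 0 ≤ Tc) :
    connProb p S P Tc ≤ ∑ j, ∫ r in Ioi 0, connDensity p Tc j r := by
  have hbound := tsum_lintegral_condBound hS hp hTc
  have hfinite := fun j (_ : j ∈ Finset.univ) => (hbound j).1
  refine (ENNReal.toReal_mono (ENNReal.sum_ne_top.2 hfinite)
    (measure_conn_le_tsum hS hp Tc)).trans_eq ?_
  rw [ENNReal.toReal_sum hfinite]
  exact Finset.sum_congr rfl fun j _ => (hbound j).2

end Average

section EqualLoss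

variable {p : Params}

lemma toNlos_eq (p : Params) (r : ℝ) : toNlos p r = equalLossDist p Link.los Link.nlos r := rfl

lemma toLos_eq (p : Params) (r : ℝ) : toLos p r = equalLossDist p Link.nlos Link.los r := rfl

lemma equalLossDist_equalLossDist (hcoef : ∀ j, 0 < p.coef j) (hexpo : ∀ j, 0 < p.expo j)
    (j k : Link) {r : ℝ} (hr : 0 ≤ r) :
    equalLossDist p k j (equalLossDist p j k r) = r := by
  have hdist := equalLossDist_nonneg hcoef j k hr
  rw [← Real.rpow_left_inj (equalLossDist_nonneg hcoef k j hdist) hr (hexpo j).ne',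
    equalLossDist_rpow hcoef hexpo k j hdist, equalLossDist_rpow hcoef hexpo j k hr]
  have hj := (hcoef j).ne'
  have hk := (hcoef k).ne'
  field_simp

lemma equalLossDist_mono (hcoef : ∀ j, 0 < p.coef j) (hexpo : ∀ j, 0 < p.expo j)
    (j k : Link) {r s : ℝ} (hr : 0 ≤ r) (hrs : r ≤ s) :
    equalLossDist p j k r ≤ equalLossDist p j k s := by
  have hexpo' := div_pos (hexpo j) (hexpo k)
  have hcoef' := div_pos (hcoef k) (hcoef j)
  unfold equalLossDist
  gcongr

lemma toNlos_D_le (hp : p.IsAdmissible) (hLN : p.coef Link.nlos * p.D ^ (-p.expo Link.nlos) ≤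
    p.coef Link.los * p.D ^ (-p.expo Link.los)) : toNlos p p.D ≤ p.D := by
  have hD := hp.D_pos
  rw [Real.rpow_neg hD.le, Real.rpow_neg hD.le, ← div_eq_mul_inv, ← div_eq_mul_inv,
    div_le_div_iff₀ (Real.rpow_pos_of_pos hD _) (Real.rpow_pos_of_pos hD _)] at hLN
  rw [toNlos_eq, ← Real.rpow_le_rpow_iff (equalLossDist_nonneg hp.coef_pos _ _ hD.le) hD.le
    (hp.expo_pos Link.nlos), equalLossDist_rpow hp.coef_pos hp.expo_pos _ _ hD.le,
    div_mul_eq_mul_div, div_le_iff₀ (hp.coef_pos _)]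
  exact hLN.trans_eq (mul_comm _ _)

lemma toLos_toNlos (hp : p.IsAdmissible) {r : ℝ} (hr : 0 ≤ r) : toLos p (toNlos p r) = r :=
  equalLossDist_equalLossDist hp.coef_pos hp.expo_pos Link.los Link.nlos hr

lemma toLos_le_D (hp : p.IsAdmissible) {r : ℝ} (hr : 0 ≤ r) (hrD : r ≤ toNlos p p.D) :
    toLos p r ≤ p.D :=
  (equalLossDist_mono hp.coef_pos hp.expo_pos Link.nlos Link.los hr hrD).trans_eq
    (toLos_toNlos hp hp.D_pos.le)

lemma D_le_toLos (hp : p.IsAdmissible) {r : ℝ} (hrD : toNlos p p.D ≤ r) : p.D ≤ toLos p r :=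
  (toLos_toNlos hp hp.D_pos.le).symm.trans_le (equalLossDist_mono hp.coef_pos hp.expo_pos
    Link.nlos Link.los (equalLossDist_nonneg hp.coef_pos _ _ hp.D_pos.le) hrD)

lemma continuous_toLos (hexpo : ∀ j, 0 < p.expo j) : Continuous (toLos p) :=
  continuous_const.mul (Real.continuous_rpow_const (div_pos (hexpo _) (hexpo _)).le)

end EqualLoss

section Association

variable {p : Params}

lemma assocN_pos (hp : p.IsAdmissible) : 0 < assocN p := by
  have hlam := hp.lam_pos
  have hC₀ := hp.C_nonneg
  have hC₁ := sub_nonneg.2 hp.C_le_one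
  refine add_pos_of_nonneg_of_pos (intervalIntegral.integral_nonneg
    (equalLossDist_nonneg hp.coef_pos Link.los Link.nlos hp.D_pos.le) fun x ⟨hx, hxD⟩ => ?_)
    (Real.exp_pos _)
  have htoLos : 0 ≤ toLos p x := equalLossDist_nonneg hp.coef_pos _ _ hx
  have hexp : 0 ≤ Real.exp (-(Real.pi * p.C * p.lam * toLos p x ^ 2)) -
      Real.exp (-(Real.pi * p.C * p.lam * p.D ^ 2)) := by
    have hle := toLos_le_D hp hx hxD
    rw [sub_nonneg]
    gcongr
  positivity

lemma integral_two_mul_mul_exp_neg_mul_sq (b t : ℝ) :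
    ∫ x in (0 : ℝ)..t, 2 * b * x * Real.exp (-(b * x ^ 2)) = 1 - Real.exp (-(b * t ^ 2)) := by
  have hderiv : ∀ x : ℝ, HasDerivAt (fun x => -Real.exp (-(b * x ^ 2)))
      (2 * b * x * Real.exp (-(b * x ^ 2))) x := fun x =>
    (((hasDerivAt_pow 2 x).const_mul b).fun_neg.exp.fun_neg).congr_deriv (by push_cast; ring)
  rw [intervalIntegral.integral_eq_sub_of_hasDerivAt (fun x _ => hderiv x)
    (Continuous.intervalIntegrable (by fun_prop) _ _)]
  rw [zero_pow two_ne_zero, mul_zero, neg_zero, Real.exp_zero]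
  ring

lemma assocN_le (hp : p.IsAdmissible) :
    assocN p ≤ (1 - Real.exp (-(Real.pi * p.C * p.lam * p.D ^ 2))) *
      (1 - Real.exp (-(Real.pi * (1 - p.C) * p.lam * toNlos p p.D ^ 2))) +
        Real.exp (-(Real.pi * p.C * p.lam * p.D ^ 2)) := by
  have hlam := hp.lam_pos
  have hC₀ := hp.C_nonneg
  have hC₁ := sub_nonneg.2 hp.C_le_one
  have hcont := continuous_toLos hp.expo_pos
  rw [← integral_two_mul_mul_exp_neg_mul_sq (Real.pi * (1 - p.C) * p.lam),
    ← intervalIntegral.integral_const_mul]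
  refine add_le_add_left (intervalIntegral.integral_mono_on
    (equalLossDist_nonneg hp.coef_pos Link.los Link.nlos hp.D_pos.le)
    (Continuous.intervalIntegrable (by fun_prop) _ _)
    (Continuous.intervalIntegrable (by fun_prop) _ _) fun x ⟨hx, _⟩ => ?_) _
  have hle : Real.exp (-(Real.pi * p.C * p.lam * toLos p x ^ 2)) ≤ 1 :=
    Real.exp_le_one_iff.2 (neg_nonpos.2 (by positivity))
  calc _ ≤ (1 - Real.exp (-(Real.pi * p.C * p.lam * p.D ^ 2))) *
        (2 * Real.pi * (1 - p.C) * p.lam * x) *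
          Real.exp (-(Real.pi * (1 - p.C) * p.lam * x ^ 2)) := by gcongr
    _ = _ := by ring

lemma assocL_pos (hp : p.IsAdmissible) (hC : 0 < p.C) : 0 < assocL p := by
  have hlam := hp.lam_pos
  have hD := hp.D_pos
  have hlt : Real.exp (-(Real.pi * p.C * p.lam * p.D ^ 2)) < 1 :=
    Real.exp_lt_one_iff.2 (neg_lt_zero.2 (by positivity))
  have hmul := mul_pos (sub_pos.2 hlt)
    (Real.exp_pos (-(Real.pi * (1 - p.C) * p.lam * toNlos p p.D ^ 2)))
  have hle := assocN_le hp
  unfold assocL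
  linarith

lemma pdfL_eq (hp : p.IsAdmissible) (hμ : toNlos p p.D ≤ p.D) {r : ℝ} (hr : r ∈ Ioc 0 p.D) :
    pdfL p r = servingDensity p Link.los r / assocL p := by
  have hle : toNlos p r ≤ p.D :=
    (equalLossDist_mono hp.coef_pos hp.expo_pos Link.los Link.nlos hr.1.le hr.2).trans hμ
  have hlink : linkProb p r Link.los = p.C := if_pos hr.2
  have hexp : Real.exp (-((1 - p.C) * p.lam * Real.pi * toNlos p r ^ 2)) *
      Real.exp (-(p.C * p.lam * Real.pi * r ^ 2)) =
        Real.exp (-strongerMean p Link.los r) := by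
    rw [← Real.exp_add, strongerMean, equalLossDist_self hp.coef_pos hp.expo_pos, ← toNlos_eq,
      min_eq_left hr.2, min_eq_left hle]
    ring_nf
  rw [pdfL, servingDensity, hlink, ← hexp]
  ring

lemma pdfN_eq_of_lt (hp : p.IsAdmissible) {r : ℝ} (hr : 0 < r) (hrD : r < p.D) :
    pdfN p r = servingDensity p Link.nlos r / assocN p := by
  have hlink : linkProb p r Link.nlos = 1 - p.C := by rw [linkProb, losProb, if_pos hrD.le]
  have hvoid : Real.exp (-(Real.pi * p.lam * r ^ 2)) *
      Real.exp (Real.pi * p.C * p.lam * (r ^ 2 - p.D ^ 2)) =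
        Real.exp (-((1 - p.C) * p.lam * Real.pi * r ^ 2)) *
          Real.exp (-(p.C * p.lam * Real.pi * p.D ^ 2)) := by
    rw [← Real.exp_add, ← Real.exp_add]
    ring_nf
  have hstronger : Real.exp (-strongerMean p Link.nlos r) =
      Real.exp (-((1 - p.C) * p.lam * Real.pi * r ^ 2)) *
        Real.exp (-(p.C * p.lam * Real.pi * min (toLos p r) p.D ^ 2)) := by
    rw [← Real.exp_add, strongerMean, equalLossDist_self hp.coef_pos hp.expo_pos, ← toLos_eq,
      min_eq_left hrD.le]
    ring_nf
  rw [pdfN, servingDensity, hlink, hstronger, if_pos hrD.le, if_neg hrD.not_ge]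
  by_cases hrμ : r ≤ toNlos p p.D
  · rw [if_pos hrμ, min_eq_left (toLos_le_D hp hr.le hrμ)]
    linear_combination (2 * Real.pi * p.lam * r * (1 - p.C) / assocN p) * hvoid
  · rw [if_neg hrμ, min_eq_right (D_le_toLos hp (not_le.1 hrμ).le)]
    linear_combination (2 * Real.pi * p.lam * r * (1 - p.C) / assocN p) * hvoid

lemma pdfN_eq_of_gt (hp : p.IsAdmissible) (hμ : toNlos p p.D ≤ p.D) {r : ℝ} (hrD : p.D < r) :
    pdfN p r = servingDensity p Link.nlos r / assocN p := by
  have hlink : linkProb p r Link.nlos = 1 := by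
    rw [linkProb, losProb, if_neg hrD.not_ge, sub_zero]
  have hstronger : strongerMean p Link.nlos r = Real.pi * p.lam * r ^ 2 := by
    rw [strongerMean, equalLossDist_self hp.coef_pos hp.expo_pos, ← toLos_eq, min_eq_right hrD.le,
      min_eq_right (D_le_toLos hp (hμ.trans hrD.le))]
    ring
  rw [pdfN, servingDensity, hlink, hstronger, if_neg hrD.not_ge, if_pos hrD.le,
    if_neg (hμ.trans_lt hrD).not_ge]
  ring

lemma XiL_mul_pdfL (hp : p.IsAdmissible) (hμ : toNlos p p.D ≤ p.D) (Tc : ℝ) {r : ℝ}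
    (hr : r ∈ Ioc 0 p.D) :
    XiL p Tc r * pdfL p r = connDensity p Tc Link.los r / assocL p := by
  rw [pdfL_eq hp hμ hr, ← mul_div_assoc]
  congr 1
  simp only [XiL, connDensity, laplaceDensity, Finset.sum_mul]
  refine Finset.sum_congr rfl fun n _ => ?_
  rw [prod_sector]
  simp only [rivalFactor, varpi, toNlos_eq, equalLossDist_self hp.coef_pos hp.expo_pos,
    min_eq_left hr.2]
  ring

lemma XiN_mul_pdfN (hp : p.IsAdmissible) (hμ : toNlos p p.D ≤ p.D) (Tc : ℝ) {r : ℝ} (hr : 0 < r)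
    (hrD : r ≠ p.D) :
    XiN p Tc r * pdfN p r = connDensity p Tc Link.nlos r / assocN p := by
  have hpdf := hrD.lt_or_gt.elim (pdfN_eq_of_lt hp hr) (pdfN_eq_of_gt hp hμ)
  rw [hpdf, ← mul_div_assoc]
  congr 1
  simp only [XiN, connDensity, laplaceDensity, Finset.sum_mul]
  refine Finset.sum_congr rfl fun n _ => ?_
  rw [prod_sector]
  simp only [rivalFactor, varphi, toLos_eq, equalLossDist_self hp.coef_pos hp.expo_pos]
  ring

lemma connDensity_div_assocN_ae_eq (hp : p.IsAdmissible) (hμ : toNlos p p.D ≤ p.D) (Tc : ℝ) :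
    (fun r => connDensity p Tc Link.nlos r / assocN p) =ᵐ[volume.restrict (Ioi 0)]
      fun r => XiN p Tc r * pdfN p r := by
  filter_upwards [ae_restrict_mem measurableSet_Ioi,
    Measure.ae_ne (volume.restrict (Ioi 0)) p.D] with r hr hrD
  exact (XiN_mul_pdfN hp hμ Tc hr hrD).symm

lemma integrableOn_XiL_mul_pdfL (hp : p.IsAdmissible) (hμ : toNlos p p.D ≤ p.D) {Tc : ℝ}
    (hTc : 0 ≤ Tc) : IntegrableOn (fun r => XiL p Tc r * pdfL p r) (Ioc 0 p.D) :=
  IntegrableOn.congr_fun (((integrableOn_connDensity hp hTc Link.los).mono_set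
    Ioc_subset_Ioi_self).div_const _) (fun _ hr => (XiL_mul_pdfL hp hμ Tc hr).symm)
    measurableSet_Ioc

lemma integrableOn_XiN_mul_pdfN (hp : p.IsAdmissible) (hμ : toNlos p p.D ≤ p.D) {Tc : ℝ}
    (hTc : 0 ≤ Tc) : IntegrableOn (fun r => XiN p Tc r * pdfN p r) (Ioi 0) :=
  ((integrableOn_connDensity hp hTc Link.nlos).div_const _).congr
    (connDensity_div_assocN_ae_eq hp hμ Tc)

lemma connDensity_eq_zero {Tc : ℝ} {j : Link} {r : ℝ} (hlink : linkProb p r j = 0) :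
    connDensity p Tc j r = 0 := by
  simp [connDensity, laplaceDensity, servingDensity, hlink]

lemma assocL_mul_integral (hp : p.IsAdmissible) (hμ : toNlos p p.D ≤ p.D) (Tc : ℝ) :
    assocL p * (∫ r in Ioc 0 p.D, XiL p Tc r * pdfL p r) =
      ∫ r in Ioi 0, connDensity p Tc Link.los r := by
  have hball : ∫ r in Ioi 0, connDensity p Tc Link.los r =
      ∫ r in Ioc 0 p.D, connDensity p Tc Link.los r :=
    setIntegral_eq_of_subset_of_forall_sdiff_eq_zero measurableSet_Ioi Ioc_subset_Ioi_self
      fun r hr => connDensity_eq_zero (if_neg fun hrD => hr.2 ⟨hr.1, hrD⟩)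
  rw [hball, setIntegral_congr_fun measurableSet_Ioc fun r hr => XiL_mul_pdfL hp hμ Tc hr,
    integral_div]
  rcases hp.C_nonneg.eq_or_lt with hC | hC
  · have hzero : ∫ r in Ioc 0 p.D, connDensity p Tc Link.los r = 0 :=
      setIntegral_eq_zero_of_forall_eq_zero fun r _ => connDensity_eq_zero <| by
        simp [linkProb, losProb, ← hC]
    rw [hzero, zero_div, mul_zero]
  · exact mul_div_cancel₀ _ (assocL_pos hp hC).ne'

lemma assocN_mul_integral (hp : p.IsAdmissible) (hμ : toNlos p p.D ≤ p.D) (Tc : ℝ) :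
    assocN p * (∫ r in Ioi 0, XiN p Tc r * pdfN p r) =
      ∫ r in Ioi 0, connDensity p Tc Link.nlos r := by
  rw [← integral_congr_ae (connDensity_div_assocN_ae_eq hp hμ Tc), integral_div]
  exact mul_div_cancel₀ _ (assocN_pos hp).ne'

end Association

end MmWave

end

theorem theorem6 {Ω : Type*} [MeasurableSpace Ω] (P : MeasureTheory.Measure Ω)
    [MeasureTheory.IsProbabilityMeasure P]
    (p : MmWave.Params) (S : MmWave.Network Ω) (hS : MmWave.IsModel p P S)
    (hlam : 0 < p.lam) (hC₀ : 0 ≤ p.C) (hC₁ : p.C ≤ 1) (hD : 0 < p.D)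
    (hcoef : ∀ j, 0 < p.coef j) (hexpo : ∀ j, 0 < p.expo j) (hnak : ∀ j, 1 ≤ p.nak j)
    -- at distance `D`, a LOS link is at least as strong as a NLOS link
    (hLN : p.coef MmWave.Link.nlos * p.D ^ (-p.expo MmWave.Link.nlos) ≤
      p.coef MmWave.Link.los * p.D ^ (-p.expo MmWave.Link.los))
    (hPt : 0 < p.Pt) (hMs : 0 < p.Ms) (hMa : 0 ≤ p.Ma)
    (hphi₀ : 0 < p.phi) (hphi₁ : p.phi ≤ 1) (hthetab₀ : 0 ≤ p.thetab) (hthetab₁ : p.thetab ≤ 180)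
    (hN0 : 0 < p.N0) (Tc : ℝ) (hTc : 0 < Tc) :
    MeasureTheory.IntegrableOn (fun r => MmWave.XiL p Tc r * MmWave.pdfL p r) (Set.Ioc 0 p.D) ∧
    MeasureTheory.IntegrableOn (fun r => MmWave.XiN p Tc r * MmWave.pdfN p r) (Set.Ioi 0) ∧
    MmWave.connProb p S P Tc ≤
      MmWave.assocL p * (∫ r in Set.Ioc 0 p.D, MmWave.XiL p Tc r * MmWave.pdfL p r) +
      MmWave.assocN p * (∫ r in Set.Ioi 0, MmWave.XiN p Tc r * MmWave.pdfN p r) := by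
  have hp : p.IsAdmissible := ⟨hlam, hC₀, hC₁, hD, hcoef, hexpo, hnak, hPt, hMs, hMa, hphi₀, hphi₁,
    hthetab₀, hthetab₁, hN0⟩
  have hμ := MmWave.toNlos_D_le hp hLN
  refine ⟨MmWave.integrableOn_XiL_mul_pdfL hp hμ hTc.le,
    MmWave.integrableOn_XiN_mul_pdfN hp hμ hTc.le, ?_⟩
  rw [MmWave.assocL_mul_integral hp hμ, MmWave.assocN_mul_integral hp hμ]
  exact (MmWave.connProb_le hS hp hTc.le).trans_eq (MmWave.sum_link _)
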